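/- Let $\Bbbk$ be a field and $A=\Bbbk[x_1,\dots,x_n]$, with the standard grading. For a homogeneous ideal $\mathfrak c$ of $A$ and a homogeneous ideal $J$ of $A/\mathfrak c$ let $H_J=\sum_t(\dim_\Bbbk J_t)\,\mathfrak z^t$ be the Hilbert series of $J$, and let $\mathcal H_{A/\mathfrak c}$ be the set of the Hilbert series of all homogeneous ideals of $A/\mathfrak c$. For a homogeneous ideal $I$ of $A$ put $\beta^A_{i,j}(I)=\dim_\Bbbk\operatorname{Tor}^A_i(I,\Bbbk)_j$. A lex-segment ideal of $A$ is a monomial ideal $L$ such that, whenever $u,v$ are monomials of the same degree with $u\in L$ and $v>u$ in the lexicographic order with $x_1>\dots>x_n$, also $v\in L$. Let $\mathbf f=f_1,\dots,f_c$ be an $A$-regular sequence of homogeneous polynomials of degrees $e_1\le\dots\le e_c$; put $\mathfrak a=(f_1,\dots,f_c)$ and $\mathfrak b=(x_1^{e_1},\dots,x_c^{e_c})$. We say that $\mathbf f$ satisfies the Eisenbud–Green–Harris (EGH) conjecture if $\mathcal H_{A/\mathfrak a}\subseteq\mathcal H_{A/\mathfrak b}$. We say that $\mathbf f$ satisfies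 the lex-plus-powers (LPP) conjecture if the following holds: if $\mathbf f$ satisfies the EGH conjecture, $I$ is a homogeneous ideal of $A$ containing $\mathbf f$, and $L$ is a lex-segment ideal of $A$ such that $I(A/\mathfrak a)$ and $L(A/\mathfrak b)$ have the same Hilbert series, then $\beta^A_{i,j}(I)\le\beta^A_{i,j}(L+\mathfrak b)$ for all $i,j$. The same definitions apply over every field and in every number of variables. **Theorem 4.1.** Let $K$ be an extension field of $\Bbbk$. 1. Let $g$ be an invertible linear change of coordinates of $K[x_1,\dots,x_n]$ such that $g(f_1),\dots,g(f_c),x_{c+1},\dots,x_n$ is a regular sequence in $K[x_1,\dots,x_n]$, and let $\overline{\mathbf f}=\overline f_1,\dots,\overline f_c$ in $K[x_1,\dots,x_c]$ be the image of $g(f_1),\dots,g(f_c)$ modulo $x_{c+1},\dots,x_n$. If $\overline{\mathbf f}$ satisfies the EGH and the LPP conjectures, then so does $\mathbf f$. 2. Consequently both conjectures together reduce to the Artinian case: if $K$ is infinite and every homogeneous regular sequence of degrees $e_1,\dots,e_c$ in $K[x_1,\dots,x_c]$ satisfies the EGH and the LPP conjectures, then $\mathbf f$ satisfies the EGH and the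 LPP conjectures. -/

import Mathlib

universe u v

namespace LexPlusPowers

noncomputable section

open MvPolynomial

attribute [local instance] MvPolynomial.gradedAlgebra

variable {k : Type u} [Field k] {n c : ℕ}

/-- The homogeneous ideals of `k[x₁, …, xₙ]` (standard grading, all variables of degree one). -/
def IsHomogeneousIdeal (I : Ideal (MvPolynomial (Fin n) k)) : Prop :=
  I.IsHomogeneous (homogeneousSubmodule (Fin n) k)

/-- The homogeneous ideals of the quotient `A ⧸ a` of `A = k[x₁, …, xₙ]` by a homogeneous ideal
`a`: those whose preimage in `A` is homogeneous. -/
def IsHomogeneousQuotIdeal (a : Ideal (MvPolynomial (Fin n) k))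
    (J : Ideal (MvPolynomial (Fin n) k ⧸ a)) : Prop :=
  IsHomogeneousIdeal (J.comap (Ideal.Quotient.mk a))

/-- The Hilbert series of an ideal `J` of `A ⧸ a` (of `J` itself, not of its quotient), as the
sequence of its coefficients: `t ↦ dim_k (J ∩ (A ⧸ a)_t)`, where `(A ⧸ a)_t` is the image
of `A_t`. -/
def hilbertSeries (a : Ideal (MvPolynomial (Fin n) k))
    (J : Ideal (MvPolynomial (Fin n) k ⧸ a)) (t : ℕ) : ℕ :=
  Module.finrank k ↥(J.restrictScalars k ⊓
    (homogeneousSubmodule (Fin n) k t).map (Ideal.Quotient.mkₐ k a).toLinearMap)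

/-- The set of Hilbert series of homogeneous ideals of `A ⧸ a`. It is partially ordered
coefficientwise, by the order that it inherits from `ℕ → ℕ`. -/
def hilbertPoset (a : Ideal (MvPolynomial (Fin n) k)) : Set (ℕ → ℕ) :=
  {H | ∃ J : Ideal (MvPolynomial (Fin n) k ⧸ a),
    IsHomogeneousQuotIdeal a J ∧ H = hilbertSeries a J}

/-- The ideal `(x₁ ^ e₁, …, x_c ^ e_c)` of `k[x₁, …, xₙ]`. -/
def powerIdeal (k : Type u) [Field k] (n : ℕ) {c : ℕ} (e : Fin c → ℕ) :
    Ideal (MvPolynomial (Fin n) k) :=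
  Ideal.span {p | ∃ (i : Fin n) (j : Fin c), (i : ℕ) = (j : ℕ) ∧ p = X i ^ e j}

/-- Lex-segment ideals: monomial ideals `L` such that, in each degree, the monomials in `L` form
an initial segment (from the top) for the lexicographic order with `x₁ > x₂ > ⋯ > xₙ`. -/
def IsLexSegment (L : Ideal (MvPolynomial (Fin n) k)) : Prop :=
  (∃ S : Set (Fin n →₀ ℕ), L = Ideal.span ((fun u => monomial u (1 : k)) '' S)) ∧
    ∀ u v : Fin n →₀ ℕ, u.degree = v.degree → toLex u < toLex v →
      monomial u (1 : k) ∈ L → monomial v (1 : k) ∈ L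

/-- The differential of the Koszul complex `K(x₁, …, xₙ)` of `A = k[x₁, …, xₙ]`. A family
`φ : Finset (Fin n) → A` stands for the element `∑ S, φ S • e_S` of the exterior algebra on
`e₁, …, eₙ`, and `∂ (e_v ∧ e_T) = x_v e_T - e_v ∧ ∂ e_T`. So the coefficient of `∂ φ` at `T` is
`∑ v ∉ T, (-1) ^ #{u ∈ T | u < v} x_v φ (T ∪ {v})`. -/
def koszulD (k : Type u) [Field k] (n : ℕ) :
    (Finset (Fin n) → MvPolynomial (Fin n) k) →ₗ[k] (Finset (Fin n) → MvPolynomial (Fin n) k) :=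
  LinearMap.pi fun T => ∑ v ∈ Tᶜ,
    LinearMap.mulLeft k ((-1) ^ (T.filter (· < v)).card * X v) ∘ₗ LinearMap.proj (insert v T)

/-- The Koszul complex is a complex. -/
theorem koszulD_koszulD (φ : Finset (Fin n) → MvPolynomial (Fin n) k) :
    koszulD k n (koszulD k n φ) = 0 := by
  funext T
  simp only [koszulD, LinearMap.pi_apply, LinearMap.sum_apply, LinearMap.comp_apply,
    LinearMap.proj_apply, LinearMap.mulLeft_apply, Pi.zero_apply, Finset.mul_sum]
  rw [Finset.sum_sigma']
  refine Finset.sum_involution (fun p _ => ⟨p.2, p.1⟩) ?_ ?_ ?_ ?_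
  · rintro ⟨v, w⟩ h
    simp only [Finset.mem_sigma, Finset.mem_compl, Finset.mem_insert, not_or] at h
    obtain ⟨hv, hwv, hw⟩ := h
    have key : ∀ a b : Fin n, a ∉ T → a < b →
        ((insert a T).filter (· < b)).card = (T.filter (· < b)).card + 1 ∧
        ((insert b T).filter (· < a)).card = (T.filter (· < a)).card := by
      intro a b ha hab
      rw [Finset.filter_insert, Finset.filter_insert, if_pos hab, if_neg (not_lt.2 hab.le),
        Finset.card_insert_of_notMem (by simp [ha])]
      exact ⟨rfl, rfl⟩
    rw [Finset.insert_comm v w]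
    rcases lt_or_gt_of_ne hwv with hlt | hlt
    · obtain ⟨h1, h2⟩ := key w v hw hlt
      dsimp only
      rw [h1, h2]; ring
    · obtain ⟨h1, h2⟩ := key v w hv hlt
      dsimp only
      rw [h1, h2]; ring
  · rintro ⟨v, w⟩ h _ heq
    simp only [Finset.mem_sigma, Finset.mem_compl, Finset.mem_insert, not_or] at h
    exact h.2.1 (congrArg Sigma.fst heq)
  · rintro ⟨v, w⟩ h
    simp only [Finset.mem_sigma, Finset.mem_compl, Finset.mem_insert, not_or] at h ⊢
    exact ⟨h.2.2, fun h' => h.2.1 h'.symm, h.1⟩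
  · rintro ⟨v, w⟩ h
    rfl

/-- The part of homological degree `i` and internal degree `j` of `K(x₁, …, xₙ) ⊗ I`, for a
homogeneous ideal `I`: as `e_S` has degree `#S`, it consists of the families of elements of
`I_{j - i}`, indexed by the subsets of size `i` of the set of variables. -/
def koszulChains (I : Ideal (MvPolynomial (Fin n) k)) (i j : ℕ) :
    Submodule k (Finset (Fin n) → MvPolynomial (Fin n) k) :=
  Submodule.pi Set.univ fun S =>
    if S.card = i ∧ i ≤ j then I.restrictScalars k ⊓ homogeneousSubmodule (Fin n) k (j - i) else ⊥

/-- The cycles in `koszulChains I i j`. -/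
def koszulCycles (I : Ideal (MvPolynomial (Fin n) k)) (i j : ℕ) :
    Submodule k (Finset (Fin n) → MvPolynomial (Fin n) k) :=
  koszulChains I i j ⊓ LinearMap.ker (koszulD k n)

/-- The boundaries in `koszulChains I i j`. -/
def koszulBoundaries (I : Ideal (MvPolynomial (Fin n) k)) (i j : ℕ) :
    Submodule k (Finset (Fin n) → MvPolynomial (Fin n) k) :=
  (koszulChains I (i + 1) j).map (koszulD k n)

/-- The vector space `Tor_i^A(I, k)_j`, for a homogeneous ideal `I` of `A = k[x₁, …, xₙ]`: the
homology, in homological degree `i` and internal degree `j`, of the complex obtained by tensoring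
`I` with the graded free resolution `K(x₁, …, xₙ)` of `k = A ⧸ (x₁, …, xₙ)`. -/
abbrev GradedTor (I : Ideal (MvPolynomial (Fin n) k)) (i j : ℕ) : Type u :=
  ↥(koszulCycles I i j) ⧸ (koszulBoundaries I i j).submoduleOf (koszulCycles I i j)

/-- The graded Betti number `β_{i,j}^A(I) = dim_k Tor_i^A(I, k)_j` of a homogeneous ideal `I` of
`A = k[x₁, …, xₙ]`. -/
def gradedBetti (I : Ideal (MvPolynomial (Fin n) k)) (i j : ℕ) : ℕ :=
  Module.finrank k (GradedTor I i j)

/-- The sequence `f` (homogeneous, of degrees `e`) satisfies the Eisenbud–Green–Harris conjecture: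
every Hilbert series of a homogeneous ideal of `A ⧸ (f)` is the Hilbert series of a homogeneous
ideal of `A ⧸ (x₁ ^ e₁, …, x_c ^ e_c)`. -/
def SatisfiesEGH (f : Fin c → MvPolynomial (Fin n) k) (e : Fin c → ℕ) : Prop :=
  hilbertPoset (Ideal.span (Set.range f)) ⊆ hilbertPoset (powerIdeal k n e)

/-- The sequence `f` (homogeneous, of degrees `e`) satisfies the lex-plus-powers conjecture: if it
satisfies the Eisenbud–Green–Harris conjecture, `I` is a homogeneous ideal that contains `f`, and
`L` is the lex-segment ideal with `H_{I (A ⧸ a)} = H_{L (A ⧸ b)}`, where `a = (f)` and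
`b = (x₁ ^ e₁, …, x_c ^ e_c)`, then `β_{i,j}(I) ≤ β_{i,j}(L + b)` for all `i` and `j`. -/
def SatisfiesLPP (f : Fin c → MvPolynomial (Fin n) k) (e : Fin c → ℕ) : Prop :=
  SatisfiesEGH f e →
    ∀ I L : Ideal (MvPolynomial (Fin n) k),
      IsHomogeneousIdeal I → (∀ i, f i ∈ I) → IsLexSegment L →
      hilbertSeries (Ideal.span (Set.range f))
          (I.map (Ideal.Quotient.mk (Ideal.span (Set.range f)))) =
        hilbertSeries (powerIdeal k n e) (L.map (Ideal.Quotient.mk (powerIdeal k n e))) →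
      ∀ i j : ℕ, gradedBetti I i j ≤ gradedBetti (L ⊔ powerIdeal k n e) i j

/-- The linear change of coordinates `x_j ↦ ∑ i, g i j x_i` of `k[x₁, …, xₙ]`. -/
def changeCoords (g : GL (Fin n) k) : MvPolynomial (Fin n) k →ₐ[k] MvPolynomial (Fin n) k :=
  aeval fun j => ∑ i, C ((g : Matrix (Fin n) (Fin n) k) i j) * X i

/-- The variables `x_{c+1}, …, xₙ` of `k[x₁, …, xₙ]`, in this order. -/
def lastVars (k : Type u) [Field k] (n c : ℕ) : List (MvPolynomial (Fin n) k) :=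
  ((List.finRange n).filter fun i : Fin n => c ≤ i.val).map X

/-- Reduction modulo `x_{c+1}, …, xₙ`, as a map `k[x₁, …, xₙ] → k[x₁, …, x_c]`. -/
def modLastVars (k : Type u) [Field k] (n c : ℕ) :
    MvPolynomial (Fin n) k →ₐ[k] MvPolynomial (Fin c) k :=
  aeval fun i => if h : (i : ℕ) < c then X ⟨i, h⟩ else 0

end

end LexPlusPowers

/-!
The heart of the matter is a hyperplane section. Let `A = k[x₁, …, x_{m+1}]`, write `z` for the last
variable, and let `𝔞` be a homogeneous ideal such that both `𝔞` and its image `𝔞'` modulo `z` have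
the Hilbert function of the ideal of powers in their respective rings. Then both conjectures pass
from `𝔞'` to `𝔞`.

Write a form as a sequence of coefficients of powers of `z`. An ideal `I ⊇ 𝔞` has an initial
degeneration with respect to `z`, which consists of layers `J 0 ⊆ J 1 ⊆ ⋯` of forms in the first `m`
variables, each of them containing `𝔞'` (`idealLayers`, `map_modLastVars_le_idealLayers`). By the
growth bound for `𝔞'`, in each layer the initial lex segments of the right sizes are closed under
multiplication by variables modulo the powers. Glued together, they form a set of monomials that is
closed under shadows, and the Clements–Lindström theorem (`card_shadow_le`) yields the growth bound
for `𝔞` (`LexGrowth.lift`). This bound is equivalent to the Eisenbud–Green–Harris property.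

Betti numbers are compared through the ranks of the Koszul differential on the chains with
coefficients in one degree of an ideal: the Hilbert function and these ranks determine them
(`gradedBetti_add`), and the ranks do not increase under initial degenerations
(`kRank_seqs_lead_le`). Degenerate `I` further, by repeatedly replacing, in the powers of `z` with
exponent greater than some `a`, one factor `z` by `z - x_v` and taking layers again, until the family
is stable: `x_v J (a + 1) ⊆ J a` (`IsLayered.exists_stable`). This works over every field. The Koszul
ranks of `I` are then bounded below by its Hilbert function and by the ranks of the bottom layer
(`kRank_seqOp_ge`). For a lex-plus-powers ideal, which is already stable, the same expression is an
upper bound (`IsLexSegment.polyRank_le`). Since its bottom layer is contained in the lex-plus-powers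
ideal with the Hilbert function of the bottom layer of `I` (`map_layerCoeff_zero_le`), the inequality
in `m` variables gives the one in `m + 1` variables (`LexBetti.lift`).

Regularity enters through Hilbert functions only: a sequence of forms of positive degrees is regular
if and only if the Hilbert function of its quotient is as small as possible
(`regularOn_of_quotHilb_le`). If `g(f), x_{c+1}, …, xₙ` is a regular sequence, then the reductions of
`g(f)` modulo any number of last variables have the Hilbert function of the ideal of powers
(`quotHilb_map_modLastVars_of_regularOn`), so that the hyperplane sections apply one after another.
Hilbert functions and Koszul ranks do not change under field extensions and linear changes of
coordinates, which takes the conclusion from `g(f)` over `K` back to `f` over `k`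
(`satisfies_of_extension`).

For the reduction to the Artinian case it remains to find `g`. A quotient by a regular sequence of
fewer than `n` forms has no socle, since its Koszul homology vanishes in degree `n`
(`mem_of_forall_X_mul_mem`). So no associated prime contains all variables, and over an infinite field
some linear form avoids the associated primes (`exists_linForm_regular`). Successive choices give
`n - c` independent linear forms, which a linear change of coordinates moves to `x_{c+1}, …, xₙ`.
-/

namespace LexPlusPowers

open MvPolynomial

attribute [local instance] MvPolynomial.gradedAlgebra

/-! ### Shadows of lexicographic segments of monomials with bounded exponents -/

section Combinatorics

variable {σ : Type*}

theorem eq_of_le_of_degree_eq {u q : σ →₀ ℕ} (h : u ≤ q) (hd : u.degree = q.degree) : u = q := by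
  obtain ⟨r, rfl⟩ := exists_add_of_le h
  have : r.degree = 0 := by
    rw [map_add] at hd; omega
  rw [Finsupp.degree_eq_zero_iff] at this
  simp [this]

theorem degree_add_single (u : σ →₀ ℕ) (i : σ) :
    (u + Finsupp.single i 1).degree = u.degree + 1 := by
  rw [map_add, Finsupp.degree_single]

theorem degree_sub_single {u : σ →₀ ℕ} {i : σ} (h : 0 < u i) :
    (u - Finsupp.single i 1).degree + 1 = u.degree := by
  rw [← degree_add_single, tsub_add_cancel_of_le]
  rwa [Finsupp.single_le_iff]

variable [LinearOrder σ]

theorem lex_lt_iff {u q : σ →₀ ℕ} :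
    toLex u < toLex q ↔ ∃ i, (∀ j < i, u j = q j) ∧ u i < q i := Iff.rfl

/-- The monomials of degree `t` in the variables of `s` in which the exponent of each variable `i`
is less than `e i`. -/
def stdMon (e : σ → ℕ) (s : Finset σ) (t : ℕ) : Finset (σ →₀ ℕ) :=
  (s.finsuppAntidiag t).filter fun u => ∀ i ∈ s, u i < e i

theorem mem_stdMon {e : σ → ℕ} {s : Finset σ} {t : ℕ} {u : σ →₀ ℕ} :
    u ∈ stdMon e s t ↔ u.degree = t ∧ (∀ i ∉ s, u i = 0) ∧ ∀ i ∈ s, u i < e i := by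
  have h : u.support ⊆ s ↔ ∀ i ∉ s, u i = 0 := by
    simp only [Finset.subset_iff, Finsupp.mem_support_iff]
    exact ⟨fun h i hi => by_contra fun h' => hi (h h'), fun h i hi => by_contra fun h' => hi (h i h')⟩
  rw [stdMon, Finset.mem_filter, Finset.mem_finsuppAntidiag', h]
  constructor
  · rintro ⟨⟨h1, h2⟩, h3⟩
    exact ⟨h1, h2, h3⟩
  · rintro ⟨h1, h2, h3⟩
    exact ⟨⟨h1, h2⟩, h3⟩

open Classical in
/-- The upper shadow of a set `W` of monomials of degree `t`: the monomials of degree `t + 1`, with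
the same bounds on the exponents, that are multiples of an element of `W`. -/
noncomputable def shadow (e : σ → ℕ) (s : Finset σ) (t : ℕ) (W : Finset (σ →₀ ℕ)) : Finset (σ →₀ ℕ) :=
  (stdMon e s (t + 1)).filter fun q => ∃ u ∈ W, ∃ i, q = u + Finsupp.single i 1

theorem mem_shadow {e : σ → ℕ} {s : Finset σ} {t : ℕ} {W : Finset (σ →₀ ℕ)} {q : σ →₀ ℕ} :
    q ∈ shadow e s t W ↔ q ∈ stdMon e s (t + 1) ∧ ∃ u ∈ W, ∃ i, q = u + Finsupp.single i 1 := by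
  classical
  rw [shadow, Finset.mem_filter]

/-- Initial segments, from the top, of a set `X` of monomials for the lexicographic order. -/
structure IsInit (X S : Finset (σ →₀ ℕ)) : Prop where
  subset : S ⊆ X
  up : ∀ u ∈ S, ∀ q ∈ X, toLex u < toLex q → q ∈ S

theorem sub_single_mem_stdMon {e : σ → ℕ} {s : Finset σ} {t : ℕ} {q : σ →₀ ℕ} {i : σ}
    (hq : q ∈ stdMon e s (t + 1)) (hi : 0 < q i) : q - Finsupp.single i 1 ∈ stdMon e s t := by
  rw [mem_stdMon] at hq ⊢
  refine ⟨by have := degree_sub_single hi; omega, fun j hj => ?_, fun j hj => ?_⟩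
  · rw [Finsupp.tsub_apply, hq.2.1 j hj, Nat.zero_sub]
  · rw [Finsupp.tsub_apply]
    exact (Nat.sub_le _ _).trans_lt (hq.2.2 j hj)

theorem add_single_mem_stdMon {e : σ → ℕ} {s : Finset σ} {t : ℕ} {u : σ →₀ ℕ} {i : σ}
    (hu : u ∈ stdMon e s t) (his : i ∈ s) (hi : u i + 1 < e i) :
    u + Finsupp.single i 1 ∈ stdMon e s (t + 1) := by
  rw [mem_stdMon] at hu ⊢
  refine ⟨by rw [degree_add_single, hu.1], fun j hj => ?_, fun j hj => ?_⟩
  · have : i ≠ j := fun h => hj (h ▸ his)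
    simp [hu.2.1 j hj, this]
  · rw [Finsupp.add_apply, Finsupp.single_apply]
    split_ifs with h
    · exact h ▸ hi
    · exact hu.2.2 j hj

/-- A monomial that is lexicographically at least a multiple `x_v u` is a multiple of a monomial
that is at least `u`. -/
theorem exists_sub_single_ge {u q : σ →₀ ℕ} {v : σ} (hd : q.degree = u.degree + 1)
    (h : toLex (u + Finsupp.single v 1) ≤ toLex q) :
    ∃ j, 0 < q j ∧ toLex u ≤ toLex (q - Finsupp.single j 1) := by
  rcases h.eq_or_lt with h | h
  · have h : u + Finsupp.single v 1 = q := h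
    subst h
    exact ⟨v, by simp, by simp⟩
  obtain ⟨i, hlt, hi⟩ := lex_lt_iff.1 h
  have key : ∀ j, 0 < q j → (∀ l < i, u l = (q - Finsupp.single j 1 : σ →₀ ℕ) l) →
      u i < (q - Finsupp.single j 1 : σ →₀ ℕ) i → ∃ j, 0 < q j ∧ toLex u ≤ toLex (q - Finsupp.single j 1) :=
    fun j h1 h2 h3 => ⟨j, h1, (lex_lt_iff.2 ⟨i, h2, h3⟩).le⟩
  simp only [Finsupp.add_apply, Finsupp.single_apply] at hlt hi
  rcases lt_trichotomy v i with hv | hv | hv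
  · refine key v (by have := hlt v hv; simp at this; omega) (fun l hl => ?_) ?_
    · have := hlt l hl
      simp only [Finsupp.tsub_apply, Finsupp.single_apply]
      omega
    · simp only [Finsupp.tsub_apply, Finsupp.single_apply, hv.ne, if_false] at hi ⊢
      omega
  · subst hv
    simp only [if_true] at hi
    refine key v (by omega) (fun l hl => ?_) ?_
    · have := hlt l hl
      simp only [Finsupp.tsub_apply, Finsupp.single_apply]
      omega
    · simp only [Finsupp.tsub_apply, Finsupp.single_apply, if_true]
      omega
  · simp only [hv.ne', if_false, add_zero] at hi
    have hlt' : ∀ l < i, u l = q l := fun l hl => by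
      have := hlt l hl
      rw [if_neg (hl.trans hv).ne'] at this
      omega
    by_cases hj : ∃ j, i < j ∧ 0 < q j
    · obtain ⟨j, hij, hj⟩ := hj
      refine key j hj (fun l hl => ?_) ?_
      · simp only [Finsupp.tsub_apply, Finsupp.single_apply, (hl.trans hij).ne', if_false]
        exact hlt' l hl
      · simp only [Finsupp.tsub_apply, Finsupp.single_apply, hij.ne', if_false]
        omega
    push Not at hj
    have hlt'' : ∀ l < i, u l = (q - Finsupp.single i 1 : σ →₀ ℕ) l := fun l hl => by
      simp only [Finsupp.tsub_apply, Finsupp.single_apply, hl.ne', if_false]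
      exact hlt' l hl
    by_cases h2 : u i + 1 < q i
    · refine key i (by omega) hlt'' ?_
      simp only [Finsupp.tsub_apply, Finsupp.single_apply, if_true]
      omega
    · have hqi : 0 < q i := by omega
      refine ⟨i, hqi, le_of_eq (congrArg toLex (eq_of_le_of_degree_eq ?_ ?_).symm)⟩
      · intro l
        rcases lt_trichotomy l i with hl | hl | hl
        · exact (hlt'' l hl).ge
        · subst hl
          simp only [Finsupp.tsub_apply, Finsupp.single_apply, if_true]
          omega
        · have := hj l hl
          simp only [Finsupp.tsub_apply]
          omega
      · have := degree_sub_single hqi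
        omega

theorem isInit_shadow {e : σ → ℕ} {s : Finset σ} {t : ℕ} {S : Finset (σ →₀ ℕ)}
    (hS : IsInit (stdMon e s t) S) : IsInit (stdMon e s (t + 1)) (shadow e s t S) := by
  refine ⟨fun q hq => (mem_shadow.1 hq).1, fun u hu q hq huq => ?_⟩
  obtain ⟨-, w, hw, v, rfl⟩ := mem_shadow.1 hu
  obtain ⟨j, hj, hle⟩ := exists_sub_single_ge
    (by rw [(mem_stdMon.1 hq).1, (mem_stdMon.1 (hS.subset hw)).1]) huq.le
  refine mem_shadow.2 ⟨hq, q - Finsupp.single j 1, ?_, j, ?_⟩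
  · rcases hle.eq_or_lt with h | h
    · rwa [← show w = q - Finsupp.single j 1 from h]
    · exact hS.up w hw _ (sub_single_mem_stdMon hq hj) h
  · rw [tsub_add_cancel_of_le]
    rwa [Finsupp.single_le_iff]

theorem shadow_mono {e : σ → ℕ} {s : Finset σ} {t : ℕ} {S W : Finset (σ →₀ ℕ)} (h : S ⊆ W) :
    shadow e s t S ⊆ shadow e s t W := fun _ hq =>
  let ⟨h1, u, hu, h2⟩ := mem_shadow.1 hq
  mem_shadow.2 ⟨h1, u, h hu, h2⟩

/-- The condition on a set of monomials that makes it, in each degree of the last variable `z`, an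
initial segment, and closed under the replacement of a factor `z` by another variable. -/
structure IsStableLex (e : σ → ℕ) (s : Finset σ) (t : ℕ) (z : σ) (W : Finset (σ →₀ ℕ)) : Prop where
  subset : W ⊆ stdMon e s t
  stable : ∀ u ∈ W, 0 < u z → ∀ v ∈ s, v ≠ z → u v + 1 < e v →
    u - Finsupp.single z 1 + Finsupp.single v 1 ∈ W
  layer : ∀ u ∈ W, ∀ q ∈ stdMon e s t, u z = q z → toLex u < toLex q → q ∈ W

theorem IsInit.isStableLex {e : σ → ℕ} {s : Finset σ} {t : ℕ} {S : Finset (σ →₀ ℕ)}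
    (hS : IsInit (stdMon e s t) S) {z : σ} (hz : ∀ i ∈ s, i ≤ z) : IsStableLex e s t z S := by
  refine ⟨hS.subset, fun u hu huz v hv hvz hve => hS.up u hu _ ?_ ?_, fun u hu q hq _ => hS.up u hu q hq⟩
  · obtain ⟨t, rfl⟩ : ∃ t', t = t' + 1 := by
      refine ⟨t - 1, ?_⟩
      have := degree_sub_single huz
      have := (mem_stdMon.1 (hS.subset hu)).1
      omega
    refine add_single_mem_stdMon (sub_single_mem_stdMon (hS.subset hu) huz) hv ?_
    rw [Finsupp.tsub_apply]
    omega
  · have hlt : v < z := lt_of_le_of_ne (hz v hv) hvz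
    refine lex_lt_iff.2 ⟨v, fun j hj => ?_, ?_⟩
    · simp [hj.ne', (hj.trans hlt).ne']
    · simp [hlt.ne']

/-- Trading factors `z` for other variables, one gets from an element of a stable set to every
lexicographically larger monomial that is not more divisible by `z`. -/
theorem IsStableLex.mem_of_lt {e : σ → ℕ} {s : Finset σ} {t : ℕ} {z : σ} {W : Finset (σ →₀ ℕ)}
    (hW : IsStableLex e s t z W) (hz : ∀ i ∈ s, i ≤ z) {u q : σ →₀ ℕ} (hu : u ∈ W)
    (hq : q ∈ stdMon e s t) (hlt : toLex u < toLex q) (hle : q z ≤ u z) : q ∈ W := by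
  obtain ⟨d, hd⟩ : ∃ d, u z - q z = d := ⟨_, rfl⟩
  induction d generalizing u with
  | zero => exact hW.layer u hu q hq (by omega) hlt
  | succ d ih =>
    obtain ⟨hdu, hsu, heu⟩ := mem_stdMon.1 (hW.subset hu)
    obtain ⟨hdq, hsq, heq⟩ := mem_stdMon.1 hq
    obtain ⟨i, hi, hiq⟩ := lex_lt_iff.1 hlt
    have his : i ∈ s := by
      by_contra h
      have := hsq i h
      omega
    have hiz : i < z := lt_of_le_of_ne (hz i his) (by rintro rfl; omega)
    -- the last variable other than `z` whose exponent can be raised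
    have hne : (s.filter fun v => v < z ∧ u v + 1 < e v).Nonempty :=
      ⟨i, Finset.mem_filter.2 ⟨his, hiz, by have := heq i his; omega⟩⟩
    obtain ⟨v, hv, hmax⟩ : ∃ v ∈ s.filter (fun v => v < z ∧ u v + 1 < e v),
        ∀ w ∈ s.filter (fun v => v < z ∧ u v + 1 < e v), w ≤ v :=
      ⟨_, Finset.max'_mem _ hne, fun w hw => Finset.le_max' _ w hw⟩
    obtain ⟨hvs, hvz, hve⟩ := Finset.mem_filter.1 hv
    have hiv : i ≤ v := hmax i (Finset.mem_filter.2 ⟨his, hiz, by have := heq i his; omega⟩)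
    have hu' := hW.stable u hu (by omega) v hvs hvz.ne hve
    set u' := u - Finsupp.single z 1 + Finsupp.single v 1 with hu'def
    have hval : ∀ j, u' j = u j - (if z = j then 1 else 0) + (if v = j then 1 else 0) := fun j => by
      rw [hu'def, Finsupp.add_apply, Finsupp.tsub_apply, Finsupp.single_apply, Finsupp.single_apply]
    have hvalz : u' z = u z - 1 := by rw [hval, if_pos rfl, if_neg hvz.ne, add_zero]
    have hpre : ∀ j < i, u' j = q j := fun j hj => by
      rw [hval, if_neg (hj.trans hiz).ne', if_neg (hj.trans_le hiv).ne']
      simpa using hi j hj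
    rcases hiv.eq_or_lt with rfl | hiv
    · have hvali : u' i = u i + 1 := by rw [hval, if_neg hiz.ne', if_pos rfl]; rfl
      rcases Nat.lt_or_ge (u i + 1) (q i) with h | h
      · exact ih hu' (lex_lt_iff.2 ⟨i, hpre, by omega⟩) (by omega) (by omega)
      · have : q = u' := by
          refine eq_of_le_of_degree_eq (fun j => ?_) ?_
          · rcases lt_trichotomy j i with hj | rfl | hj
            · exact (hpre j hj).ge
            · omega
            · by_cases hjs : j ∈ s
              · rcases (hz j hjs).eq_or_lt with rfl | hjz
                · omega
                · have h1 : ¬ (u j + 1 < e j) := fun h =>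
                    (hmax j (Finset.mem_filter.2 ⟨hjs, hjz, h⟩)).not_gt hj
                  have h2 := heq j hjs
                  rw [hval, if_neg hjz.ne', if_neg hj.ne]
                  simp only [tsub_zero, add_zero]
                  omega
              · rw [hsq j hjs]
                exact Nat.zero_le _
          · rw [hdq, (mem_stdMon.1 (hW.subset hu')).1]
        rwa [this]
    · have hvali : u' i = u i := by
        rw [hval, if_neg hiz.ne', if_neg hiv.ne']; rfl
      exact ih hu' (lex_lt_iff.2 ⟨i, hpre, by omega⟩) (by omega) (by omega)

/-- A stable set has at least as many monomials free of `z` as the initial segment of its size. -/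
theorem IsStableLex.mem_of_apply_eq_zero {e : σ → ℕ} {s : Finset σ} {t : ℕ} {z : σ}
    {W S : Finset (σ →₀ ℕ)} (hW : IsStableLex e s t z W) (hz : ∀ i ∈ s, i ≤ z)
    (hS : IsInit (stdMon e s t) S) (hc : S.card ≤ W.card) {w : σ →₀ ℕ} (hw : w ∈ S) (hwz : w z = 0) :
    w ∈ W := by
  by_contra hwW
  have hWS : W ⊂ S := by
    refine (Finset.ssubset_iff_of_subset fun u hu => ?_).2 ⟨w, hw, hwW⟩
    rcases lt_trichotomy (toLex u) (toLex w) with h | h | h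
    · exact absurd (hW.mem_of_lt hz hu (hS.subset hw) h (by omega)) hwW
    · rwa [show u = w from h]
    · exact hS.up w hw u (hW.subset hu) h
  exact (Finset.card_lt_card hWS).not_ge hc

/-- A stable set has at most as many monomials in which the exponent of `z` is maximal as the
initial segment of its size. -/
theorem IsStableLex.mem_init_of_apply_max {e : σ → ℕ} {s : Finset σ} {t : ℕ} {z : σ}
    {W S : Finset (σ →₀ ℕ)} (hW : IsStableLex e s t z W) (hzs : z ∈ s) (hz : ∀ i ∈ s, i ≤ z)
    (hS : IsInit (stdMon e s t) S) (hc : W.card ≤ S.card) {u : σ →₀ ℕ} (hu : u ∈ W)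
    (huz : ¬ u z + 1 < e z) : u ∈ S := by
  by_contra huS
  have hSW : S ⊂ W := by
    refine (Finset.ssubset_iff_of_subset fun q hq => ?_).2 ⟨u, hu, huS⟩
    have hqM := hS.subset hq
    rcases lt_trichotomy (toLex u) (toLex q) with h | h | h
    · refine hW.mem_of_lt hz hu hqM h ?_
      have := (mem_stdMon.1 hqM).2.2 z hzs
      omega
    · rwa [← show u = q from h]
    · exact absurd (hS.up q hq u (hW.subset hu) h) huS
  exact (Finset.card_lt_card hSW).not_ge hc

/-- In the shadow of a stable set, the monomials that involve `z` are exactly the products by `z`. -/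
theorem IsStableLex.card_shadow {e : σ → ℕ} {s : Finset σ} {t : ℕ} {z : σ}
    {W : Finset (σ →₀ ℕ)} (hW : IsStableLex e s t z W) (hzs : z ∈ s) :
    (shadow e s t W).card = ((shadow e s t W).filter fun q => q z = 0).card +
      (W.filter fun u => u z + 1 < e z).card := by
  classical
  rw [← Finset.card_filter_add_card_filter_not (fun q : σ →₀ ℕ => q z = 0)]
  congr 1
  rw [← Finset.card_image_of_injective (W.filter fun u => u z + 1 < e z)
    (add_left_injective (Finsupp.single z 1))]
  congr 1
  ext q
  simp only [Finset.mem_filter, Finset.mem_image]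
  constructor
  · rintro ⟨hq, hqz⟩
    obtain ⟨hqM, u, hu, i, rfl⟩ := mem_shadow.1 hq
    by_cases hiz : i = z
    · subst hiz
      refine ⟨u, ⟨hu, ?_⟩, rfl⟩
      simpa using (mem_stdMon.1 hqM).2.2 i hzs
    · have huz : 0 < u z := by
        rw [Finsupp.add_apply, Finsupp.single_apply, if_neg hiz] at hqz
        omega
      have his : i ∈ s := by
        by_contra h
        have := (mem_stdMon.1 hqM).2.1 i h
        simp at this
      have hi := (mem_stdMon.1 hqM).2.2 i his
      have hzM := (mem_stdMon.1 (hW.subset hu)).2.2 z hzs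
      refine ⟨_, ⟨hW.stable u hu huz i his hiz (by simpa using hi), ?_⟩, ?_⟩
      · simp only [Finsupp.add_apply, Finsupp.tsub_apply, Finsupp.single_apply, if_true, hiz, if_false]
        omega
      · rw [add_right_comm, tsub_add_cancel_of_le]
        rwa [Finsupp.single_le_iff]
  · rintro ⟨u, ⟨hu, huz⟩, rfl⟩
    refine ⟨mem_shadow.2 ⟨add_single_mem_stdMon (hW.subset hu) hzs huz, u, hu, z, rfl⟩, by simp⟩

/-- Among stable sets of the same size, the initial segments have the smallest shadows: they have
the fewest monomials without `z`, and the fewest that can be multiplied by `z`. -/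
theorem IsStableLex.card_shadow_le {e : σ → ℕ} {s : Finset σ} {t : ℕ} {z : σ}
    {W S : Finset (σ →₀ ℕ)} (hW : IsStableLex e s t z W) (hzs : z ∈ s) (hz : ∀ i ∈ s, i ≤ z)
    (hS : IsInit (stdMon e s t) S) (hc : S.card = W.card) :
    (shadow e s t S).card ≤ (shadow e s t W).card := by
  rw [hW.card_shadow hzs, (hS.isStableLex hz).card_shadow hzs]
  refine Nat.add_le_add (Finset.card_le_card fun q hq => ?_) ?_
  · obtain ⟨hq, hqz⟩ := Finset.mem_filter.1 hq
    obtain ⟨hqM, u, hu, i, rfl⟩ := mem_shadow.1 hq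
    refine Finset.mem_filter.2 ⟨mem_shadow.2 ⟨hqM, u, ?_, i, rfl⟩, hqz⟩
    refine hW.mem_of_apply_eq_zero hz hS hc.le hu ?_
    rw [Finsupp.add_apply] at hqz
    omega
  · have h1 := Finset.card_filter_add_card_filter_not (s := S) (fun u : σ →₀ ℕ => u z + 1 < e z)
    have h2 := Finset.card_filter_add_card_filter_not (s := W) (fun u : σ →₀ ℕ => u z + 1 < e z)
    have h3 : (W.filter fun u => ¬ u z + 1 < e z).card ≤ (S.filter fun u => ¬ u z + 1 < e z).card :=
      Finset.card_le_card fun u hu => Finset.mem_filter.2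
        ⟨hW.mem_init_of_apply_max hzs hz hS hc.ge (Finset.mem_filter.1 hu).1 (Finset.mem_filter.1 hu).2,
          (Finset.mem_filter.1 hu).2⟩
    omega

end Combinatorics

/-! ### The Clements–Lindström theorem -/

section ClementsLindstrom

variable {σ : Type*} [LinearOrder σ]

theorem exists_isInit_card (X : Finset (σ →₀ ℕ)) {r : ℕ} (hr : r ≤ X.card) :
    ∃ S, IsInit X S ∧ S.card = r := by
  classical
  obtain ⟨d, hd⟩ : ∃ d, X.card = r + d := exists_add_of_le hr
  clear hr
  induction d generalizing X with
  | zero => exact ⟨X, ⟨Finset.Subset.refl _, fun _ _ q hq _ => hq⟩, hd⟩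
  | succ d ih =>
    obtain ⟨m, hm, hmin⟩ := X.exists_min_image toLex (Finset.card_pos.1 (by omega))
    obtain ⟨S, hS, hc⟩ := ih (X.erase m) (by rw [Finset.card_erase_of_mem hm]; omega)
    refine ⟨S, ⟨hS.subset.trans (Finset.erase_subset _ _), fun u hu q hq h => hS.up u hu q ?_ h⟩, hc⟩
    refine Finset.mem_erase.2 ⟨?_, hq⟩
    rintro rfl
    exact (hmin u (Finset.mem_of_mem_erase (hS.subset hu))).not_gt h

theorem IsInit.subset_of_card_le {X S T : Finset (σ →₀ ℕ)} (hS : IsInit X S) (hT : IsInit X T)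
    (h : S.card ≤ T.card) : S ⊆ T := by
  by_contra hST
  obtain ⟨u, huS, huT⟩ := Finset.not_subset.1 hST
  have : T ⊂ S := by
    refine (Finset.ssubset_iff_of_subset fun q hq => ?_).2 ⟨u, huS, huT⟩
    rcases lt_trichotomy (toLex u) (toLex q) with h | h | h
    · exact hS.up u huS q (hT.subset hq) h
    · rwa [← show u = q from h]
    · exact absurd (hT.up q hq u (hS.subset huS) h) huT
  exact (Finset.card_lt_card this).not_ge h

/-- Among the subsets of `X` of a given size, the initial segment is the only one that minimizes
the sum of a strictly decreasing function. -/
theorem IsInit.sum_lt {X S T : Finset (σ →₀ ℕ)} {f : (σ →₀ ℕ) → ℕ}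
    (hf : ∀ u ∈ X, ∀ q ∈ X, toLex u < toLex q → f q < f u) (hS : IsInit X S) (hT : T ⊆ X)
    (h : S.card = T.card) (hne : S ≠ T) : ∑ u ∈ S, f u < ∑ u ∈ T, f u := by
  classical
  rw [← Finset.sum_inter_add_sum_sdiff S T, ← Finset.sum_inter_add_sum_sdiff T S,
    Finset.inter_comm T S]
  have hc : (S \ T).card = (T \ S).card := by
    have h1 := Finset.card_inter_add_card_sdiff S T
    have h2 := Finset.card_inter_add_card_sdiff T S
    rw [Finset.inter_comm T S] at h2
    omega
  have hpos : 0 < (S \ T).card := by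
    rw [Finset.card_pos, Finset.sdiff_nonempty]
    exact fun hST => hne (Finset.eq_of_subset_of_card_le hST h.ge)
  have hlt : ∀ u ∈ S \ T, ∀ q ∈ T \ S, f u < f q := fun u hu q hq => by
    rw [Finset.mem_sdiff] at hu hq
    refine hf q (hT hq.1) u (hS.subset hu.1) ?_
    rcases lt_trichotomy (toLex u) (toLex q) with h | h | h
    · exact absurd (hS.up u hu.1 q (hT hq.1) h) hq.2
    · exact absurd ((show u = q from h) ▸ hu.1) hq.2
    · exact h
  refine Nat.add_lt_add_left ?_ _
  obtain ⟨q, hq, hmin⟩ := (T \ S).exists_min_image f (Finset.card_pos.1 (hc ▸ hpos))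
  calc ∑ u ∈ S \ T, f u < ∑ u ∈ S \ T, f q :=
        Finset.sum_lt_sum_of_nonempty (Finset.card_pos.1 hpos) fun u hu => hlt u hu q hq
    _ = ∑ u ∈ T \ S, f q := by rw [Finset.sum_const, Finset.sum_const, hc]
    _ ≤ ∑ u ∈ T \ S, f u := Finset.sum_le_sum hmin

theorem stdMon_pair_degree {e : σ → ℕ} {x z : σ} (hxz : x ≠ z) {t : ℕ} {u : σ →₀ ℕ}
    (hu : u ∈ stdMon e {x, z} t) : u x + u z = t := by
  obtain ⟨h1, h2, -⟩ := mem_stdMon.1 hu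
  have : u = Finsupp.single x (u x) + Finsupp.single z (u z) := by
    ext i
    simp only [Finsupp.add_apply, Finsupp.single_apply]
    by_cases hx : x = i
    · subst hx; simp [hxz.symm]
    · by_cases hz : z = i
      · subst hz; simp [hxz]
      · rw [if_neg hx, if_neg hz]
        exact h2 i (by simp [Ne.symm hx, Ne.symm hz])
  rw [← h1]
  conv_rhs => rw [this, map_add, Finsupp.degree_single, Finsupp.degree_single]

theorem stdMon_pair_ext {e : σ → ℕ} {x z : σ} (hxz : x ≠ z) {t : ℕ} {u q : σ →₀ ℕ}
    (hu : u ∈ stdMon e {x, z} t) (hq : q ∈ stdMon e {x, z} t) (h : u x = q x) : u = q := by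
  have h1 := stdMon_pair_degree hxz hu
  have h2 := stdMon_pair_degree hxz hq
  ext i
  by_cases hx : i = x
  · rw [hx, h]
  · by_cases hz : i = z
    · rw [hz]; omega
    · rw [(mem_stdMon.1 hu).2.1 i (by simp [hx, hz]), (mem_stdMon.1 hq).2.1 i (by simp [hx, hz])]

/-- The Clements–Lindström theorem in two variables. -/
theorem card_shadow_le_pair {e : σ → ℕ} {x z : σ} (hxz : x < z) (he : e x ≤ e z) {t : ℕ}
    {W S : Finset (σ →₀ ℕ)} (hW : W ⊆ stdMon e {x, z} t) (hS : IsInit (stdMon e {x, z} t) S)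
    (hc : S.card = W.card) :
    (shadow e {x, z} t S).card ≤ (shadow e {x, z} t W).card := by
  classical
  have hxs : x ∈ ({x, z} : Finset σ) := by simp
  have hzs : z ∈ ({x, z} : Finset σ) := by simp
  rcases W.eq_empty_or_nonempty with rfl | hWne
  · rw [Finset.card_empty, Finset.card_eq_zero] at hc
    rw [hc]
  by_cases hWM : W = stdMon e {x, z} t
  · rw [Finset.eq_of_subset_of_card_le (hWM ▸ hS.subset) hc.ge]
  -- multiplication by `z` exhausts the shadow of `S`, up to the monomial `x ^ (t + 1)`
  have hsub : shadow e {x, z} t S ⊆ S.image (fun u => u + Finsupp.single z 1) ∪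
      (if t + 1 < e x then {Finsupp.single x (t + 1)} else ∅) := by
    intro q hq
    obtain ⟨hqM, u, hu, i, rfl⟩ := mem_shadow.1 hq
    have huM := hS.subset hu
    have hud := stdMon_pair_degree hxz.ne huM
    have hiM : i ∈ ({x, z} : Finset σ) := by
      by_contra h
      have := (mem_stdMon.1 hqM).2.1 i h
      simp at this
    rw [Finset.mem_union, Finset.mem_image]
    rcases Finset.mem_insert.1 hiM with rfl | hi
    · have hix := (mem_stdMon.1 hqM).2.2 i hxs
      rw [Finsupp.add_apply, Finsupp.single_eq_same] at hix
      rcases Nat.eq_zero_or_pos (u z) with h0 | h0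
      · right
        have hut : u = Finsupp.single i t := by
          ext j
          by_cases hj : j = i
          · subst hj; simp; omega
          · rw [Finsupp.single_apply, if_neg (Ne.symm hj)]
            by_cases hj' : j = z
            · rw [hj', h0]
            · exact (mem_stdMon.1 huM).2.1 j (by simp [hj, hj'])
        rw [if_pos (by omega), Finset.mem_singleton, hut, ← Finsupp.single_add]
      · left
        refine ⟨_, (hS.isStableLex (z := z) (by simp [hxz.le])).stable u hu h0 i hxs hxz.ne hix, ?_⟩
        rw [add_right_comm, tsub_add_cancel_of_le]
        rwa [Finsupp.single_le_iff]
    · left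
      rw [Finset.mem_singleton] at hi
      exact ⟨u, hu, by rw [hi]⟩
  have hinj : Function.Injective fun u : σ →₀ ℕ => u + Finsupp.single z 1 := add_left_injective _
  by_cases hlt : t + 1 < e x
  · rw [if_pos hlt] at hsub
    refine (Finset.card_le_card hsub).trans ((Finset.card_union_le _ _).trans ?_)
    rw [Finset.card_image_of_injective _ hinj, Finset.card_singleton, hc]
    obtain ⟨w, hw, hmax⟩ := W.exists_max_image (fun u => u x) hWne
    rw [← Finset.card_image_of_injective W hinj, ← Finset.card_insert_of_notMem
      (a := w + Finsupp.single x 1)]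
    · refine Finset.card_le_card (Finset.insert_subset ?_ ?_)
      · refine mem_shadow.2 ⟨add_single_mem_stdMon (hW hw) hxs ?_, w, hw, x, rfl⟩
        have := stdMon_pair_degree hxz.ne (hW hw)
        omega
      · intro q hq
        obtain ⟨u, hu, rfl⟩ := Finset.mem_image.1 hq
        refine mem_shadow.2 ⟨add_single_mem_stdMon (hW hu) hzs ?_, u, hu, z, rfl⟩
        have := stdMon_pair_degree hxz.ne (hW hu)
        omega
    · intro h
      obtain ⟨u, hu, h⟩ := Finset.mem_image.1 h
      have h' := DFunLike.congr_fun h x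
      have := hmax u hu
      simp [hxz.ne] at h'
      omega
  · rw [if_neg hlt, Finset.union_empty] at hsub
    refine (Finset.card_le_card hsub).trans ?_
    rw [Finset.card_image_of_injective _ hinj, hc]
    -- a monomial `j` outside `W` lets one map `W` injectively to its shadow
    obtain ⟨j, hj, hjW⟩ : ∃ j ∈ stdMon e {x, z} t, j ∉ W :=
      Finset.not_subset.1 fun h => hWM (hW.antisymm h)
    have hjd := stdMon_pair_degree hxz.ne hj
    refine Finset.card_le_card_of_injOn
      (fun u => if j x < u x then u + Finsupp.single z 1 else u + Finsupp.single x 1) ?_ ?_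
    · intro u hu
      have hud := stdMon_pair_degree hxz.ne (hW hu)
      have hne : u x ≠ j x := fun h => hjW (stdMon_pair_ext hxz.ne hj (hW hu) h.symm ▸ hu)
      dsimp only
      split_ifs with h
      · refine mem_shadow.2 ⟨add_single_mem_stdMon (hW hu) hzs ?_, u, hu, z, rfl⟩
        have := (mem_stdMon.1 hj).2.2 z hzs
        omega
      · refine mem_shadow.2 ⟨add_single_mem_stdMon (hW hu) hxs ?_, u, hu, x, rfl⟩
        have := (mem_stdMon.1 hj).2.2 x hxs
        omega
    · intro u hu q hq h
      have hne : ∀ u ∈ W, u x ≠ j x := fun u hu h =>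
        hjW (stdMon_pair_ext hxz.ne hj (hW hu) h.symm ▸ hu)
      have hu' := hne u hu
      have hq' := hne q hq
      refine stdMon_pair_ext hxz.ne (hW hu) (hW hq) ?_
      dsimp only at h
      have h' := DFunLike.congr_fun h x
      split_ifs at h' with h1 h2 h2 <;> simp [hxz.ne] at h' <;> omega

theorem lex_add_lt_add_iff {u q w : σ →₀ ℕ} :
    toLex (u + w) < toLex (q + w) ↔ toLex u < toLex q := by
  simp [lex_lt_iff]

theorem erase_add_single_of_eq {τ : Type*} {u : τ →₀ ℕ} {i : τ} {k : ℕ} (h : u i = k) :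
    u.erase i + Finsupp.single i k = u := by
  rw [← h, Finsupp.erase_add_single]

theorem erase_mem_stdMon {e : σ → ℕ} {s : Finset σ} {d k : ℕ} {u : σ →₀ ℕ} {i : σ}
    (hu : u ∈ stdMon e s (d + k)) (hk : u i = k) : u.erase i ∈ stdMon e (s.erase i) d := by
  obtain ⟨h1, h2, h3⟩ := mem_stdMon.1 hu
  refine mem_stdMon.2 ⟨?_, fun j hj => ?_, fun j hj => ?_⟩
  · have := congrArg Finsupp.degree (erase_add_single_of_eq hk)
    rw [map_add, Finsupp.degree_single, h1] at this
    omega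
  · by_cases hji : j = i
    · rw [hji, Finsupp.erase_same]
    · rw [Finsupp.erase_ne hji]
      exact h2 j fun h => hj (Finset.mem_erase.2 ⟨hji, h⟩)
  · rw [Finsupp.erase_ne (Finset.ne_of_mem_erase hj)]
    exact h3 j (Finset.mem_of_mem_erase hj)

theorem add_single_mem_stdMon_of_erase {e : σ → ℕ} {s : Finset σ} {d k : ℕ} {w : σ →₀ ℕ} {i : σ}
    (his : i ∈ s) (hk : k < e i) (hw : w ∈ stdMon e (s.erase i) d) :
    w + Finsupp.single i k ∈ stdMon e s (d + k) ∧ (w + Finsupp.single i k : σ →₀ ℕ) i = k := by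
  obtain ⟨h1, h2, h3⟩ := mem_stdMon.1 hw
  have hwi : w i = 0 := h2 i (by simp)
  refine ⟨mem_stdMon.2 ⟨by rw [map_add, Finsupp.degree_single, h1], fun j hj => ?_, fun j hj => ?_⟩,
    by simp [hwi]⟩
  · have hij : i ≠ j := fun h => hj (h ▸ his)
    simp [h2 j (fun h => hj (Finset.mem_of_mem_erase h)), hij]
  · rw [Finsupp.add_apply, Finsupp.single_apply]
    split_ifs with hij
    · rw [← hij, hwi]; omega
    · exact h3 j (Finset.mem_erase.2 ⟨Ne.symm hij, hj⟩)

/-- The slice, where `i` has exponent `k`, of the shadow of a set with the same exponent of `i`, is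
a shadow in the remaining variables. -/
theorem image_erase_shadow {e : σ → ℕ} {s : Finset σ} {d k : ℕ} {i : σ} (his : i ∈ s) (hk : k < e i)
    {W : Finset (σ →₀ ℕ)} (hW : W ⊆ (stdMon e s (d + k)).filter fun u => u i = k) :
    ((shadow e s (d + k) W).filter fun q => q i = k).image (Finsupp.erase i) =
      shadow e (s.erase i) d (W.image (Finsupp.erase i)) := by
  ext w
  simp only [Finset.mem_image, Finset.mem_filter, mem_shadow]
  constructor
  · rintro ⟨q, ⟨⟨hq, u, hu, j, rfl⟩, hqi⟩, rfl⟩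
    obtain ⟨huM, hui⟩ := Finset.mem_filter.1 (hW hu)
    have hji : i ≠ j := by
      rintro rfl
      simp at hqi
      omega
    refine ⟨erase_mem_stdMon (by rwa [add_right_comm]) hqi, u.erase i, ⟨u, hu, rfl⟩, j, ?_⟩
    rw [Finsupp.erase_add, Finsupp.erase_single_ne hji]
  · rintro ⟨hw, -, ⟨u, hu, rfl⟩, j, rfl⟩
    obtain ⟨huM, hui⟩ := Finset.mem_filter.1 (hW hu)
    have hji : i ≠ j := by
      rintro rfl
      have := (mem_stdMon.1 hw).2.1 i (by simp)
      simp at this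
    have heq : u.erase i + Finsupp.single j 1 + Finsupp.single i k = u + Finsupp.single j 1 := by
      rw [add_right_comm, erase_add_single_of_eq hui]
    obtain ⟨h1, h2⟩ := add_single_mem_stdMon_of_erase his hk hw
    rw [heq] at h1 h2
    refine ⟨u + Finsupp.single j 1, ⟨⟨by rwa [add_right_comm], u, hu, j, rfl⟩, h2⟩, ?_⟩
    rw [Finsupp.erase_add, Finsupp.erase_single_ne hji]

theorem card_image_erase {W : Finset (σ →₀ ℕ)} {i : σ} {k : ℕ} (hW : ∀ u ∈ W, u i = k) :
    (W.image (Finsupp.erase i)).card = W.card := by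
  refine Finset.card_image_of_injOn fun u hu q hq h => ?_
  rw [← erase_add_single_of_eq (hW u hu), ← erase_add_single_of_eq (hW q hq), h]

theorem IsInit.image_erase {e : σ → ℕ} {s : Finset σ} {d k : ℕ} {i : σ} (his : i ∈ s) (hk : k < e i)
    {S : Finset (σ →₀ ℕ)} (hS : IsInit ((stdMon e s (d + k)).filter fun u => u i = k) S) :
    IsInit (stdMon e (s.erase i) d) (S.image (Finsupp.erase i)) := by
  refine ⟨fun w hw => ?_, fun w hw q hq h => ?_⟩
  · obtain ⟨u, hu, rfl⟩ := Finset.mem_image.1 hw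
    obtain ⟨h1, h2⟩ := Finset.mem_filter.1 (hS.subset hu)
    exact erase_mem_stdMon h1 h2
  · obtain ⟨u, hu, rfl⟩ := Finset.mem_image.1 hw
    obtain ⟨h1, h2⟩ := Finset.mem_filter.1 (hS.subset hu)
    obtain ⟨h3, h4⟩ := add_single_mem_stdMon_of_erase his hk hq
    refine Finset.mem_image.2 ⟨q + Finsupp.single i k, hS.up u hu _
      (Finset.mem_filter.2 ⟨h3, h4⟩) ?_, ?_⟩
    · conv_lhs => rw [← erase_add_single_of_eq h2]
      rwa [lex_add_lt_add_iff]
    · rw [Finsupp.erase_add, Finsupp.erase_single, add_zero,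
        Finsupp.erase_of_notMem_support]
      rw [Finsupp.notMem_support_iff]
      exact (mem_stdMon.1 hq).2.1 i (by simp)

theorem IsInit.of_image_erase {e : σ → ℕ} {s : Finset σ} {d k : ℕ} {i : σ}
    {S : Finset (σ →₀ ℕ)} (hsub : S ⊆ (stdMon e s (d + k)).filter fun u => u i = k)
    (hS : IsInit (stdMon e (s.erase i) d) (S.image (Finsupp.erase i))) :
    IsInit ((stdMon e s (d + k)).filter fun u => u i = k) S := by
  refine ⟨hsub, fun u hu q hq h => ?_⟩
  obtain ⟨h1, h2⟩ := Finset.mem_filter.1 (hsub hu)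
  obtain ⟨h3, h4⟩ := Finset.mem_filter.1 hq
  rw [← erase_add_single_of_eq h2, ← erase_add_single_of_eq h4, lex_add_lt_add_iff] at h
  obtain ⟨q', hq', hqq⟩ := Finset.mem_image.1
    (hS.up _ (Finset.mem_image_of_mem _ hu) _ (erase_mem_stdMon h3 h4) h)
  rwa [← erase_add_single_of_eq h4, ← hqq,
    erase_add_single_of_eq (Finset.mem_filter.1 (hsub hq')).2]

end ClementsLindstrom

section ClementsLindstrom

variable {σ : Type*} [LinearOrder σ]

theorem IsInit.union_eq {X S T : Finset (σ →₀ ℕ)} [DecidableEq (σ →₀ ℕ)] (hS : IsInit X S)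
    (hT : IsInit X T) : S ∪ T = S ∨ S ∪ T = T := by
  rcases le_total S.card T.card with h | h
  · exact Or.inr (Finset.union_eq_right.2 (hS.subset_of_card_le hT h))
  · exact Or.inl (Finset.union_eq_left.2 (hT.subset_of_card_le hS h))

theorem apply_le_of_mem_stdMon {e : σ → ℕ} {s : Finset σ} {t : ℕ} {u : σ →₀ ℕ}
    (hu : u ∈ stdMon e s t) (i : σ) : u i ≤ t :=
  (mem_stdMon.1 hu).1 ▸ Finsupp.le_degree i u

theorem shadow_filter {e : σ → ℕ} {s : Finset σ} {t k : ℕ} {i : σ} [DecidableEq (σ →₀ ℕ)]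
    (his : i ∈ s) (hk : k < e i) {W : Finset (σ →₀ ℕ)} (hW : W ⊆ stdMon e s t) :
    (shadow e s t W).filter (fun q => q i = k) =
      (shadow e s t (W.filter fun u => u i = k)).filter (fun q => q i = k) ∪
        (W.filter fun u => u i + 1 = k).image (fun u => u + Finsupp.single i 1) := by
  ext q
  simp only [Finset.mem_filter, Finset.mem_union, Finset.mem_image, mem_shadow]
  constructor
  · rintro ⟨⟨hq, u, hu, j, rfl⟩, hqi⟩
    by_cases hij : j = i
    · subst hij
      refine Or.inr ⟨u, ⟨hu, by simpa using hqi⟩, rfl⟩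
    · exact Or.inl ⟨⟨hq, u, ⟨hu, by simpa [hij] using hqi⟩, j, rfl⟩, hqi⟩
  · rintro (⟨⟨hq, u, ⟨hu, -⟩, j, rfl⟩, hqi⟩ | ⟨u, ⟨hu, hui⟩, rfl⟩)
    · exact ⟨⟨hq, u, hu, j, rfl⟩, hqi⟩
    · exact ⟨⟨add_single_mem_stdMon (hW hu) his (by omega), u, hu, i, rfl⟩, by simpa using hui⟩

theorem shadow_empty {e : σ → ℕ} {s : Finset σ} {t : ℕ} : shadow e s t ∅ = ∅ := by
  ext q
  simp [mem_shadow]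

/-- The Clements–Lindström inequality for a set of variables. -/
def ShadowIneq (e : σ → ℕ) (s : Finset σ) : Prop :=
  ∀ t W S, W ⊆ stdMon e s t → IsInit (stdMon e s t) S → S.card = W.card →
    (shadow e s t S).card ≤ (shadow e s t W).card

/-- In the slice where `i` has exponent `k`, division by that power of `i` reduces shadows to the
other variables. -/
theorem isInit_shadow_slice {e : σ → ℕ} {s : Finset σ} {t k : ℕ} {i : σ}
    (his : i ∈ s) (hk : k < e i) (ih : ShadowIneq e (s.erase i)) {W S : Finset (σ →₀ ℕ)}
    (hW : W ⊆ (stdMon e s t).filter fun u => u i = k)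
    (hS : IsInit ((stdMon e s t).filter fun u => u i = k) S) (hc : S.card = W.card) :
    IsInit ((stdMon e s (t + 1)).filter fun u => u i = k)
        ((shadow e s t S).filter fun q => q i = k) ∧
      ((shadow e s t S).filter fun q => q i = k).card ≤
        ((shadow e s t W).filter fun q => q i = k).card := by
  have hsub : (shadow e s t S).filter (fun q => q i = k) ⊆
      (stdMon e s (t + 1)).filter fun u => u i = k := fun q hq => by
    rw [Finset.mem_filter] at hq ⊢
    exact ⟨(mem_shadow.1 hq.1).1, hq.2⟩
  rcases S.eq_empty_or_nonempty with rfl | ⟨u, hu⟩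
  · rw [shadow_empty, Finset.filter_empty, Finset.card_empty]
    exact ⟨⟨Finset.empty_subset _, by simp⟩, Nat.zero_le _⟩
  · obtain ⟨huM, hui⟩ := Finset.mem_filter.1 (hS.subset hu)
    obtain ⟨d, rfl⟩ : ∃ d, t = d + k := by
      have := apply_le_of_mem_stdMon huM i
      exact ⟨t - k, by omega⟩
    have hS' := hS.image_erase his hk
    have e1 := image_erase_shadow his hk hS.subset
    have e2 := image_erase_shadow his hk hW
    have hval : ∀ T : Finset (σ →₀ ℕ), ∀ q ∈ T.filter (fun q => q i = k), q i = k :=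
      fun T q hq => (Finset.mem_filter.1 hq).2
    constructor
    · rw [show d + k + 1 = (d + 1) + k by omega] at hsub ⊢
      refine IsInit.of_image_erase hsub ?_
      rw [e1]
      exact isInit_shadow hS'
    · rw [← card_image_erase (hval _), e1, ← card_image_erase (hval _), e2]
      refine ih d _ _ (fun w hw => ?_) hS' ?_
      · obtain ⟨q, hq, rfl⟩ := Finset.mem_image.1 hw
        obtain ⟨h1, h2⟩ := Finset.mem_filter.1 (hW hq)
        exact erase_mem_stdMon h1 h2
      · rw [card_image_erase fun q hq => (Finset.mem_filter.1 (hS.subset hq)).2,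
          card_image_erase fun q hq => (Finset.mem_filter.1 (hW hq)).2, hc]

/-- Compression: the slices of `W` by the exponents of `i` are replaced by initial segments. This
does not increase the shadow, by the inequality for the other variables. -/
theorem exists_compression {e : σ → ℕ} {s : Finset σ} {t : ℕ} {i : σ} (his : i ∈ s)
    (ih : ShadowIneq e (s.erase i)) {W : Finset (σ →₀ ℕ)} (hW : W ⊆ stdMon e s t)
    {f : (σ →₀ ℕ) → ℕ}
    (hf : ∀ u ∈ stdMon e s t, ∀ q ∈ stdMon e s t, toLex u < toLex q → f q < f u) :
    ∃ C ⊆ stdMon e s t, C.card = W.card ∧ (shadow e s t C).card ≤ (shadow e s t W).card ∧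
      (∀ k, IsInit ((stdMon e s t).filter fun u => u i = k) (C.filter fun u => u i = k)) ∧
      (C ≠ W → ∑ u ∈ C, f u < ∑ u ∈ W, f u) := by
  classical
  have hWk : ∀ k, W.filter (fun u => u i = k) ⊆ (stdMon e s t).filter fun u => u i = k :=
    fun k => Finset.filter_subset_filter _ hW
  choose S hS hSc using fun k => exists_isInit_card _ (Finset.card_le_card (hWk k))
  set C := (stdMon e s t).filter fun u => u ∈ S (u i) with hC
  have hCM : C ⊆ stdMon e s t := Finset.filter_subset _ _
  have hCk : ∀ k, C.filter (fun u => u i = k) = S k := by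
    intro k
    ext u
    simp only [hC, Finset.mem_filter]
    constructor
    · rintro ⟨⟨-, h1⟩, rfl⟩
      exact h1
    · intro hu
      obtain ⟨h1, h2⟩ := Finset.mem_filter.1 ((hS k).subset hu)
      exact ⟨⟨h1, h2.symm ▸ hu⟩, h2⟩
  have hmaps : ∀ T ⊆ stdMon e s t, ∀ u ∈ T, u i ∈ Finset.range (t + 1) := fun T hT u hu =>
    Finset.mem_range.2 (Nat.lt_succ_of_le (apply_le_of_mem_stdMon (hT hu) i))
  have hcard : C.card = W.card := by
    rw [Finset.card_eq_sum_card_fiberwise (hmaps C hCM), Finset.card_eq_sum_card_fiberwise (hmaps W hW)]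
    refine Finset.sum_congr rfl fun k _ => ?_
    rw [hCk, hSc]
  refine ⟨C, hCM, hcard, ?_, fun k => (hCk k).symm ▸ hS k, fun hne => ?_⟩
  · have hmaps' : ∀ T : Finset (σ →₀ ℕ), ∀ q ∈ shadow e s t T, q i ∈ Finset.range (t + 2) :=
      fun T q hq => Finset.mem_range.2
        (Nat.lt_succ_of_le (apply_le_of_mem_stdMon (mem_shadow.1 hq).1 i))
    rw [Finset.card_eq_sum_card_fiberwise (hmaps' C), Finset.card_eq_sum_card_fiberwise (hmaps' W)]
    refine Finset.sum_le_sum fun k _ => ?_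
    by_cases hk : k < e i
    · rw [shadow_filter his hk hCM, hCk]
      obtain ⟨h1, h2⟩ := isInit_shadow_slice his hk ih (hWk k) (hS k) (hSc k)
      -- the slice of the shadow is the union of the shadow of the slice and of the product by `i`
      -- of the preceding slice: for `C`, these are initial segments, so one contains the other
      have h3 : IsInit ((stdMon e s (t + 1)).filter fun u => u i = k)
          ((C.filter fun u => u i + 1 = k).image fun u => u + Finsupp.single i 1) := by
        refine ⟨fun q hq => ?_, fun w hw q hq h => ?_⟩
        · obtain ⟨u, hu, rfl⟩ := Finset.mem_image.1 hq
          obtain ⟨hu1, hu2⟩ := Finset.mem_filter.1 hu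
          exact Finset.mem_filter.2
            ⟨add_single_mem_stdMon (hCM hu1) his (by omega), by simpa using hu2⟩
        · obtain ⟨u, hu, rfl⟩ := Finset.mem_image.1 hw
          obtain ⟨hu1, hu2⟩ := Finset.mem_filter.1 hu
          obtain ⟨hq1, hq2⟩ := Finset.mem_filter.1 hq
          have hqi : 0 < q i := by omega
          have hqe : q - Finsupp.single i 1 + Finsupp.single i 1 = q :=
            tsub_add_cancel_of_le (by rwa [Finsupp.single_le_iff])
          have hqi' : (q - Finsupp.single i 1 : σ →₀ ℕ) i = u i := by
            rw [Finsupp.tsub_apply, Finsupp.single_eq_same]; omega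
          rw [← hqe, lex_add_lt_add_iff] at h
          have hu' : u ∈ S (u i) := (Finset.mem_filter.1 hu1).2
          have := (hS (u i)).up u hu' (q - Finsupp.single i 1)
            (Finset.mem_filter.2 ⟨sub_single_mem_stdMon hq1 hqi, hqi'⟩) h
          refine Finset.mem_image.2 ⟨_, Finset.mem_filter.2 ⟨?_, by omega⟩, hqe⟩
          refine Finset.mem_filter.2 ⟨sub_single_mem_stdMon hq1 hqi, ?_⟩
          rwa [hqi']
      have h4 : ((C.filter fun u => u i + 1 = k).image fun u => u + Finsupp.single i 1).card =
          ((W.filter fun u => u i + 1 = k).image fun u => u + Finsupp.single i 1).card := by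
        rw [Finset.card_image_of_injective _ (add_left_injective _),
          Finset.card_image_of_injective _ (add_left_injective _)]
        cases k with
        | zero => simp
        | succ k => simp only [add_left_inj, hCk, hSc]
      rw [shadow_filter his hk hW]
      rcases h1.union_eq h3 with h | h
      · rw [h]
        exact h2.trans (Finset.card_le_card Finset.subset_union_left)
      · rw [h, h4]
        exact Finset.card_le_card Finset.subset_union_right
    · rw [Finset.filter_eq_empty_iff.2, Finset.card_empty]
      · exact Nat.zero_le _
      · intro q hq hqi
        have := (mem_stdMon.1 (mem_shadow.1 hq).1).2.2 i his
        omega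
  · rw [← Finset.sum_fiberwise_of_maps_to (hmaps C hCM), ← Finset.sum_fiberwise_of_maps_to (hmaps W hW)]
    have hex : ∃ k ∈ Finset.range (t + 1), S k ≠ W.filter fun u => u i = k := by
      by_contra! h
      refine hne (Finset.ext fun u => ?_)
      by_cases hu : u i ∈ Finset.range (t + 1)
      · have h1 := h (u i) hu
        rw [← hCk] at h1
        simpa using Finset.ext_iff.1 h1 u
      · exact ⟨fun h => absurd (hmaps C hCM u h) hu, fun h => absurd (hmaps W hW u h) hu⟩
    have hlt : ∀ k, S k ≠ W.filter (fun u => u i = k) →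
        ∑ u ∈ C with u i = k, f u < ∑ u ∈ W with u i = k, f u := fun k hk => by
      rw [hCk]
      exact (hS k).sum_lt (fun u hu q hq => hf u (Finset.mem_of_mem_filter u hu) q
        (Finset.mem_of_mem_filter q hq)) (hWk k) (hSc k) hk
    refine Finset.sum_lt_sum (fun k _ => ?_) ?_
    · by_cases hk : S k = W.filter fun u => u i = k
      · rw [hCk, hk]
      · exact (hlt k hk).le
    · obtain ⟨k, hk, hk'⟩ := hex
      exact ⟨k, hk, hlt k hk'⟩

/-- The Clements–Lindström theorem, by induction on the number of variables: among the sets of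
monomials of a given degree and size, the initial segments have the smallest shadows. -/
theorem shadowIneq (e : σ → ℕ) (s : Finset σ) (he : ∀ i ∈ s, ∀ j ∈ s, i ≤ j → e i ≤ e j) :
    ShadowIneq e s := by
  classical
  induction s using Finset.strongInduction with
  | H s ihs =>
  have ih : ∀ i ∈ s, ShadowIneq e (s.erase i) := fun i hi =>
    ihs _ (Finset.erase_ssubset hi) fun a ha b hb =>
      he a (Finset.mem_of_mem_erase ha) b (Finset.mem_of_mem_erase hb)
  intro t W S hW hS hc
  rcases s.eq_empty_or_nonempty with rfl | hne
  · have h0 : shadow e ∅ t S = ∅ := by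
      refine Finset.eq_empty_of_forall_notMem fun q hq => ?_
      obtain ⟨h1, h2, -⟩ := mem_stdMon.1 (mem_shadow.1 hq).1
      have : q = 0 := Finsupp.ext fun i => h2 i (by simp)
      simp [this] at h1
    simp [h0]
  obtain ⟨z, hzs, hz⟩ : ∃ z ∈ s, ∀ i ∈ s, i ≤ z :=
    ⟨_, s.max'_mem hne, fun i hi => s.le_max' i hi⟩
  rcases Nat.lt_or_ge s.card 3 with hs3 | hs3
  · rcases Nat.lt_or_ge s.card 2 with hs2 | hs2
    · -- in at most one variable, there is at most one monomial of degree `t`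
      obtain ⟨a, rfl⟩ : ∃ a, s = {a} := Finset.card_eq_one.1 (by have := hne.card_pos; omega)
      have huniq : ∀ u ∈ stdMon e {a} t, u = Finsupp.single a t := by
        intro u hu
        obtain ⟨h1, h2, -⟩ := mem_stdMon.1 hu
        have : u = Finsupp.single a (u a) := by
          ext j
          by_cases hj : j = a
          · simp [hj]
          · simp [Ne.symm hj, h2 j (by simpa using hj)]
        rw [this, Finsupp.degree_single] at h1
        rw [this, h1]
      have hSW : S = W := by
        rcases S.eq_empty_or_nonempty with rfl | ⟨u, hu⟩
        · rw [Finset.card_empty] at hc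
          exact (Finset.card_eq_zero.1 hc.symm).symm
        · have hW0 : 0 < W.card := hc ▸ Finset.card_pos.2 ⟨u, hu⟩
          obtain ⟨q, hq⟩ := Finset.card_pos.1 hW0
          have h1 : ∀ T ⊆ stdMon e {a} t, T ⊆ {Finsupp.single a t} := fun T hT w hw =>
            Finset.mem_singleton.2 (huniq w (hT hw))
          rw [(Finset.subset_singleton_iff.1 (h1 S hS.subset)).resolve_left
              (Finset.ne_empty_of_mem hu),
            (Finset.subset_singleton_iff.1 (h1 W hW)).resolve_left (Finset.ne_empty_of_mem hq)]
      rw [hSW]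
    · obtain ⟨a, b, hab, rfl⟩ := Finset.card_eq_two.1 (show s.card = 2 by omega)
      rcases lt_or_gt_of_ne hab with h | h
      · exact card_shadow_le_pair h (he a (by simp) b (by simp) h.le) hW hS hc
      · rw [Finset.pair_comm] at *
        exact card_shadow_le_pair h (he b (by simp) a (by simp) h.le) hW hS hc
  · -- the sum over `W` of the ranks `f` from the top decreases under compressions
    set f : (σ →₀ ℕ) → ℕ := fun u => ((stdMon e s t).filter fun q => toLex u < toLex q).card with hfdef
    have hf : ∀ u ∈ stdMon e s t, ∀ q ∈ stdMon e s t, toLex u < toLex q → f q < f u := by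
      intro u hu q hq huq
      refine Finset.card_lt_card ((Finset.ssubset_iff_of_subset fun w hw => ?_).2 ⟨q, ?_, ?_⟩)
      · rw [Finset.mem_filter] at hw ⊢
        exact ⟨hw.1, huq.trans hw.2⟩
      · exact Finset.mem_filter.2 ⟨hq, huq⟩
      · simp
    obtain ⟨m, hm⟩ : ∃ m, ∑ u ∈ W, f u = m := ⟨_, rfl⟩
    induction m using Nat.strong_induction_on generalizing W with
    | _ m ihm =>
    by_cases hcomp : ∀ i ∈ s, ∀ k,
        IsInit ((stdMon e s t).filter fun u => u i = k) (W.filter fun u => u i = k)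
    · have hup : ∀ i ∈ s, ∀ u ∈ W, ∀ q ∈ stdMon e s t, u i = q i → toLex u < toLex q → q ∈ W :=
        fun i hi u hu q hq h hlt => (Finset.mem_filter.1 ((hcomp i hi (q i)).up u
          (Finset.mem_filter.2 ⟨hu, h⟩) q (Finset.mem_filter.2 ⟨hq, rfl⟩) hlt)).1
      refine IsStableLex.card_shadow_le ⟨hW, fun u hu huz v hv hvz hve => ?_, hup z hzs⟩ hzs hz hS hc
      -- a third variable `i` singles out a slice that contains both monomials
      obtain ⟨i, hi⟩ : ((s.erase z).erase v).Nonempty := by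
        rw [← Finset.card_pos, Finset.card_erase_of_mem (Finset.mem_erase.2 ⟨hvz, hv⟩),
          Finset.card_erase_of_mem hzs]
        omega
      obtain ⟨hiv, hi⟩ := Finset.mem_erase.1 hi
      obtain ⟨hiz, his⟩ := Finset.mem_erase.1 hi
      have hvz' : v < z := lt_of_le_of_ne (hz v hv) hvz
      obtain ⟨t, rfl⟩ : ∃ t', t = t' + 1 := by
        refine ⟨t - 1, ?_⟩
        have := apply_le_of_mem_stdMon (hW hu) z
        omega
      refine hup i his u hu _ (add_single_mem_stdMon (sub_single_mem_stdMon (hW hu) huz) hv ?_) ?_ ?_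
      · rw [Finsupp.tsub_apply]
        omega
      · simp [hiv.symm, hiz.symm]
      · refine lex_lt_iff.2 ⟨v, fun j hj => ?_, ?_⟩
        · simp [hj.ne', (hj.trans hvz').ne']
        · simp [hvz'.ne']
    · push Not at hcomp
      obtain ⟨i, his, k, hk⟩ := hcomp
      obtain ⟨C, hCM, hCc, hCs, hCi, hlt⟩ := exists_compression his (ih i his) hW hf
      have hne : C ≠ W := fun h => hk (h ▸ hCi k)
      exact (ihm _ (hm ▸ hlt hne) C hCM (hc.trans hCc.symm) rfl).trans hCs

/-- The Clements–Lindström theorem, for sets of different sizes. -/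
theorem card_shadow_le {e : σ → ℕ} {s : Finset σ} (he : ∀ i ∈ s, ∀ j ∈ s, i ≤ j → e i ≤ e j)
    {t : ℕ} {W S : Finset (σ →₀ ℕ)} (hW : W ⊆ stdMon e s t) (hS : IsInit (stdMon e s t) S)
    (hc : S.card ≤ W.card) : (shadow e s t S).card ≤ (shadow e s t W).card := by
  obtain ⟨T, hT, hTc⟩ := exists_isInit_card _ (Finset.card_le_card hW)
  exact (Finset.card_le_card (shadow_mono (hS.subset_of_card_le hT (hc.trans hTc.ge)))).trans
    (shadowIneq e s he t W T hW hT hTc)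

end ClementsLindstrom

/-! ### Graded parts of ideals and Hilbert functions -/

section LinearAlgebra

variable {k : Type*} [Field k] {V W : Type*} [AddCommGroup V] [Module k V] [AddCommGroup W]
  [Module k W]

theorem finrank_map_add_finrank_inf_ker (f : V →ₗ[k] W) (S : Submodule k V) [FiniteDimensional k S] :
    Module.finrank k (S.map f) + Module.finrank k (S ⊓ LinearMap.ker f : Submodule k V) =
      Module.finrank k S := by
  rw [← LinearMap.finrank_range_add_finrank_ker (f.domRestrict S), LinearMap.range_domRestrict]
  congr 1
  rw [LinearMap.ker_domRestrict, ← Submodule.finrank_map_subtype_eq, Submodule.map_comap_subtype]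

/-- The leading coefficients, at the index `i`, of the elements of `U` whose coefficients at all
smaller indices vanish. -/
def lead {ι : Type*} [LT ι] (coef : ι → V →ₗ[k] W) (U : Submodule k V) (i : ι) : Submodule k W :=
  (U ⊓ ⨅ l : ι, ⨅ _ : l < i, LinearMap.ker (coef l)).map (coef i)

theorem mem_lead {ι : Type*} [LT ι] {coef : ι → V →ₗ[k] W} {U : Submodule k V} {i : ι} {a : W} :
    a ∈ lead coef U i ↔ ∃ q ∈ U, (∀ l < i, coef l q = 0) ∧ coef i q = a := by
  simp [lead, Submodule.mem_map, Submodule.mem_iInf, and_assoc]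

/-- The dimension of a space is the sum of the dimensions of its spaces of leading coefficients. -/
theorem finrank_eq_sum_lead {ι : Type*} [LinearOrder ι] (coef : ι → V →ₗ[k] W) (U : Submodule k V)
    [FiniteDimensional k U] (s : Finset ι) (hs : ∀ q ∈ U, ∀ l ∉ s, coef l q = 0)
    (hinj : ∀ q ∈ U, (∀ l, coef l q = 0) → q = 0) :
    Module.finrank k U = ∑ i ∈ s, Module.finrank k (lead coef U i) := by
  have hlead : ∀ i, lead coef U i =
      (U ⊓ ⨅ l ∈ s, ⨅ _ : l < i, LinearMap.ker (coef l)).map (coef i) := by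
    intro i
    ext a
    simp only [mem_lead, Submodule.mem_map, Submodule.mem_inf, Submodule.mem_iInf,
      LinearMap.mem_ker, and_assoc]
    refine exists_congr fun q => and_congr_right fun hq => and_congr_left fun _ => ?_
    refine ⟨fun h l _ => h l, fun h l hl => ?_⟩
    by_cases hls : l ∈ s
    · exact h l hls hl
    · exact hs q hq l hls
  have key : ∀ r : Finset ι, Module.finrank k U =
      ∑ i ∈ r, Module.finrank k
        ((U ⊓ ⨅ l ∈ r, ⨅ _ : l < i, LinearMap.ker (coef l)).map (coef i) : Submodule k W) +
      Module.finrank k (U ⊓ ⨅ l ∈ r, LinearMap.ker (coef l) : Submodule k V) := by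
    intro r
    induction r using Finset.induction_on_max with
    | empty =>
      have : (⨅ l ∈ (∅ : Finset ι), LinearMap.ker (coef l)) = ⊤ := by simp
      rw [this, inf_top_eq, Finset.sum_empty, zero_add]
    | insert a r ha ih =>
      have har : a ∉ r := fun h => lt_irrefl a (ha a h)
      have h1 : ∀ i ∈ r, (⨅ l ∈ insert a r, ⨅ _ : l < i, LinearMap.ker (coef l)) =
          ⨅ l ∈ r, ⨅ _ : l < i, LinearMap.ker (coef l) := by
        intro i hi
        rw [Finset.iInf_insert]
        simp [(ha i hi).not_gt]
      have h2 : (⨅ l ∈ insert a r, ⨅ _ : l < a, LinearMap.ker (coef l)) =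
          ⨅ l ∈ r, LinearMap.ker (coef l) := by
        rw [Finset.iInf_insert]
        simp only [lt_irrefl, iInf_false, le_top, inf_of_le_right]
        exact iInf_congr fun l => iInf_congr fun hl => by simp [ha l hl]
      have h3 : FiniteDimensional k (U ⊓ ⨅ l ∈ r, LinearMap.ker (coef l) : Submodule k V) :=
        Submodule.finiteDimensional_of_le inf_le_left
      have h4 : ∑ i ∈ r, Module.finrank k ((U ⊓ ⨅ l ∈ insert a r, ⨅ _ : l < i,
          LinearMap.ker (coef l)).map (coef i) : Submodule k W) =
          ∑ i ∈ r, Module.finrank k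
            ((U ⊓ ⨅ l ∈ r, ⨅ _ : l < i, LinearMap.ker (coef l)).map (coef i) : Submodule k W) :=
        Finset.sum_congr rfl fun i hi => by rw [h1 i hi]
      rw [ih, Finset.sum_insert har, h2, h4, Finset.iInf_insert, ← finrank_map_add_finrank_inf_ker (coef a), inf_assoc,
        inf_comm (LinearMap.ker (coef a))]
      ring
  rw [key s]
  have h0 : (U ⊓ ⨅ l ∈ s, LinearMap.ker (coef l) : Submodule k V) = ⊥ := by
    rw [eq_bot_iff]
    rintro q ⟨hq, hq'⟩
    simp only [Submodule.mem_iInf, SetLike.mem_coe, LinearMap.mem_ker] at hq'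
    refine hinj q hq fun l => ?_
    by_cases hls : l ∈ s
    · exact hq' l hls
    · exact hs q hq l hls
  rw [h0, finrank_bot, add_zero]
  exact Finset.sum_congr rfl fun i _ => by rw [hlead]

end LinearAlgebra

section GradedPart

variable {k : Type u} [Field k] {n c : ℕ}

/-- The part of degree `t` of an ideal. -/
noncomputable def gradedPart (I : Ideal (MvPolynomial (Fin n) k)) (t : ℕ) : Submodule k (MvPolynomial (Fin n) k) :=
  I.restrictScalars k ⊓ homogeneousSubmodule (Fin n) k t

theorem mem_gradedPart {I : Ideal (MvPolynomial (Fin n) k)} {t : ℕ} {p : MvPolynomial (Fin n) k} :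
    p ∈ gradedPart I t ↔ p ∈ I ∧ p.IsHomogeneous t := Iff.rfl

/-- The Hilbert function of an ideal of the polynomial ring. -/
noncomputable def hilb (I : Ideal (MvPolynomial (Fin n) k)) (t : ℕ) : ℕ :=
  Module.finrank k (gradedPart I t)

instance (t : ℕ) : FiniteDimensional k (homogeneousSubmodule (Fin n) k t) :=
  Module.Finite.iff_fg.2 (homogeneousSubmodule_fg _ _ t)

theorem finiteDimensional_of_le_homogeneous {U : Submodule k (MvPolynomial (Fin n) k)} {t : ℕ}
    (h : U ≤ homogeneousSubmodule (Fin n) k t) : FiniteDimensional k U :=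
  Submodule.finiteDimensional_of_le h

instance (I : Ideal (MvPolynomial (Fin n) k)) (t : ℕ) : FiniteDimensional k (gradedPart I t) :=
  finiteDimensional_of_le_homogeneous inf_le_right

theorem gradedPart_mono {I J : Ideal (MvPolynomial (Fin n) k)} (h : I ≤ J) (t : ℕ) :
    gradedPart I t ≤ gradedPart J t :=
  inf_le_inf_right _ fun _ hx => h hx

theorem hilb_mono {I J : Ideal (MvPolynomial (Fin n) k)} (h : I ≤ J) (t : ℕ) :
    hilb I t ≤ hilb J t :=
  Submodule.finrank_mono (gradedPart_mono h t)

theorem X_mul_mem_homogeneous {p : MvPolynomial (Fin n) k} {t : ℕ} (v : Fin n)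
    (hp : p.IsHomogeneous t) : (X v * p).IsHomogeneous (t + 1) := by
  rw [add_comm]
  exact (isHomogeneous_X k v).mul hp

theorem hilbertSeries_add_hilb (a : Ideal (MvPolynomial (Fin n) k))
    (J : Ideal (MvPolynomial (Fin n) k ⧸ a)) (t : ℕ) :
    hilbertSeries a J t + hilb a t = hilb (J.comap (Ideal.Quotient.mk a)) t := by
  rw [hilb, hilb, ← finrank_map_add_finrank_inf_ker (Ideal.Quotient.mkₐ k a).toLinearMap
    (gradedPart (J.comap (Ideal.Quotient.mk a)) t), hilbertSeries]
  have h1 : J.restrictScalars k ⊓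
      (homogeneousSubmodule (Fin n) k t).map (Ideal.Quotient.mkₐ k a).toLinearMap =
      (gradedPart (J.comap (Ideal.Quotient.mk a)) t).map (Ideal.Quotient.mkₐ k a).toLinearMap := by
    ext q
    constructor
    · rintro ⟨h1, p, hp, rfl⟩
      exact ⟨p, ⟨h1, hp⟩, rfl⟩
    · rintro ⟨p, ⟨h1, hp⟩, rfl⟩
      exact ⟨h1, p, hp, rfl⟩
  have h2 : gradedPart a t = gradedPart (J.comap (Ideal.Quotient.mk a)) t ⊓
      LinearMap.ker (Ideal.Quotient.mkₐ k a).toLinearMap := by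
    ext q
    constructor
    · rintro ⟨h1, h2⟩
      have h0 : Ideal.Quotient.mk a q = 0 := Ideal.Quotient.eq_zero_iff_mem.2 h1
      refine ⟨⟨?_, h2⟩, h0⟩
      show Ideal.Quotient.mk a q ∈ J
      rw [h0]
      exact J.zero_mem
    · rintro ⟨⟨-, h2⟩, h0⟩
      exact ⟨Ideal.Quotient.eq_zero_iff_mem.1 h0, h2⟩
  rw [h1, ← h2]

theorem hilbertSeries_map_add_hilb (a I : Ideal (MvPolynomial (Fin n) k)) (t : ℕ) :
    hilbertSeries a (I.map (Ideal.Quotient.mk a)) t + hilb a t = hilb (I ⊔ a) t := by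
  rw [hilbertSeries_add_hilb, Ideal.comap_map_of_surjective' _ Ideal.Quotient.mk_surjective,
    Ideal.mk_ker]

theorem hilbertPoset_subset_iff {a b : Ideal (MvPolynomial (Fin n) k)}
    (hab : ∀ t, hilb a t = hilb b t) :
    hilbertPoset a ⊆ hilbertPoset b ↔ ∀ I, IsHomogeneousIdeal I → a ≤ I →
      ∃ I', IsHomogeneousIdeal I' ∧ b ≤ I' ∧ ∀ t, hilb I t = hilb I' t := by
  have hle : ∀ (a : Ideal (MvPolynomial (Fin n) k)) (J : Ideal (MvPolynomial (Fin n) k ⧸ a)),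
      a ≤ J.comap (Ideal.Quotient.mk a) := fun a J p hp => by
    rw [Ideal.mem_comap, Ideal.Quotient.eq_zero_iff_mem.2 hp]
    exact J.zero_mem
  constructor
  · intro h I hI haI
    have h1 : (I.map (Ideal.Quotient.mk a)).comap (Ideal.Quotient.mk a) = I := by
      rw [Ideal.comap_map_of_surjective' _ Ideal.Quotient.mk_surjective, Ideal.mk_ker,
        sup_eq_left.2 haI]
    obtain ⟨J, hJ, hJ'⟩ := h ⟨I.map (Ideal.Quotient.mk a), by
      rwa [IsHomogeneousQuotIdeal, h1], rfl⟩
    refine ⟨J.comap (Ideal.Quotient.mk b), hJ, hle b J, fun t => ?_⟩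
    rw [← hilbertSeries_add_hilb, ← hJ', ← hab, hilbertSeries_add_hilb, h1]
  · rintro h _ ⟨J, hJ, rfl⟩
    obtain ⟨I', hI', hb, heq⟩ := h _ hJ (hle a J)
    have h1 : (I'.map (Ideal.Quotient.mk b)).comap (Ideal.Quotient.mk b) = I' := by
      rw [Ideal.comap_map_of_surjective' _ Ideal.Quotient.mk_surjective, Ideal.mk_ker,
        sup_eq_left.2 hb]
    refine ⟨I'.map (Ideal.Quotient.mk b), by rwa [IsHomogeneousQuotIdeal, h1], funext fun t => ?_⟩
    have e1 := hilbertSeries_add_hilb a J t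
    have e2 := hilbertSeries_add_hilb b (I'.map (Ideal.Quotient.mk b)) t
    rw [h1, ← heq, ← hab] at e2
    omega

/-- Families of spaces of forms, one in each degree, that are the graded parts of an ideal. -/
structure IsGradedFamily (U : ℕ → Submodule k (MvPolynomial (Fin n) k)) : Prop where
  le : ∀ t, U t ≤ homogeneousSubmodule (Fin n) k t
  X_mul : ∀ t v, ∀ p ∈ U t, X v * p ∈ U (t + 1)

theorem isGradedFamily_gradedPart (I : Ideal (MvPolynomial (Fin n) k)) :
    IsGradedFamily (gradedPart I) :=
  ⟨fun _ => inf_le_right, fun _ v _ hp => ⟨I.mul_mem_left _ hp.1, X_mul_mem_homogeneous v hp.2⟩⟩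

theorem homogeneousComponent_X_mul (v : Fin n) (p : MvPolynomial (Fin n) k) (t : ℕ) :
    homogeneousComponent (t + 1) (X v * p) = X v * homogeneousComponent t p := by
  ext d
  rw [coeff_homogeneousComponent, coeff_X_mul', coeff_X_mul', coeff_homogeneousComponent]
  by_cases hv : v ∈ d.support
  · have := degree_sub_single (u := d) (i := v) (by
      rw [Finsupp.mem_support_iff] at hv; omega)
    simp only [hv, if_true]
    by_cases h : d.degree = t + 1
    · rw [if_pos h, if_pos (by omega)]
    · rw [if_neg h, if_neg (by omega)]
  · simp [hv]

theorem homogeneousComponent_zero_X_mul (v : Fin n) (p : MvPolynomial (Fin n) k) :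
    homogeneousComponent 0 (X v * p) = 0 := by
  rw [homogeneousComponent_zero, coeff_X_mul', if_neg (by simp), map_zero]

/-- The homogeneous ideal with given graded parts. -/
noncomputable def familyIdeal (U : ℕ → Submodule k (MvPolynomial (Fin n) k)) (hU : IsGradedFamily U) :
    Ideal (MvPolynomial (Fin n) k) where
  carrier := {p | ∀ t, homogeneousComponent t p ∈ U t}
  add_mem' := fun hp hq t => by
    rw [map_add]
    exact (U t).add_mem (hp t) (hq t)
  zero_mem' := fun t => by
    rw [map_zero]
    exact (U t).zero_mem
  smul_mem' := fun r p hp => by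
    rw [smul_eq_mul]
    induction r using MvPolynomial.induction_on generalizing p with
    | C a =>
      intro t
      rw [homogeneousComponent_C_mul, ← smul_eq_C_mul]
      exact (U t).smul_mem a (hp t)
    | add r s hr hs =>
      intro t
      rw [add_mul, map_add]
      exact (U t).add_mem (hr p hp t) (hs p hp t)
    | mul_X r v hr =>
      rw [mul_assoc]
      refine hr _ fun t => ?_
      cases t with
      | zero =>
        rw [homogeneousComponent_zero_X_mul]
        exact (U 0).zero_mem
      | succ t =>
        rw [homogeneousComponent_X_mul]
        exact hU.X_mul t v _ (hp t)

theorem isHomogeneousIdeal_iff {I : Ideal (MvPolynomial (Fin n) k)} :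
    IsHomogeneousIdeal I ↔ ∀ p ∈ I, ∀ t, homogeneousComponent t p ∈ I := by
  constructor
  · intro h p hp t
    have := h t hp
    rwa [← decomposition.decompose'_apply]
  · intro h t p hp
    have := h p hp t
    rwa [← decomposition.decompose'_apply] at this

theorem homogeneousComponent_of_isHomogeneous {p : MvPolynomial (Fin n) k} {s t : ℕ}
    (hp : p.IsHomogeneous t) : homogeneousComponent s p = if s = t then p else 0 := by
  rw [homogeneousComponent_of_mem ((mem_homogeneousSubmodule t p).2 hp)]

theorem isHomogeneousIdeal_familyIdeal {U : ℕ → Submodule k (MvPolynomial (Fin n) k)}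
    (hU : IsGradedFamily U) : IsHomogeneousIdeal (familyIdeal U hU) :=
  isHomogeneousIdeal_iff.2 fun p hp t s => by
    rw [homogeneousComponent_of_isHomogeneous (homogeneousComponent_isHomogeneous t p)]
    split_ifs with h
    · exact h ▸ hp s
    · exact (U s).zero_mem

theorem gradedPart_familyIdeal {U : ℕ → Submodule k (MvPolynomial (Fin n) k)}
    (hU : IsGradedFamily U) (t : ℕ) : gradedPart (familyIdeal U hU) t = U t := by
  ext p
  constructor
  · rintro ⟨h1, h2⟩
    have := h1 t
    rwa [homogeneousComponent_of_isHomogeneous h2, if_pos rfl] at this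
  · intro hp
    refine ⟨fun s => ?_, hU.le t hp⟩
    rw [homogeneousComponent_of_isHomogeneous (hU.le t hp)]
    split_ifs with h
    · exact h ▸ hp
    · exact (U s).zero_mem

theorem hilb_familyIdeal {U : ℕ → Submodule k (MvPolynomial (Fin n) k)}
    (hU : IsGradedFamily U) (t : ℕ) : hilb (familyIdeal U hU) t = Module.finrank k (U t) := by
  rw [hilb, gradedPart_familyIdeal]

theorem le_of_gradedPart_le {I J : Ideal (MvPolynomial (Fin n) k)} (hI : IsHomogeneousIdeal I)
    (h : ∀ t, gradedPart I t ≤ gradedPart J t) : I ≤ J := fun p hp => by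
  rw [← sum_homogeneousComponent p]
  exact J.sum_mem fun t _ =>
    (h t ⟨isHomogeneousIdeal_iff.1 hI p hp t, homogeneousComponent_isHomogeneous t p⟩).1

theorem IsHomogeneousIdeal.sup {I J : Ideal (MvPolynomial (Fin n) k)} (hI : IsHomogeneousIdeal I)
    (hJ : IsHomogeneousIdeal J) : IsHomogeneousIdeal (I ⊔ J) :=
  Ideal.IsHomogeneous.sup hI hJ

theorem isHomogeneousIdeal_span {S : Set (MvPolynomial (Fin n) k)}
    (hS : ∀ p ∈ S, ∃ t, p.IsHomogeneous t) : IsHomogeneousIdeal (Ideal.span S) :=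
  Ideal.homogeneous_span _ _ fun p hp => by
    obtain ⟨t, ht⟩ := hS p hp
    exact ⟨t, ht⟩

end GradedPart

/-! ### Monomial ideals and lex-plus-powers ideals -/

section MonomialIdeals

variable {k : Type u} [Field k] {n c : ℕ}

/-- Monomial ideals. -/
def IsMonomialIdeal (I : Ideal (MvPolynomial (Fin n) k)) : Prop :=
  ∃ S : Set (Fin n →₀ ℕ), I = Ideal.span ((fun u => monomial u (1 : k)) '' S)

theorem IsMonomialIdeal.mem_iff {I : Ideal (MvPolynomial (Fin n) k)} (hI : IsMonomialIdeal I)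
    {p : MvPolynomial (Fin n) k} : p ∈ I ↔ ∀ u, coeff u p ≠ 0 → monomial u (1 : k) ∈ I := by
  obtain ⟨S, rfl⟩ := hI
  rw [mem_ideal_span_monomial_image]
  have h : ∀ u : Fin n →₀ ℕ, monomial u (1 : k) ∈ Ideal.span ((fun u => monomial u (1 : k)) '' S) ↔
      ∃ s ∈ S, s ≤ u := fun u => by
    classical
    rw [mem_ideal_span_monomial_image]
    simp [support_monomial]
  simp only [h, mem_support_iff]

theorem IsMonomialIdeal.sup {I J : Ideal (MvPolynomial (Fin n) k)} (hI : IsMonomialIdeal I)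
    (hJ : IsMonomialIdeal J) : IsMonomialIdeal (I ⊔ J) := by
  obtain ⟨S, rfl⟩ := hI
  obtain ⟨T, rfl⟩ := hJ
  exact ⟨S ∪ T, by rw [Set.image_union, Ideal.span_union]⟩

theorem IsMonomialIdeal.monomial_mem_sup {I J : Ideal (MvPolynomial (Fin n) k)}
    (hI : IsMonomialIdeal I) (hJ : IsMonomialIdeal J) {u : Fin n →₀ ℕ} :
    monomial u (1 : k) ∈ I ⊔ J ↔ monomial u (1 : k) ∈ I ∨ monomial u (1 : k) ∈ J := by
  classical
  obtain ⟨S, rfl⟩ := hI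
  obtain ⟨T, rfl⟩ := hJ
  rw [← Ideal.span_union, ← Set.image_union]
  simp only [mem_ideal_span_monomial_image, support_monomial, one_ne_zero, if_false,
    Finset.mem_singleton, forall_eq, Set.mem_union]
  constructor
  · rintro ⟨s, h | h, hs⟩
    exacts [Or.inl ⟨s, h, hs⟩, Or.inr ⟨s, h, hs⟩]
  · rintro (⟨s, h, hs⟩ | ⟨s, h, hs⟩)
    exacts [⟨s, Or.inl h, hs⟩, ⟨s, Or.inr h, hs⟩]

theorem IsMonomialIdeal.isHomogeneousIdeal {I : Ideal (MvPolynomial (Fin n) k)}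
    (hI : IsMonomialIdeal I) : IsHomogeneousIdeal I := by
  obtain ⟨S, rfl⟩ := hI
  refine isHomogeneousIdeal_span ?_
  rintro _ ⟨u, -, rfl⟩
  exact ⟨u.degree, isHomogeneous_monomial _ rfl⟩

theorem monomial_add_single_mem {I : Ideal (MvPolynomial (Fin n) k)} {u : Fin n →₀ ℕ}
    (h : monomial u (1 : k) ∈ I) (v : Fin n) : monomial (u + Finsupp.single v 1) (1 : k) ∈ I := by
  have : monomial (u + Finsupp.single v 1) (1 : k) = X v * monomial u 1 := by
    rw [X, monomial_mul, mul_one, add_comm]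
  rw [this]
  exact I.mul_mem_left _ h

/-- If `T` is closed under multiplication by variables, it consists of all the monomials of the
ideal that it generates. -/
theorem monomial_mem_span_iff {T : Set (Fin n →₀ ℕ)}
    (hT : ∀ u ∈ T, ∀ v, u + Finsupp.single v 1 ∈ T) {u : Fin n →₀ ℕ} :
    monomial u (1 : k) ∈ Ideal.span ((fun u => monomial u (1 : k)) '' T) ↔ u ∈ T := by
  classical
  refine ⟨fun h => ?_, fun h => Ideal.subset_span ⟨u, h, rfl⟩⟩
  rw [mem_ideal_span_monomial_image] at h
  obtain ⟨s, hs, hsu⟩ := h u (by simp [support_monomial])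
  obtain ⟨d, rfl⟩ := exists_add_of_le hsu
  clear hsu h
  induction hd : d.degree generalizing d with
  | zero =>
    rw [Finsupp.degree_eq_zero_iff] at hd
    rwa [hd, add_zero]
  | succ m ih =>
    obtain ⟨i, hi⟩ : ∃ i, 0 < d i := by
      by_contra! h
      have : d = 0 := Finsupp.ext fun i => Nat.le_zero.1 (h i)
      rw [this, map_zero] at hd
      omega
    have h1 : d - Finsupp.single i 1 + Finsupp.single i 1 = d :=
      tsub_add_cancel_of_le (by rwa [Finsupp.single_le_iff])
    rw [← h1, ← add_assoc]
    exact hT _ (ih _ (by have := degree_sub_single hi; omega)) i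

open Classical in
/-- The monomials of degree `t` in an ideal. -/
noncomputable def monFinset (I : Ideal (MvPolynomial (Fin n) k)) (t : ℕ) : Finset (Fin n →₀ ℕ) :=
  (Finset.univ.finsuppAntidiag t).filter fun u => monomial u (1 : k) ∈ I

theorem mem_finsuppAntidiag_univ {t : ℕ} {u : Fin n →₀ ℕ} :
    u ∈ (Finset.univ : Finset (Fin n)).finsuppAntidiag t ↔ u.degree = t := by
  rw [Finset.mem_finsuppAntidiag']
  exact ⟨fun h => h.1, fun h => ⟨h, Finset.subset_univ _⟩⟩

theorem mem_monFinset {I : Ideal (MvPolynomial (Fin n) k)} {t : ℕ} {u : Fin n →₀ ℕ} :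
    u ∈ monFinset I t ↔ u.degree = t ∧ monomial u (1 : k) ∈ I := by
  classical
  rw [monFinset, Finset.mem_filter, mem_finsuppAntidiag_univ]

theorem IsMonomialIdeal.gradedPart_eq {I : Ideal (MvPolynomial (Fin n) k)}
    (hI : IsMonomialIdeal I) (t : ℕ) :
    gradedPart I t = restrictSupport k (monFinset I t : Set (Fin n →₀ ℕ)) := by
  ext p
  rw [mem_gradedPart, mem_restrictSupport_iff, hI.mem_iff]
  simp only [Set.subset_def, Finset.mem_coe, mem_support_iff, mem_monFinset]
  constructor
  · rintro ⟨h1, h2⟩ u hu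
    exact ⟨by_contra fun h => hu (h2.coeff_eq_zero h), h1 u hu⟩
  · intro h
    refine ⟨fun u hu => (h u hu).2, fun u hu => ?_⟩
    have := (h u hu).1
    rwa [Finsupp.degree_eq_weight_one] at this

theorem IsMonomialIdeal.hilb_eq {I : Ideal (MvPolynomial (Fin n) k)}
    (hI : IsMonomialIdeal I) (t : ℕ) : hilb I t = (monFinset I t).card := by
  rw [hilb, hI.gradedPart_eq, Module.finrank_eq_card_basis (basisRestrictSupport k _)]
  simp

/-- The monomials of degree `t` outside the ideal of powers: for each `j`, the variable `x_j` has
an exponent less than `e j`, while the exponents of the variables after `x_c` are arbitrary. -/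
def capMon (e : Fin c → ℕ) (n t : ℕ) : Finset (Fin n →₀ ℕ) :=
  (Finset.univ.finsuppAntidiag t).filter fun u => ∀ (i : Fin n) (j : Fin c), (i : ℕ) = j → u i < e j

theorem mem_capMon {e : Fin c → ℕ} {t : ℕ} {u : Fin n →₀ ℕ} :
    u ∈ capMon e n t ↔ u.degree = t ∧ ∀ (i : Fin n) (j : Fin c), (i : ℕ) = j → u i < e j := by
  rw [capMon, Finset.mem_filter, mem_finsuppAntidiag_univ]

theorem isMonomialIdeal_powerIdeal (e : Fin c → ℕ) : IsMonomialIdeal (powerIdeal k n e) := by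
  refine ⟨{u | ∃ (i : Fin n) (j : Fin c), (i : ℕ) = j ∧ u = Finsupp.single i (e j)}, ?_⟩
  rw [powerIdeal]
  congr 1
  ext p
  constructor
  · rintro ⟨i, j, h, rfl⟩
    exact ⟨_, ⟨i, j, h, rfl⟩, (X_pow_eq_monomial).symm⟩
  · rintro ⟨_, ⟨i, j, h, rfl⟩, rfl⟩
    exact ⟨i, j, h, (X_pow_eq_monomial).symm⟩

theorem monomial_mem_powerIdeal_iff {e : Fin c → ℕ} {u : Fin n →₀ ℕ} :
    monomial u (1 : k) ∈ powerIdeal k n e ↔ u ∉ capMon e n u.degree := by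
  have hT : ∀ u ∈ {u : Fin n →₀ ℕ | u ∉ capMon e n u.degree}, ∀ v,
      u + Finsupp.single v 1 ∈ {u : Fin n →₀ ℕ | u ∉ capMon e n u.degree} := by
    intro u hu v h
    refine hu (mem_capMon.2 ⟨rfl, fun i j hij => ?_⟩)
    exact (Nat.le_add_right _ _).trans_lt ((mem_capMon.1 h).2 i j hij)
  have heq : powerIdeal k n e =
      Ideal.span ((fun u => monomial u (1 : k)) '' {u | u ∉ capMon e n u.degree}) := by
    refine le_antisymm (Ideal.span_le.2 ?_) (Ideal.span_le.2 ?_)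
    · rintro _ ⟨i, j, h, rfl⟩
      refine Ideal.subset_span ⟨Finsupp.single i (e j), fun h' => ?_, (X_pow_eq_monomial).symm⟩
      have := (mem_capMon.1 h').2 i j h
      simp at this
    · rintro _ ⟨u, hu, rfl⟩
      have : ∃ (i : Fin n) (j : Fin c), (i : ℕ) = j ∧ e j ≤ u i := by
        by_contra! h
        exact hu (mem_capMon.2 ⟨rfl, h⟩)
      obtain ⟨i, j, hij, hle⟩ := this
      have h1 : u = (u - Finsupp.single i (e j)) + Finsupp.single i (e j) :=
        (tsub_add_cancel_of_le (Finsupp.single_le_iff.2 hle)).symm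
      have h2 : monomial u (1 : k) = monomial (u - Finsupp.single i (e j)) 1 * X i ^ e j := by
        rw [X_pow_eq_monomial, monomial_mul, mul_one, ← h1]
      show monomial u (1 : k) ∈ powerIdeal k n e
      rw [h2]
      exact Ideal.mul_mem_left _ _ (Ideal.subset_span ⟨i, j, hij, rfl⟩)
  rw [heq, monomial_mem_span_iff hT]
  rfl

theorem isMonomialIdeal_top : IsMonomialIdeal (⊤ : Ideal (MvPolynomial (Fin n) k)) := by
  refine ⟨Set.univ, ?_⟩
  rw [eq_comm, Ideal.eq_top_iff_one]
  exact Ideal.subset_span ⟨0, trivial, rfl⟩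

/-- The Hilbert function of a monomial ideal that is enlarged by the ideal of powers. -/
theorem hilb_sup_powerIdeal {L : Ideal (MvPolynomial (Fin n) k)} (hL : IsMonomialIdeal L)
    (e : Fin c → ℕ) (t : ℕ) [DecidablePred fun u : Fin n →₀ ℕ => monomial u (1 : k) ∈ L] :
    hilb (L ⊔ powerIdeal k n e) t = hilb (powerIdeal k n e) t +
      ((capMon e n t).filter fun u => monomial u (1 : k) ∈ L).card := by
  classical
  rw [(hL.sup (isMonomialIdeal_powerIdeal e)).hilb_eq, (isMonomialIdeal_powerIdeal e).hilb_eq,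
    ← Finset.card_union_of_disjoint]
  · congr 1
    ext u
    simp only [Finset.mem_union, Finset.mem_filter, mem_monFinset,
      hL.monomial_mem_sup (isMonomialIdeal_powerIdeal e), monomial_mem_powerIdeal_iff]
    constructor
    · rintro ⟨rfl, h⟩
      by_cases hu : u ∈ capMon e n u.degree
      · exact Or.inr ⟨hu, h.resolve_right (not_not_intro hu)⟩
      · exact Or.inl ⟨rfl, hu⟩
    · rintro (⟨h1, h2⟩ | ⟨h1, h2⟩)
      · exact ⟨h1, Or.inr h2⟩
      · exact ⟨(mem_capMon.1 h1).1, Or.inl h2⟩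
  · rw [Finset.disjoint_left]
    intro u hu hu'
    rw [mem_monFinset, monomial_mem_powerIdeal_iff] at hu
    rw [Finset.mem_filter] at hu'
    exact hu.2 (hu.1.symm ▸ hu'.1)

theorem hilb_powerIdeal_add_card (e : Fin c → ℕ) (t : ℕ) :
    hilb (powerIdeal k n e) t + (capMon e n t).card =
      hilb (⊤ : Ideal (MvPolynomial (Fin n) k)) t := by
  classical
  have := hilb_sup_powerIdeal (k := k) (n := n) isMonomialIdeal_top e t
  rw [top_sup_eq] at this
  rw [this]
  simp

/-- The exponent bounds, with a finite bound `N` in place of the absent ones. -/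
def capFn (e : Fin c → ℕ) (N : ℕ) (i : Fin n) : ℕ :=
  if h : (i : ℕ) < c then e ⟨i, h⟩ else N

theorem capMon_eq_stdMon (e : Fin c → ℕ) {t N : ℕ} (h : t < N) :
    capMon e n t = stdMon (capFn e N) Finset.univ t := by
  ext u
  rw [mem_capMon, mem_stdMon]
  refine and_congr_right fun hu => ⟨fun h1 => ⟨by simp, fun i _ => ?_⟩, fun h1 i j hij => ?_⟩
  · rw [capFn]
    split_ifs with hi
    · exact h1 i ⟨i, hi⟩ rfl
    · exact ((Finsupp.le_degree i u).trans hu.le).trans_lt h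
  · have := h1.2 i (Finset.mem_univ _)
    have hi : (i : ℕ) < c := hij ▸ j.2
    rw [capFn, dif_pos hi] at this
    rwa [show j = ⟨i, hi⟩ from Fin.ext hij.symm]

theorem capFn_mono {e : Fin c → ℕ} (he : Monotone e) {N : ℕ} (hN : ∀ j, e j ≤ N) {i j : Fin n}
    (hij : i ≤ j) : capFn e N i ≤ capFn e N j := by
  rw [capFn, capFn]
  split_ifs with h1 h2 h2
  · exact he hij
  · exact hN _
  · exact absurd (lt_of_le_of_lt (Fin.le_def.1 hij) h2) h1
  · exact le_rfl

open Classical in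
/-- The upper shadow of a set of monomials, outside the ideal of powers. -/
noncomputable def capShadow (e : Fin c → ℕ) (n t : ℕ) (W : Finset (Fin n →₀ ℕ)) :
    Finset (Fin n →₀ ℕ) :=
  (capMon e n (t + 1)).filter fun q => ∃ u ∈ W, ∃ i, q = u + Finsupp.single i 1

theorem mem_capShadow {e : Fin c → ℕ} {t : ℕ} {W : Finset (Fin n →₀ ℕ)} {q : Fin n →₀ ℕ} :
    q ∈ capShadow e n t W ↔ q ∈ capMon e n (t + 1) ∧ ∃ u ∈ W, ∃ i, q = u + Finsupp.single i 1 := by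
  classical
  rw [capShadow, Finset.mem_filter]

theorem capShadow_eq_shadow (e : Fin c → ℕ) {t N : ℕ} (h : t + 1 < N) (W : Finset (Fin n →₀ ℕ)) :
    capShadow e n t W = shadow (capFn e N) Finset.univ t W := by
  ext q
  rw [mem_capShadow, mem_shadow, capMon_eq_stdMon e h]

theorem exists_cap_bound (e : Fin c → ℕ) (t : ℕ) : ∃ N, t + 1 < N ∧ ∀ j, e j ≤ N :=
  ⟨t + 2 + ∑ j, e j, by omega, fun j =>
    (Finset.single_le_sum (fun _ _ => Nat.zero_le _) (Finset.mem_univ j)).trans (by omega)⟩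

theorem isInit_capShadow {e : Fin c → ℕ} {t : ℕ} {S : Finset (Fin n →₀ ℕ)}
    (hS : IsInit (capMon e n t) S) : IsInit (capMon e n (t + 1)) (capShadow e n t S) := by
  obtain ⟨N, hN, -⟩ := exists_cap_bound e t
  rw [capMon_eq_stdMon e hN, capShadow_eq_shadow e hN]
  rw [capMon_eq_stdMon e (show t < N by omega)] at hS
  exact isInit_shadow hS

theorem card_capShadow_le {e : Fin c → ℕ} (he : Monotone e) {t : ℕ} {W S : Finset (Fin n →₀ ℕ)}
    (hW : W ⊆ capMon e n t) (hS : IsInit (capMon e n t) S) (hc : S.card ≤ W.card) :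
    (capShadow e n t S).card ≤ (capShadow e n t W).card := by
  obtain ⟨N, hN, hN'⟩ := exists_cap_bound e t
  rw [capShadow_eq_shadow e hN, capShadow_eq_shadow e hN]
  rw [capMon_eq_stdMon e (show t < N by omega)] at hS hW
  exact card_shadow_le (fun i _ j _ hij => capFn_mono he hN' hij) hW hS hc

/-- Initial segments whose shadows are contained in each other are cut out by a lex-segment ideal,
namely by the largest one that does so. -/
theorem exists_lexSegment (k : Type u) [Field k] {e : Fin c → ℕ} {S : ℕ → Finset (Fin n →₀ ℕ)}
    (hS : ∀ t, IsInit (capMon e n t) (S t)) (hsh : ∀ t, capShadow e n t (S t) ⊆ S (t + 1)) :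
    ∃ L : Ideal (MvPolynomial (Fin n) k), IsLexSegment L ∧
      ∀ t, ∀ u ∈ capMon e n t, monomial u (1 : k) ∈ L ↔ u ∈ S t := by
  set T : Set (Fin n →₀ ℕ) :=
    {u | ∀ q ∈ capMon e n u.degree, toLex u ≤ toLex q → q ∈ S u.degree} with hTdef
  have hT : ∀ u ∈ T, ∀ v, u + Finsupp.single v 1 ∈ T := by
    intro u hu v q hq hle
    rw [degree_add_single] at hq ⊢
    obtain ⟨j, hj, hle'⟩ := exists_sub_single_ge (mem_capMon.1 hq).1 hle
    have hqj : q - Finsupp.single j 1 + Finsupp.single j 1 = q :=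
      tsub_add_cancel_of_le (by rwa [Finsupp.single_le_iff])
    refine hsh _ (mem_capShadow.2 ⟨hq, _, hu _ (mem_capMon.2 ⟨?_, fun i l hil => ?_⟩) hle', j,
      hqj.symm⟩)
    · have := degree_sub_single hj
      have := (mem_capMon.1 hq).1
      omega
    · rw [Finsupp.tsub_apply]
      exact (Nat.sub_le _ _).trans_lt ((mem_capMon.1 hq).2 i l hil)
  refine ⟨Ideal.span ((fun u => monomial u (1 : k)) '' T), ⟨⟨T, rfl⟩, ?_⟩, ?_⟩
  · intro u v hd hlt hu
    rw [monomial_mem_span_iff hT] at hu ⊢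
    intro q hq hle
    rw [← hd] at hq ⊢
    exact hu q hq (hlt.le.trans hle)
  · intro t u hu
    rw [monomial_mem_span_iff hT]
    obtain rfl := (mem_capMon.1 hu).1
    refine ⟨fun h => h u hu le_rfl, fun h q hq hle => ?_⟩
    rcases hle.eq_or_lt with h' | h'
    · rwa [← show u = q from h']
    · exact (hS _).up u h q hq h'

theorem IsLexSegment.isInit {L : Ideal (MvPolynomial (Fin n) k)} (hL : IsLexSegment L)
    (e : Fin c → ℕ) (t : ℕ) [DecidablePred fun u : Fin n →₀ ℕ => monomial u (1 : k) ∈ L] :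
    IsInit (capMon e n t) ((capMon e n t).filter fun u => monomial u (1 : k) ∈ L) := by
  refine ⟨Finset.filter_subset _ _, fun u hu q hq hlt => ?_⟩
  rw [Finset.mem_filter] at hu ⊢
  refine ⟨hq, hL.2 u q ?_ hlt hu.2⟩
  rw [(mem_capMon.1 hu.1).1, (mem_capMon.1 hq).1]

end MonomialIdeals

section Growth

variable {k : Type u} [Field k] {n c : ℕ}

/-- The monomials of degree `t`, outside the ideal of powers, that are initial monomials of forms in
an ideal `I`. -/
theorem exists_initialMonomials {e : Fin c → ℕ} {I : Ideal (MvPolynomial (Fin n) k)}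
    (hI : powerIdeal k n e ≤ I) : ∃ W : ℕ → Finset (Fin n →₀ ℕ),
      (∀ t, W t ⊆ capMon e n t) ∧ (∀ t, capShadow e n t (W t) ⊆ W (t + 1)) ∧
        ∀ t, (W t).card + hilb (powerIdeal k n e) t = hilb I t := by
  classical
  set coef : Lex (Fin n →₀ ℕ) → MvPolynomial (Fin n) k →ₗ[k] k := fun u => lcoeff k (ofLex u)
  have hcoef : ∀ u p, coef u p = coeff (ofLex u) p := fun u p => rfl
  refine ⟨fun t => (capMon e n t).filter fun u => lead coef (gradedPart I t) (toLex u) ≠ ⊥,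
    fun t => Finset.filter_subset _ _, fun t q hq => ?_, fun t => ?_⟩
  · obtain ⟨hq, u, hu, v, rfl⟩ := mem_capShadow.1 hq
    refine Finset.mem_filter.2 ⟨hq, ?_⟩
    obtain ⟨-, hu⟩ := Finset.mem_filter.1 hu
    rw [Submodule.ne_bot_iff] at hu ⊢
    obtain ⟨a, ha, ha0⟩ := hu
    obtain ⟨p, hp, hlt, rfl⟩ := mem_lead.1 ha
    refine ⟨_, mem_lead.2 ⟨X v * p, (isGradedFamily_gradedPart I).X_mul t v p hp, fun l hl => ?_,
      rfl⟩, ?_⟩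
    · rw [hcoef, coeff_X_mul']
      split_ifs with h
      · refine hlt (toLex (ofLex l - Finsupp.single v 1)) ?_
        have : ofLex l - Finsupp.single v 1 + Finsupp.single v 1 = ofLex l := by
          refine tsub_add_cancel_of_le ?_
          rw [Finsupp.single_le_iff]
          rw [Finsupp.mem_support_iff] at h
          omega
        rw [← lex_add_lt_add_iff (w := Finsupp.single v 1), this]
        exact hl
      · rfl
    · rw [hcoef, ofLex_toLex, coeff_X_mul', if_pos (by simp), add_tsub_cancel_right]
      exact ha0
  · have h1 := finrank_eq_sum_lead coef (gradedPart I t)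
      ((Finset.univ.finsuppAntidiag t).image toLex) (fun q hq l hl => ?_) fun q hq h => ?_
    · rw [Finset.sum_image fun a _ b _ h => toLex_inj.1 h] at h1
      have h2 : ∀ u : Fin n →₀ ℕ, Module.finrank k (lead coef (gradedPart I t) (toLex u)) =
          if lead coef (gradedPart I t) (toLex u) ≠ ⊥ then 1 else 0 := by
        intro u
        split_ifs with h
        · have h3 : 0 < Module.finrank k (lead coef (gradedPart I t) (toLex u)) :=
            Nat.pos_of_ne_zero fun h' => h (Submodule.finrank_eq_zero.1 h')
          have h4 := Submodule.finrank_le (lead coef (gradedPart I t) (toLex u))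
          rw [Module.finrank_self] at h4
          omega
        · rw [not_not.1 h, finrank_bot]
      dsimp only
      rw [show hilb I t = _ from h1, Finset.sum_congr rfl fun u _ => h2 u, Finset.sum_boole, Nat.cast_id,
        (isMonomialIdeal_powerIdeal e).hilb_eq, ← Finset.card_union_of_disjoint]
      · congr 1
        ext u
        simp only [Finset.mem_union, Finset.mem_filter, mem_monFinset, mem_finsuppAntidiag_univ,
          monomial_mem_powerIdeal_iff]
        constructor
        · rintro (⟨h3, h4⟩ | ⟨rfl, h4⟩)
          · exact ⟨(mem_capMon.1 h3).1, h4⟩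
          · refine ⟨rfl, (Submodule.ne_bot_iff _).2 ⟨1, mem_lead.2 ⟨monomial u 1, ⟨hI
              (monomial_mem_powerIdeal_iff.2 h4), isHomogeneous_monomial _ rfl⟩, fun l hl => ?_, ?_⟩,
              one_ne_zero⟩⟩
            · rw [hcoef, coeff_monomial, if_neg]
              rintro rfl
              exact lt_irrefl _ hl
            · rw [hcoef, ofLex_toLex, coeff_monomial, if_pos rfl]
        · rintro ⟨rfl, h4⟩
          by_cases hu : u ∈ capMon e n u.degree
          · exact Or.inl ⟨hu, h4⟩
          · exact Or.inr ⟨rfl, hu⟩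
      · rw [Finset.disjoint_left]
        intro u hu hu'
        rw [mem_monFinset, monomial_mem_powerIdeal_iff] at hu'
        exact hu'.2 (hu'.1.symm ▸ (Finset.mem_filter.1 hu).1)
    · rw [hcoef]
      refine hq.2.coeff_eq_zero fun h => hl (Finset.mem_image.2 ⟨ofLex l, ?_, rfl⟩)
      rwa [mem_finsuppAntidiag_univ]
    · ext u
      exact h (toLex u)

/-- The numerical form of the Eisenbud–Green–Harris property of a homogeneous ideal `a`: a space `U`
of forms of degree `t` that contains `a_t` grows, modulo `a`, at least as fast as the initial
segment of its size does modulo the ideal of powers. -/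
def LexGrowth (e : Fin c → ℕ) (a : Ideal (MvPolynomial (Fin n) k)) : Prop :=
  ∀ (t : ℕ) (U U' : Submodule k (MvPolynomial (Fin n) k)),
    gradedPart a t ≤ U → U ≤ homogeneousSubmodule (Fin n) k t →
    gradedPart a (t + 1) ≤ U' → U' ≤ homogeneousSubmodule (Fin n) k (t + 1) →
    (∀ p ∈ U, ∀ v, X v * p ∈ U') → ∀ S, IsInit (capMon e n t) S →
    S.card + hilb (powerIdeal k n e) t ≤ Module.finrank k U →
    (capShadow e n t S).card + hilb (powerIdeal k n e) (t + 1) ≤ Module.finrank k U'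

/-- The Eisenbud–Green–Harris property implies its numerical form: a single pair of consecutive
degrees extends to a homogeneous ideal, and the Clements–Lindström theorem bounds the growth of the
initial monomials of the corresponding ideal over the ideal of powers. -/
theorem lexGrowth_of_hilbertPoset_subset {e : Fin c → ℕ} (he : Monotone e)
    {a : Ideal (MvPolynomial (Fin n) k)} (ha : IsHomogeneousIdeal a)
    (hab : ∀ t, hilb a t = hilb (powerIdeal k n e) t)
    (h : hilbertPoset a ⊆ hilbertPoset (powerIdeal k n e)) : LexGrowth e a := by
  intro t U U' hU hUt hU' hUt' hmul S hS hc
  -- the ideal that is `a` below degree `t` and everything above degree `t + 1`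
  set F : ℕ → Submodule k (MvPolynomial (Fin n) k) := fun s =>
    if s < t then gradedPart a s else if s = t then U else if s = t + 1 then U' else
      homogeneousSubmodule (Fin n) k s with hF
  have hFa : ∀ s, gradedPart a s ≤ F s := by
    intro s
    simp only [hF]
    split_ifs with h1 h2 h3
    · exact le_rfl
    · exact h2 ▸ hU
    · exact h3 ▸ hU'
    · exact inf_le_right
  have hFs : ∀ s, F s ≤ homogeneousSubmodule (Fin n) k s := by
    intro s
    simp only [hF]
    split_ifs with h1 h2 h3
    · exact inf_le_right
    · exact h2 ▸ hUt
    · exact h3 ▸ hUt'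
    · exact le_rfl
  have hFt : F t = U := by simp [hF]
  have hFt' : F (t + 1) = U' := by simp [hF]
  have hfam : IsGradedFamily F := by
    refine ⟨hFs, fun s v p hp => ?_⟩
    rcases lt_trichotomy s t with hs | rfl | hs
    · refine hFa _ ((isGradedFamily_gradedPart a).X_mul s v p ?_)
      simpa only [hF, if_pos hs] using hp
    · rw [hFt']
      exact hmul p (hFt ▸ hp) v
    · have : F (s + 1) = homogeneousSubmodule (Fin n) k (s + 1) := by
        simp only [hF]
        rw [if_neg (by omega), if_neg (by omega), if_neg (by omega)]
      rw [this]
      exact X_mul_mem_homogeneous v (hFs s hp)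
  obtain ⟨I', -, hbI', heq⟩ := (hilbertPoset_subset_iff hab).1 h _ (isHomogeneousIdeal_familyIdeal hfam)
    (le_of_gradedPart_le ha fun s => by
      rw [gradedPart_familyIdeal]
      exact hFa s)
  obtain ⟨W, hW, hsh, hWc⟩ := exists_initialMonomials hbI'
  have h1 := hWc t
  have h2 := hWc (t + 1)
  rw [← heq, hilb_familyIdeal, hFt] at h1
  rw [← heq, hilb_familyIdeal, hFt'] at h2
  have h3 := card_capShadow_le he (hW t) hS (by omega)
  have h4 := Finset.card_le_card (hsh t)
  omega

theorem exists_lexSegment_hilb_eq {e : Fin c → ℕ} {H : ℕ → ℕ}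
    (h1 : ∀ t, hilb (powerIdeal k n e) t ≤ H t)
    (h2 : ∀ t, H t ≤ hilb (⊤ : Ideal (MvPolynomial (Fin n) k)) t)
    (h3 : ∀ t S, IsInit (capMon e n t) S → S.card + hilb (powerIdeal k n e) t ≤ H t →
      (capShadow e n t S).card + hilb (powerIdeal k n e) (t + 1) ≤ H (t + 1)) :
    ∃ L : Ideal (MvPolynomial (Fin n) k), IsLexSegment L ∧
      ∀ t, hilb (L ⊔ powerIdeal k n e) t = H t := by
  classical
  have hle : ∀ t, H t - hilb (powerIdeal k n e) t ≤ (capMon e n t).card := fun t => by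
    have := hilb_powerIdeal_add_card (k := k) (n := n) e t
    have := h2 t
    omega
  choose S hS hSc using fun t => exists_isInit_card _ (hle t)
  obtain ⟨L, hL, hLS⟩ := exists_lexSegment k hS fun t =>
    (isInit_capShadow (hS t)).subset_of_card_le (hS (t + 1)) (by
      have := h3 t (S t) (hS t) (by rw [hSc]; have := h1 t; omega)
      rw [hSc]
      omega)
  refine ⟨L, hL, fun t => ?_⟩
  rw [hilb_sup_powerIdeal hL.1, Finset.filter_congr (hLS t), Finset.filter_mem_eq_inter,
    Finset.inter_eq_right.2 (hS t).subset, hSc]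
  have := h1 t
  omega

theorem LexGrowth.of_ideal {e : Fin c → ℕ} {a I : Ideal (MvPolynomial (Fin n) k)}
    (h : LexGrowth e a) (haI : a ≤ I) (t : ℕ) (S : Finset (Fin n →₀ ℕ))
    (hS : IsInit (capMon e n t) S) (hc : S.card + hilb (powerIdeal k n e) t ≤ hilb I t) :
    (capShadow e n t S).card + hilb (powerIdeal k n e) (t + 1) ≤ hilb I (t + 1) :=
  h t _ _ (gradedPart_mono haI t) inf_le_right (gradedPart_mono haI (t + 1)) inf_le_right
    (fun p hp v => (isGradedFamily_gradedPart I).X_mul t v p hp) S hS hc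

theorem LexGrowth.exists_lexSegment {e : Fin c → ℕ} {a I : Ideal (MvPolynomial (Fin n) k)}
    (h : LexGrowth e a) (hab : ∀ t, hilb a t = hilb (powerIdeal k n e) t) (haI : a ≤ I) :
    ∃ L : Ideal (MvPolynomial (Fin n) k), IsLexSegment L ∧
      ∀ t, hilb (L ⊔ powerIdeal k n e) t = hilb I t :=
  exists_lexSegment_hilb_eq (fun t => hab t ▸ hilb_mono haI t) (fun t => hilb_mono le_top t)
    (h.of_ideal haI)

theorem LexGrowth.hilbertPoset_subset {e : Fin c → ℕ} {a : Ideal (MvPolynomial (Fin n) k)}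
    (h : LexGrowth e a) (hab : ∀ t, hilb a t = hilb (powerIdeal k n e) t) :
    hilbertPoset a ⊆ hilbertPoset (powerIdeal k n e) := by
  rw [hilbertPoset_subset_iff hab]
  intro I hI haI
  obtain ⟨L, hL, heq⟩ := h.exists_lexSegment hab haI
  exact ⟨L ⊔ powerIdeal k n e, ((IsMonomialIdeal.sup hL.1
    (isMonomialIdeal_powerIdeal e)).isHomogeneousIdeal), le_sup_right, fun t => (heq t).symm⟩

/-- The inequality of Betti numbers that the lex-plus-powers conjecture asserts. -/
def LexBetti (e : Fin c → ℕ) (a : Ideal (MvPolynomial (Fin n) k)) : Prop :=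
  ∀ I L : Ideal (MvPolynomial (Fin n) k), IsHomogeneousIdeal I → a ≤ I → IsLexSegment L →
    (∀ t, hilb I t = hilb (L ⊔ powerIdeal k n e) t) →
    ∀ i j, gradedBetti I i j ≤ gradedBetti (L ⊔ powerIdeal k n e) i j

theorem satisfies_iff {e : Fin c → ℕ} (he : Monotone e) {f : Fin c → MvPolynomial (Fin n) k}
    (hf : ∀ i, (f i).IsHomogeneous (e i))
    (hab : ∀ t, hilb (Ideal.span (Set.range f)) t = hilb (powerIdeal k n e) t) :
    SatisfiesEGH f e ∧ SatisfiesLPP f e ↔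
      LexGrowth e (Ideal.span (Set.range f)) ∧ LexBetti e (Ideal.span (Set.range f)) := by
  have ha : IsHomogeneousIdeal (Ideal.span (Set.range f)) := by
    refine isHomogeneousIdeal_span ?_
    rintro _ ⟨i, rfl⟩
    exact ⟨e i, hf i⟩
  have hle : ∀ I : Ideal (MvPolynomial (Fin n) k),
      Ideal.span (Set.range f) ≤ I ↔ ∀ i, f i ∈ I := fun I => by
    rw [Ideal.span_le, Set.range_subset_iff]
    rfl
  have key : ∀ I L : Ideal (MvPolynomial (Fin n) k), Ideal.span (Set.range f) ≤ I →
      (hilbertSeries (Ideal.span (Set.range f))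
          (I.map (Ideal.Quotient.mk (Ideal.span (Set.range f)))) =
        hilbertSeries (powerIdeal k n e) (L.map (Ideal.Quotient.mk (powerIdeal k n e))) ↔
      ∀ t, hilb I t = hilb (L ⊔ powerIdeal k n e) t) := by
    intro I L haI
    rw [funext_iff]
    refine forall_congr' fun t => ?_
    have h1 := hilbertSeries_map_add_hilb (Ideal.span (Set.range f)) I t
    have h2 := hilbertSeries_map_add_hilb (powerIdeal k n e) L t
    rw [sup_eq_left.2 haI] at h1
    rw [← h1, ← h2, hab]
    omega
  constructor
  · rintro ⟨h1, h2⟩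
    exact ⟨lexGrowth_of_hilbertPoset_subset he ha hab h1, fun I L hI haI hL h =>
      h2 h1 I L hI ((hle I).1 haI) hL ((key I L haI).2 h)⟩
  · rintro ⟨h1, h2⟩
    exact ⟨h1.hilbertPoset_subset hab, fun _ I L hI haI hL h =>
      h2 I L hI ((hle I).2 haI) hL ((key I L ((hle I).2 haI)).1 h)⟩

end Growth

/-! ### Koszul complexes of commuting operators -/

section Koszul

variable {k : Type*} [Field k] {V W : Type*} [AddCommGroup V] [Module k V] [AddCommGroup W]
  [Module k W] {n : ℕ}

/-- The sign of `w` in front of the elements of `S` in an exterior product. -/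
def extSign (S : Finset (Fin n)) (w : Fin n) : ℤˣ := (-1) ^ (S.filter (· < w)).card

theorem extSign_insert_of_lt {S : Finset (Fin n)} {a b : Fin n} (ha : a ∉ S) (h : a < b) :
    extSign (insert a S) b = - extSign S b := by
  rw [extSign, extSign, Finset.filter_insert, if_pos h, Finset.card_insert_of_notMem (by simp [ha]),
    pow_succ, mul_neg_one]

theorem extSign_insert_of_gt {S : Finset (Fin n)} {a b : Fin n} (h : b ≤ a) :
    extSign (insert a S) b = extSign S b := by
  rw [extSign, extSign, Finset.filter_insert, if_neg h.not_gt]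

theorem extSign_mul_self (S : Finset (Fin n)) (w : Fin n) : extSign S w * extSign S w = 1 :=
  Int.units_mul_self _

theorem extSign_insert_mul {S : Finset (Fin n)} {a b : Fin n} (hab : a ≠ b) (ha : a ∉ S)
    (hb : b ∉ S) : extSign S a * extSign (insert a S) b = -(extSign S b * extSign (insert b S) a) := by
  rcases lt_or_gt_of_ne hab with h | h
  · rw [extSign_insert_of_lt ha h, extSign_insert_of_gt h.le, mul_neg, mul_comm]
  · rw [extSign_insert_of_lt hb h, extSign_insert_of_gt h.le, mul_neg, neg_neg, mul_comm]

variable (k V) in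
/-- The contraction by the `w`-th coordinate on the exterior algebra with coefficients in `V`. -/
def contr (w : Fin n) : Module.End k (Finset (Fin n) → V) where
  toFun φ S := if w ∈ S then 0 else extSign S w • φ (insert w S)
  map_add' φ ψ := by
    funext S
    simp only [Pi.add_apply]
    split_ifs
    · rw [add_zero]
    · rw [smul_add]
  map_smul' a φ := by
    funext S
    simp only [Pi.smul_apply, RingHom.id_apply]
    split_ifs
    · rw [smul_zero]
    · rw [smul_comm]

variable (k V) in
/-- The exterior multiplication by the `w`-th basis vector. -/
def wedge (w : Fin n) : Module.End k (Finset (Fin n) → V) where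
  toFun φ S := if w ∈ S then extSign (S.erase w) w • φ (S.erase w) else 0
  map_add' φ ψ := by
    funext S
    simp only [Pi.add_apply]
    split_ifs
    · rw [smul_add]
    · rw [add_zero]
  map_smul' a φ := by
    funext S
    simp only [Pi.smul_apply, RingHom.id_apply]
    split_ifs
    · rw [smul_comm]
    · rw [smul_zero]

theorem contr_apply (w : Fin n) (φ : Finset (Fin n) → V) (S : Finset (Fin n)) :
    contr k V w φ S = if w ∈ S then 0 else extSign S w • φ (insert w S) := rfl

theorem wedge_apply (w : Fin n) (φ : Finset (Fin n) → V) (S : Finset (Fin n)) :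
    wedge k V w φ S = if w ∈ S then extSign (S.erase w) w • φ (S.erase w) else 0 := rfl

theorem contr_mul_contr (a b : Fin n) : contr k V a * contr k V b = -(contr k V b * contr k V a) := by
  refine LinearMap.ext fun φ => ?_
  funext S
  simp only [Module.End.mul_apply, contr_apply, LinearMap.neg_apply, Pi.neg_apply, Finset.mem_insert]
  by_cases hab : a = b
  · subst hab
    simp
  by_cases ha : a ∈ S
  · simp [ha]
  by_cases hb : b ∈ S
  · simp [hb]
  simp only [ha, hb, hab, Ne.symm hab, if_false, or_self, smul_smul, Finset.insert_comm b a]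
  rw [extSign_insert_mul hab ha hb, Units.neg_smul]

theorem contr_mul_self (a : Fin n) : contr k V a * contr k V a = 0 := by
  refine LinearMap.ext fun φ => ?_
  funext S
  simp [contr_apply]

theorem contr_mul_wedge (a b : Fin n) :
    contr k V a * wedge k V b = (if a = b then 1 else 0) - wedge k V b * contr k V a := by
  refine LinearMap.ext fun φ => ?_
  funext S
  by_cases hab : a = b
  · subst hab
    by_cases ha : a ∈ S
    · simp [contr_apply, wedge_apply, ha, smul_smul]
    · simp [contr_apply, wedge_apply, ha, smul_smul]
  · simp only [hab, if_false, zero_sub, LinearMap.neg_apply, Pi.neg_apply, Module.End.mul_apply,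
      contr_apply, wedge_apply, Finset.mem_insert, Ne.symm hab, false_or, Finset.mem_erase]
    by_cases ha : a ∈ S
    · simp [ha, hab]
    by_cases hb : b ∈ S
    · simp only [ha, hb, and_false, if_false, if_true, smul_smul]
      obtain ⟨R, hbR, rfl⟩ : ∃ R, b ∉ R ∧ S = insert b R :=
        ⟨S.erase b, Finset.notMem_erase _ _, (Finset.insert_erase hb).symm⟩
      have haR : a ∉ R := fun h => ha (Finset.mem_insert_of_mem h)
      rw [Finset.insert_comm a b, Finset.erase_insert hbR,
        Finset.erase_insert (by simp [Ne.symm hab, hbR]), ← Units.neg_smul]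
      congr 1
      have h := extSign_insert_mul hab haR hbR
      have h1 : extSign (insert a R) b =
          -(extSign R a * extSign R b * extSign (insert b R) a) := by
        calc extSign (insert a R) b = extSign R a * (extSign R a * extSign (insert a R) b) := by
              rw [← mul_assoc, extSign_mul_self, one_mul]
          _ = _ := by rw [h, mul_neg, ← mul_assoc]
      rw [h1, mul_neg, mul_comm (extSign R a * _), ← mul_assoc, extSign_mul_self, one_mul, mul_comm]
    · simp [hb]

/-- An operator on the coefficients of the exterior algebra. -/
def onCoeff (f : V →ₗ[k] W) : (Finset (Fin n) → V) →ₗ[k] (Finset (Fin n) → W) :=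
  f.compLeft (Finset (Fin n))

theorem onCoeff_apply (f : V →ₗ[k] W) (φ : Finset (Fin n) → V) (S : Finset (Fin n)) :
    onCoeff f φ S = f (φ S) := rfl

theorem onCoeff_contr (f : V →ₗ[k] W) (w : Fin n) (φ : Finset (Fin n) → V) :
    onCoeff f (contr k V w φ) = contr k W w (onCoeff f φ) := by
  funext S
  rw [onCoeff_apply, contr_apply, contr_apply]
  split_ifs
  · rw [map_zero]
  · rw [Units.smul_def, map_zsmul, Units.smul_def, onCoeff_apply]

theorem onCoeff_wedge (f : V →ₗ[k] W) (w : Fin n) (φ : Finset (Fin n) → V) :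
    onCoeff f (wedge k V w φ) = wedge k W w (onCoeff f φ) := by
  funext S
  rw [onCoeff_apply, wedge_apply, wedge_apply]
  split_ifs
  · rw [Units.smul_def, map_zsmul, Units.smul_def, onCoeff_apply]
  · rw [map_zero]

/-- The differential of the Koszul complex of a family of operators on `V`. -/
def kosz (X : Fin n → Module.End k V) : Module.End k (Finset (Fin n) → V) :=
  ∑ w, onCoeff (X w) * contr k V w

theorem kosz_apply (X : Fin n → Module.End k V) (φ : Finset (Fin n) → V) :
    kosz X φ = ∑ w, onCoeff (X w) (contr k V w φ) := by
  simp [kosz, LinearMap.sum_apply]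

theorem kosz_apply_apply (X : Fin n → Module.End k V) (φ : Finset (Fin n) → V)
    (S : Finset (Fin n)) : kosz X φ S = ∑ w ∈ Sᶜ, extSign S w • X w (φ (insert w S)) := by
  rw [kosz_apply, Finset.sum_apply, ← Finset.sum_subset (Finset.subset_univ Sᶜ)]
  · refine Finset.sum_congr rfl fun w hw => ?_
    rw [onCoeff_apply, contr_apply, if_neg (Finset.mem_compl.1 hw), Units.smul_def, map_zsmul,
      Units.smul_def]
  · intro w _ hw
    rw [Finset.mem_compl, not_not] at hw
    rw [onCoeff_apply, contr_apply, if_pos hw, map_zero]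

theorem kosz_onCoeff {X : Fin n → Module.End k V} {Y : Fin n → Module.End k W} {f : V →ₗ[k] W}
    (h : ∀ w x, f (X w x) = Y w (f x)) (φ : Finset (Fin n) → V) :
    kosz Y (onCoeff f φ) = onCoeff f (kosz X φ) := by
  rw [kosz_apply, kosz_apply, map_sum]
  refine Finset.sum_congr rfl fun w _ => ?_
  rw [← onCoeff_contr]
  funext S
  exact (h w _).symm

theorem kosz_kosz {X : Fin n → Module.End k V} (h : ∀ v w, X v * X w = X w * X v)
    (φ : Finset (Fin n) → V) : kosz X (kosz X φ) = 0 := by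
  rw [kosz_apply, kosz_apply]
  simp only [map_sum]
  have h1 : ∀ v w, onCoeff (X v) (contr k V v (onCoeff (X w) (contr k V w φ))) =
      -onCoeff (X w) (contr k V w (onCoeff (X v) (contr k V v φ))) := by
    intro v w
    rw [← onCoeff_contr, ← onCoeff_contr]
    have h2 := LinearMap.congr_fun (contr_mul_contr (k := k) (V := V) v w) φ
    rw [Module.End.mul_apply, LinearMap.neg_apply, Module.End.mul_apply] at h2
    rw [h2]
    funext S
    simp only [onCoeff_apply, Pi.neg_apply, map_neg]
    rw [← Module.End.mul_apply, h, Module.End.mul_apply]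
  have h3 : ∀ v, onCoeff (X v) (contr k V v (onCoeff (X v) (contr k V v φ))) = 0 := by
    intro v
    rw [← onCoeff_contr, ← Module.End.mul_apply (contr k V v), contr_mul_self]
    simp
  rw [← Finset.sum_product']
  refine Finset.sum_involution (fun p _ => (p.2, p.1)) ?_ ?_ ?_ ?_
  · rintro ⟨v, w⟩ _
    rw [h1 v w, neg_add_cancel]
  · rintro ⟨v, w⟩ _ hne heq
    obtain rfl : w = v := congrArg Prod.fst heq
    exact hne (h3 w)
  · simp
  · simp

theorem intertwine_of_relations {R : Type*} [Ring R] {D h ι P M : R} (hDh : D * h = M - h * D)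
    (hDι : D * ι = -(ι * D)) (hιD : ι * P * D = ι * D * P) (hιP : ι * P = P * ι)
    (hιM : ι * M = M * ι) (hιι : ι * ι = 0) :
    D * (1 + h * ι * P) = (1 + h * ι * P) * (D + M * P * ι) := by
  have h1 : D * (h * ι * P) = M * P * ι + h * (ι * D * P) := by
    calc D * (h * ι * P) = D * h * ι * P := by noncomm_ring
      _ = M * (ι * P) - h * (D * ι) * P := by rw [hDh]; noncomm_ring
      _ = _ := by rw [hDι, hιP]; noncomm_ring
  have h2 : h * ι * P * (M * P * ι) = 0 := by
    calc h * ι * P * (M * P * ι) = h * (ι * P) * M * P * ι := by noncomm_ring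
      _ = h * P * (ι * M) * P * ι := by rw [hιP]; noncomm_ring
      _ = h * P * M * (ι * P) * ι := by rw [hιM]; noncomm_ring
      _ = h * P * M * P * (ι * ι) := by rw [hιP]; noncomm_ring
      _ = 0 := by rw [hιι, mul_zero]
  rw [mul_add, mul_one, h1, ← hιD, add_mul, one_mul, mul_add, h2, add_zero]
  noncomm_ring

/-- The operator on the exterior algebra that replaces the `j`-th basis vector `e_j` by
`e_j + π e_v`. -/
def shear (v j : Fin n) (π : Module.End k V) : Module.End k (Finset (Fin n) → V) :=
  1 + wedge k V v * contr k V j * onCoeff π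

/-- If `X_j` is replaced by `X_j + X_v π`, where `π` commutes with the other operators, the Koszul
complex is replaced by an isomorphic one. -/
theorem kosz_shear {X : Fin n → Module.End k V} {v j : Fin n} (hvj : v ≠ j) {π : Module.End k V}
    (hπ : ∀ i, i ≠ j → π * X i = X i * π) (φ : Finset (Fin n) → V) :
    kosz X (shear v j π φ) = shear v j π (kosz (Function.update X j (X j + X v * π)) φ) := by
  have hcι : ∀ (f : Module.End k V) w, onCoeff f * contr k V w = contr k V (n := n) w * onCoeff f :=
    fun f w => LinearMap.ext fun φ => onCoeff_contr f w φ
  have hcw : ∀ (f : Module.End k V) w, onCoeff f * wedge k V w = wedge k V (n := n) w * onCoeff f :=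
    fun f w => LinearMap.ext fun φ => onCoeff_wedge f w φ
  have hmul : ∀ f g : Module.End k V, onCoeff (n := n) (f * g) = onCoeff f * onCoeff g :=
    fun f g => rfl
  have hadd : ∀ f g : Module.End k V, onCoeff (n := n) (f + g) = onCoeff f + onCoeff g :=
    fun f g => rfl
  have hD' : kosz (Function.update X j (X j + X v * π)) =
      kosz X + onCoeff (X v) * onCoeff π * contr k V j := by
    rw [kosz, kosz, ← Finset.add_sum_erase _ _ (Finset.mem_univ j),
      ← Finset.add_sum_erase Finset.univ (fun w => onCoeff (X w) * contr k V w) (Finset.mem_univ j),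
      Function.update_self, hadd, hmul, add_mul]
    rw [Finset.sum_congr rfl fun w hw => by rw [Function.update_of_ne (Finset.ne_of_mem_erase hw)]]
    abel
  have hDw : kosz X * wedge k V v = onCoeff (X v) - wedge k V v * kosz X := by
    have : ∀ w, onCoeff (X w) * contr k V w * wedge k V v =
        (if w = v then onCoeff (X w) else 0) - wedge k V v * (onCoeff (X w) * contr k V w) := by
      intro w
      rw [mul_assoc, contr_mul_wedge, mul_sub, ← mul_assoc, ← mul_assoc, hcw]
      split_ifs <;> simp
    rw [kosz, Finset.sum_mul, Finset.sum_congr rfl fun w _ => this w, Finset.sum_sub_distrib,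
      Finset.mul_sum]
    simp
  have hmn : ∀ A B : Module.End k (Finset (Fin n) → V), A * -B = -(A * B) :=
    fun A B => LinearMap.ext fun x => map_neg A _
  have hDι : kosz X * contr k V j = -(contr k V j * kosz X) := by
    rw [kosz, Finset.sum_mul, Finset.mul_sum, ← Finset.sum_neg_distrib]
    refine Finset.sum_congr rfl fun w _ => ?_
    rw [mul_assoc, contr_mul_contr, hmn, ← mul_assoc, hcι, mul_assoc]
  have hιD : contr k V j * onCoeff π * kosz X = contr k V j * kosz X * onCoeff π := by
    rw [kosz, Finset.mul_sum, Finset.mul_sum, Finset.sum_mul]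
    refine Finset.sum_congr rfl fun w _ => ?_
    by_cases hw : w = j
    · subst hw
      have h0 : ∀ f : Module.End k V, contr k V w * (onCoeff f * contr k V w) = 0 := fun f => by
        rw [hcι, ← mul_assoc, contr_mul_self, zero_mul]
      rw [h0, zero_mul, mul_assoc, ← mul_assoc (onCoeff π), ← hmul, h0]
    · rw [mul_assoc, mul_assoc, ← mul_assoc (onCoeff π), ← hmul, hπ w hw, hmul, mul_assoc,
        mul_assoc, hcι π w]
  have key : kosz X * shear v j π =
      shear v j π * kosz (Function.update X j (X j + X v * π)) := by
    rw [shear, hD']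
    exact intertwine_of_relations hDw hDι hιD (hcι π j).symm (hcι (X v) j).symm (contr_mul_self j)
  exact LinearMap.congr_fun key φ

end Koszul

/-! ### Koszul ranks and graded Betti numbers -/

section KoszulRank

variable {k : Type*} [Field k] {V W : Type*} [AddCommGroup V] [Module k V] [AddCommGroup W]
  [Module k W] {n : ℕ}

/-- The elements of degree `i` of the exterior algebra, with coefficients in `M`. -/
def chains (n : ℕ) (M : Submodule k V) (i : ℕ) : Submodule k (Finset (Fin n) → V) :=
  Submodule.pi Set.univ fun S => if S.card = i then M else ⊥

theorem mem_chains {M : Submodule k V} {i : ℕ} {φ : Finset (Fin n) → V} :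
    φ ∈ chains n M i ↔ (∀ S, φ S ∈ M) ∧ ∀ S, S.card ≠ i → φ S = 0 := by
  rw [chains, Submodule.mem_pi]
  constructor
  · intro h
    have h0 : ∀ S, S.card ≠ i → φ S = 0 := fun S hS => by
      have := h S trivial
      rwa [if_neg hS, Submodule.mem_bot] at this
    refine ⟨fun S => ?_, h0⟩
    by_cases hS : S.card = i
    · have := h S trivial
      rwa [if_pos hS] at this
    · rw [h0 S hS]
      exact M.zero_mem
  · rintro ⟨h, h0⟩ S -
    split_ifs with hS
    · exact h S
    · exact h0 S hS

theorem chains_mono {M N : Submodule k V} (h : M ≤ N) (i : ℕ) : chains n M i ≤ chains n N i :=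
  fun _ hφ => mem_chains.2 ⟨fun S => h ((mem_chains.1 hφ).1 S), (mem_chains.1 hφ).2⟩

theorem map_onCoeff_chains (f : V →ₗ[k] W) (M : Submodule k V) (i : ℕ) :
    (chains n M i).map (onCoeff f) = chains n (M.map f) i := by
  ext ψ
  rw [Submodule.mem_map, mem_chains]
  constructor
  · rintro ⟨φ, hφ, rfl⟩
    rw [mem_chains] at hφ
    exact ⟨fun S => Submodule.mem_map_of_mem (hφ.1 S), fun S hS => by
      rw [onCoeff_apply, hφ.2 S hS, map_zero]⟩
  · rintro ⟨h1, h2⟩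
    choose φ hφ hφψ using fun S => Submodule.mem_map.1 (h1 S)
    refine ⟨fun S => if S.card = i then φ S else 0, mem_chains.2 ⟨fun S => ?_, fun S hS => ?_⟩, ?_⟩
    · split_ifs
      · exact hφ S
      · exact M.zero_mem
    · rw [if_neg hS]
    · funext S
      rw [onCoeff_apply]
      split_ifs with hS
      · exact hφψ S
      · rw [map_zero, h2 S hS]

/-- A chain of degree `i` is a family indexed by the subsets of size `i`. -/
noncomputable def chainsEquiv (M : Submodule k V) (i : ℕ) :
    chains n M i ≃ₗ[k] ({S : Finset (Fin n) // S.card = i} → M) where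
  toFun φ S := ⟨φ.1 S.1, (mem_chains.1 φ.2).1 S.1⟩
  map_add' _ _ := rfl
  map_smul' _ _ := rfl
  invFun ψ := ⟨fun S => if h : S.card = i then ψ ⟨S, h⟩ else 0, mem_chains.2
    ⟨fun S => by
      split_ifs
      · exact (ψ _).2
      · exact M.zero_mem, fun S hS => dif_neg hS⟩⟩
  left_inv φ := by
    refine Subtype.ext (funext fun S => ?_)
    dsimp only
    split_ifs with h
    · rfl
    · exact ((mem_chains.1 φ.2).2 S h).symm
  right_inv ψ := by
    refine funext fun S => Subtype.ext ?_
    dsimp only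
    rw [dif_pos S.2]

theorem finrank_chains (M : Submodule k V) [FiniteDimensional k M] (i : ℕ) :
    Module.finrank k (chains n M i) = n.choose i * Module.finrank k M := by
  rw [(chainsEquiv M i).finrank_eq, Module.finrank_pi_fintype, Finset.sum_const, Finset.card_univ,
    Fintype.card_finset_len, Fintype.card_fin, smul_eq_mul]

instance (M : Submodule k V) [FiniteDimensional k M] (i : ℕ) :
    FiniteDimensional k (chains n M i) :=
  (chainsEquiv M i).symm.finiteDimensional

theorem kosz_mem_chains {X : Fin n → Module.End k V} {M N : Submodule k V}
    (h : ∀ v, ∀ x ∈ M, X v x ∈ N) {i : ℕ} {φ : Finset (Fin n) → V} (hφ : φ ∈ chains n M (i + 1)) :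
    kosz X φ ∈ chains n N i := by
  rw [mem_chains] at hφ ⊢
  refine ⟨fun S => ?_, fun S hS => ?_⟩
  · rw [kosz_apply_apply]
    refine N.sum_mem fun w _ => ?_
    rw [Units.smul_def]
    exact zsmul_mem (h w _ (hφ.1 _)) _
  · rw [kosz_apply_apply]
    refine Finset.sum_eq_zero fun w hw => ?_
    rw [hφ.2, map_zero, smul_zero]
    rw [Finset.card_insert_of_notMem (Finset.mem_compl.1 hw)]
    omega

/-- The dimension of the image, under the Koszul differential of the operators `X`, of the chains
of degree `i` with coefficients in `M`. -/
noncomputable def kRank (X : Fin n → Module.End k V) (M : Submodule k V) (i : ℕ) : ℕ :=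
  Module.finrank k ((chains n M i).map (kosz X))

theorem kRank_mono (X : Fin n → Module.End k V) {M N : Submodule k V} [FiniteDimensional k N]
    (h : M ≤ N) (i : ℕ) : kRank X M i ≤ kRank X N i :=
  Submodule.finrank_mono (Submodule.map_mono (chains_mono h i))

theorem kRank_map {X : Fin n → Module.End k V} {Y : Fin n → Module.End k W} {f : V →ₗ[k] W}
    (hf : Function.Injective f) (h : ∀ w x, f (X w x) = Y w (f x)) (M : Submodule k V) (i : ℕ) :
    kRank Y (M.map f) i = kRank X M i := by
  have hc : kosz Y ∘ₗ onCoeff f = onCoeff f ∘ₗ kosz X := LinearMap.ext fun φ => kosz_onCoeff h φ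
  have hinj : Function.Injective (onCoeff (n := n) f) := fun φ ψ hφψ => by
    funext S
    exact hf (congrFun hφψ S)
  rw [kRank, kRank, ← map_onCoeff_chains, ← Submodule.map_comp, hc, Submodule.map_comp]
  exact (Submodule.equivMapOfInjective _ hinj _).finrank_eq.symm

theorem shear_mem_chains {v j : Fin n} {π : Module.End k V} {M : Submodule k V}
    (hM : ∀ x ∈ M, π x ∈ M) {i : ℕ} {φ : Finset (Fin n) → V} (hφ : φ ∈ chains n M i) :
    shear v j π φ ∈ chains n M i := by
  rw [mem_chains] at hφ
  have h : ∀ S, shear v j π φ S = φ S + wedge k V v (contr k V j (onCoeff π φ)) S := fun S => rfl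
  refine mem_chains.2 ⟨fun S => ?_, fun S hS => ?_⟩
  · rw [h]
    refine M.add_mem (hφ.1 S) ?_
    rw [wedge_apply]
    split_ifs
    · rw [contr_apply]
      split_ifs
      · rw [smul_zero]
        exact M.zero_mem
      · rw [Units.smul_def, Units.smul_def, onCoeff_apply]
        exact zsmul_mem (zsmul_mem (hM _ (hφ.1 _)) _) _
    · exact M.zero_mem
  · rw [h, hφ.2 S hS, zero_add, wedge_apply]
    split_ifs with hv
    · rw [contr_apply]
      split_ifs with hj
      · rw [smul_zero]
      · rw [onCoeff_apply, hφ.2, map_zero, smul_zero, smul_zero]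
        rwa [Finset.card_insert_of_notMem hj, Finset.card_erase_add_one hv]
    · rfl

theorem shear_shear_neg {v j : Fin n} (hvj : v ≠ j) (π : Module.End k V)
    (φ : Finset (Fin n) → V) : shear v j π (shear v j (-π) φ) = φ := by
  have h : ∀ (π : Module.End k V) φ, shear v j π φ =
      φ + wedge k V v (contr k V j (onCoeff π φ)) := fun π φ => rfl
  have hneg : ∀ φ : Finset (Fin n) → V, onCoeff (-π) φ = -onCoeff π φ := fun φ => rfl
  have h0 : ∀ φ : Finset (Fin n) → V, contr k V j (wedge k V v (contr k V j φ)) = 0 := by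
    intro φ
    have := LinearMap.congr_fun (contr_mul_wedge (k := k) (V := V) j v) (contr k V j φ)
    rw [if_neg hvj.symm] at this
    rw [Module.End.mul_apply] at this
    rw [this, zero_sub, LinearMap.neg_apply, Module.End.mul_apply,
      ← Module.End.mul_apply (contr k V j) (contr k V j), contr_mul_self, LinearMap.zero_apply,
      map_zero, neg_zero]
  rw [h, h (-π), hneg, map_neg, map_neg, map_add, map_add, map_add, map_neg, map_neg, map_neg,
    onCoeff_wedge, onCoeff_contr, h0]
  simp

theorem kRank_shear {X : Fin n → Module.End k V} {v j : Fin n} (hvj : v ≠ j)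
    {π : Module.End k V} (hπ : ∀ i, i ≠ j → π * X i = X i * π) {M : Submodule k V}
    (hM : ∀ x ∈ M, π x ∈ M) (i : ℕ) :
    kRank (Function.update X j (X j + X v * π)) M i = kRank X M i := by
  have hinj : Function.Injective (shear v j π) := by
    have h : Function.LeftInverse (shear v j (-π)) (shear v j π) := fun φ => by
      have := shear_shear_neg hvj (-π) φ
      rwa [neg_neg] at this
    exact h.injective
  have hmap : (chains n M i).map (shear v j π) = chains n M i := by
    refine le_antisymm (Submodule.map_le_iff_le_comap.2 fun φ hφ => shear_mem_chains hM hφ) ?_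
    intro φ hφ
    refine ⟨shear v j (-π) φ, shear_mem_chains (fun x hx => ?_) hφ, shear_shear_neg hvj π φ⟩
    exact M.neg_mem (hM x hx)
  have hc : kosz X ∘ₗ shear v j π =
      shear v j π ∘ₗ kosz (Function.update X j (X j + X v * π)) :=
    LinearMap.ext fun φ => kosz_shear hvj hπ φ
  have h : (chains n M i).map (kosz X) = ((chains n M i).map
      (kosz (Function.update X j (X j + X v * π)))).map (shear v j π) := by
    rw [← Submodule.map_comp, ← hc, Submodule.map_comp, hmap]
  rw [kRank, kRank, h]
  exact (Submodule.equivMapOfInjective _ hinj _).finrank_eq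

/-- Rescaling the operators by nonzero scalars amounts to rescaling the basis vectors of the exterior
algebra. -/
theorem kRank_smul (X : Fin n → Module.End k V) {a : Fin n → k} (ha : ∀ i, a i ≠ 0)
    (M : Submodule k V) (i : ℕ) : kRank (fun w => a w • X w) M i = kRank X M i := by
  let T : (Finset (Fin n) → V) →ₗ[k] (Finset (Fin n) → V) :=
    LinearMap.pi fun S => (∏ w ∈ S, a w) • LinearMap.proj S
  have hT : ∀ φ S, T φ S = (∏ w ∈ S, a w) • φ S := fun φ S => rfl
  have hne : ∀ S : Finset (Fin n), ∏ w ∈ S, a w ≠ 0 := fun S =>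
    Finset.prod_ne_zero_iff.2 fun w _ => ha w
  have hinj : Function.Injective T := fun φ ψ h => by
    funext S
    exact smul_right_injective V (hne S) (congrFun h S)
  have hmap : (chains n M i).map T = chains n M i := by
    ext φ
    rw [Submodule.mem_map]
    constructor
    · rintro ⟨φ, hφ, rfl⟩
      rw [mem_chains] at hφ ⊢
      exact ⟨fun S => M.smul_mem _ (hφ.1 S), fun S hS => by rw [hT, hφ.2 S hS, smul_zero]⟩
    · intro hφ
      rw [mem_chains] at hφ
      refine ⟨fun S => (∏ w ∈ S, a w)⁻¹ • φ S, mem_chains.2 ⟨fun S => M.smul_mem _ (hφ.1 S),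
        fun S hS => by rw [hφ.2 S hS, smul_zero]⟩, ?_⟩
      funext S
      rw [hT, smul_smul, mul_inv_cancel₀ (hne S), one_smul]
  have hc : kosz X ∘ₗ T = T ∘ₗ kosz (fun w => a w • X w) := by
    refine LinearMap.ext fun φ => ?_
    funext S
    rw [LinearMap.comp_apply, LinearMap.comp_apply, hT, kosz_apply_apply, kosz_apply_apply,
      Finset.smul_sum]
    refine Finset.sum_congr rfl fun w hw => ?_
    rw [hT, Finset.prod_insert (Finset.mem_compl.1 hw), map_smul, LinearMap.smul_apply,
      smul_comm _ (extSign S w), smul_smul, mul_comm]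
  have h : (chains n M i).map (kosz X) =
      ((chains n M i).map (kosz (fun w => a w • X w))).map T := by
    rw [← Submodule.map_comp, ← hc, Submodule.map_comp, hmap]
  rw [kRank, kRank, h]
  exact (Submodule.equivMapOfInjective _ hinj _).finrank_eq

end KoszulRank

section GradedBetti

variable {k : Type*} [Field k] {n : ℕ}

variable (k n) in
/-- The multiplications by the variables. -/
noncomputable def mulX (v : Fin n) : Module.End k (MvPolynomial (Fin n) k) :=
  LinearMap.mulLeft k (X v)

theorem mulX_apply (v : Fin n) (p : MvPolynomial (Fin n) k) : mulX k n v p = X v * p := rfl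

theorem kosz_mulX : kosz (mulX k n) = koszulD k n := by
  refine LinearMap.ext fun φ => ?_
  funext S
  rw [kosz_apply_apply, koszulD, LinearMap.pi_apply, LinearMap.sum_apply]
  refine Finset.sum_congr rfl fun w _ => ?_
  rw [LinearMap.comp_apply, LinearMap.mulLeft_apply, LinearMap.proj_apply, mulX_apply, extSign]
  rcases neg_one_pow_eq_or ℤˣ (S.filter (· < w)).card with h | h <;>
  rcases Nat.even_or_odd (S.filter (· < w)).card with h' | h' <;>
  simp [h', Units.smul_def]

/-- The rank of the differential of `K(x₁, …, xₙ) ⊗ I`, from homological degree `i` and internal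
degree `t + i`, where `U = I_t`. -/
noncomputable abbrev polyRank (U : Submodule k (MvPolynomial (Fin n) k)) (i : ℕ) : ℕ :=
  kRank (mulX k n) U i

theorem koszulChains_eq (I : Ideal (MvPolynomial (Fin n) k)) {i j : ℕ} (h : i ≤ j) :
    koszulChains I i j = chains n (gradedPart I (j - i)) i := by
  rw [koszulChains, chains]
  congr 1
  funext S
  simp only [h, and_true]
  rfl

theorem koszulChains_eq_bot (I : Ideal (MvPolynomial (Fin n) k)) {i j : ℕ} (h : j < i) :
    koszulChains I i j = ⊥ := by
  rw [koszulChains]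
  simp [h.not_ge]

theorem gradedBetti_eq_zero (I : Ideal (MvPolynomial (Fin n) k)) {i j : ℕ} (h : j < i) :
    gradedBetti I i j = 0 := by
  have h0 : koszulCycles I i j = ⊥ := by
    rw [koszulCycles, koszulChains_eq_bot I h, bot_inf_eq]
  have : Subsingleton (koszulCycles I i j) := by
    rw [h0]
    infer_instance
  rw [gradedBetti]
  exact Module.finrank_zero_of_subsingleton

theorem gradedBetti_add_finrank (I : Ideal (MvPolynomial (Fin n) k)) (i j : ℕ) (h : i ≤ j) :
    gradedBetti I i j + Module.finrank k (koszulBoundaries I i j) + polyRank (gradedPart I (j - i)) i =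
      n.choose i * hilb I (j - i) := by
  have hch := koszulChains_eq I h
  have : FiniteDimensional k (koszulChains I i j) := by
    rw [hch]
    infer_instance
  have hle : koszulBoundaries I i j ≤ koszulCycles I i j := by
    rcases h.lt_or_eq with h' | rfl
    · rw [koszulBoundaries, koszulChains_eq I h', koszulCycles, hch, Submodule.map_le_iff_le_comap,
        ← kosz_mulX]
      refine fun φ hφ => ⟨kosz_mem_chains (fun v x hx => ?_) hφ, ?_⟩
      · have := (isGradedFamily_gradedPart I).X_mul (j - (i + 1)) v x hx
        rwa [show j - (i + 1) + 1 = j - i by omega] at this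
      · rw [kosz_mulX]
        exact LinearMap.mem_ker.2 (koszulD_koszulD φ)
    · rw [koszulBoundaries, koszulChains_eq_bot I (Nat.lt_succ_self i), Submodule.map_bot]
      exact bot_le
  have h1 := finrank_map_add_finrank_inf_ker (koszulD k n) (koszulChains I i j)
  have : FiniteDimensional k (koszulCycles I i j) :=
    Submodule.finiteDimensional_of_le (inf_le_left : _ ≤ koszulChains I i j)
  have h2 := Submodule.finrank_quotient_add_finrank
    ((koszulBoundaries I i j).submoduleOf (koszulCycles I i j))
  rw [(Submodule.submoduleOfEquivOfLe hle).finrank_eq] at h2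
  rw [gradedBetti, polyRank, kRank, kosz_mulX, ← hch, h2, hilb, ← finrank_chains, ← hch, ← h1,
    add_comm]
  rfl

/-- The graded Betti numbers are determined by the Hilbert function and by two Koszul ranks. -/
theorem gradedBetti_add (I : Ideal (MvPolynomial (Fin n) k)) (i t : ℕ) :
    gradedBetti I i (t + 1 + i) + polyRank (gradedPart I t) (i + 1) +
      polyRank (gradedPart I (t + 1)) i = n.choose i * hilb I (t + 1) := by
  have h := gradedBetti_add_finrank I i (t + 1 + i) (by omega)
  rw [koszulBoundaries, koszulChains_eq I (by omega), ← kosz_mulX, Nat.add_sub_cancel,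
    show t + 1 + i - (i + 1) = t by omega] at h
  exact h

theorem gradedBetti_zero_add (I : Ideal (MvPolynomial (Fin n) k)) (i : ℕ) :
    gradedBetti I i i + polyRank (gradedPart I 0) i = n.choose i * hilb I 0 := by
  have h := gradedBetti_add_finrank I i i le_rfl
  rw [koszulBoundaries, koszulChains_eq_bot I (by omega), Submodule.map_bot, Nat.sub_self,
    finrank_bot, add_zero] at h
  exact h

end GradedBetti

/-! ### Sequences of coefficients -/

section Sequences

variable {k : Type*} [Field k] {V W : Type*} [AddCommGroup V] [Module k V] [AddCommGroup W]
  [Module k W] {n m : ℕ}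

theorem kRank_map_of_injOn {X : Fin n → Module.End k V} {Y : Fin n → Module.End k W}
    {f : V →ₗ[k] W} (h : ∀ w x, f (X w x) = Y w (f x)) {M N : Submodule k V} [FiniteDimensional k M]
    (hN : ∀ x ∈ N, f x = 0 → x = 0) (hMN : ∀ w, ∀ x ∈ M, X w x ∈ N) (i : ℕ) :
    kRank Y (M.map f) i = kRank X M i := by
  have hc : kosz Y ∘ₗ onCoeff f = onCoeff f ∘ₗ kosz X := LinearMap.ext fun φ => kosz_onCoeff h φ
  rw [kRank, kRank, ← map_onCoeff_chains, ← Submodule.map_comp, hc, Submodule.map_comp,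
    ← finrank_map_add_finrank_inf_ker (onCoeff f) ((chains n M i).map (kosz X))]
  have : (chains n M i).map (kosz X) ⊓ LinearMap.ker (onCoeff f) = ⊥ := by
    rw [eq_bot_iff]
    rintro _ ⟨⟨φ, hφ, rfl⟩, h0⟩
    rw [Submodule.mem_bot]
    funext S
    refine hN _ ?_ (congrFun h0 S)
    rw [kosz_apply_apply]
    refine N.sum_mem fun w _ => ?_
    rw [Units.smul_def]
    exact zsmul_mem (hMN w _ ((mem_chains.1 hφ).1 _)) _
  rw [this, finrank_bot, add_zero]

instance {ι : Type*} [LT ι] (coef : ι → V →ₗ[k] W) (U : Submodule k V) [FiniteDimensional k U]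
    (i : ι) : FiniteDimensional k (lead coef U i) := by
  rw [lead]
  infer_instance

variable (k V) in
/-- The shift of sequences, which is the multiplication by the last variable on the sequences of
coefficients with respect to this variable. -/
def shiftOp : Module.End k (ℕ → V) where
  toFun q l := if l = 0 then 0 else q (l - 1)
  map_add' q r := by
    funext l
    simp only [Pi.add_apply]
    split_ifs
    · rw [add_zero]
    · rfl
  map_smul' a q := by
    funext l
    simp only [Pi.smul_apply, RingHom.id_apply]
    split_ifs
    · rw [smul_zero]
    · rfl

theorem shiftOp_apply (q : ℕ → V) (l : ℕ) :
    shiftOp k V q l = if l = 0 then 0 else q (l - 1) := rfl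

theorem shiftOp_zero (q : ℕ → V) : shiftOp k V q 0 = 0 := rfl

theorem shiftOp_succ (q : ℕ → V) (l : ℕ) : shiftOp k V q (l + 1) = q l := rfl

theorem shiftOp_injective : Function.Injective (shiftOp k V) := fun q r h => by
  funext l
  exact congrFun h (l + 1)

/-- The operators on sequences that correspond to the multiplications by the variables. -/
def seqOp (X : Fin m → Module.End k V) : Fin (m + 1) → Module.End k (ℕ → V) :=
  Fin.lastCases (motive := fun _ => Module.End k (ℕ → V)) (shiftOp k V)
    fun v => (X v).compLeft ℕ

theorem seqOp_last (X : Fin m → Module.End k V) : seqOp X (Fin.last m) = shiftOp k V := by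
  rw [seqOp, Fin.lastCases_last]

theorem seqOp_castSucc (X : Fin m → Module.End k V) (v : Fin m) (q : ℕ → V) (l : ℕ) :
    seqOp X v.castSucc q l = X v (q l) := by
  rw [seqOp, Fin.lastCases_castSucc]
  rfl

/-- The sequences with `l`-th term in `J l`. -/
def seqs (J : ℕ → Submodule k V) : Submodule k (ℕ → V) := Submodule.pi Set.univ J

theorem mem_seqs {J : ℕ → Submodule k V} {q : ℕ → V} : q ∈ seqs J ↔ ∀ l, q l ∈ J l := by
  simp [seqs]

theorem single_mem_seqs {J : ℕ → Submodule k V} {l : ℕ} {x : V} (hx : x ∈ J l) :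
    Pi.single l x ∈ seqs J := by
  refine mem_seqs.2 fun l' => ?_
  by_cases h : l' = l
  · subst h
    rwa [Pi.single_eq_same]
  · rw [Pi.single_eq_of_ne h]
    exact Submodule.zero_mem _

/-- The finitely many terms that determine a sequence. -/
def seqsEquiv {J : ℕ → Submodule k V} {t : ℕ} (h : ∀ l, t < l → J l = ⊥) :
    seqs J ≃ₗ[k] ((l : Fin (t + 1)) → J l) where
  toFun q l := ⟨q.1 l, mem_seqs.1 q.2 l⟩
  map_add' _ _ := rfl
  map_smul' _ _ := rfl
  invFun r := ⟨fun l => if hl : l < t + 1 then r ⟨l, hl⟩ else 0, mem_seqs.2 fun l => by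
    split_ifs with hl
    · exact (r ⟨l, hl⟩).2
    · exact Submodule.zero_mem _⟩
  left_inv q := by
    refine Subtype.ext (funext fun l => ?_)
    dsimp only
    split_ifs with hl
    · rfl
    · have := mem_seqs.1 q.2 l
      rw [h l (by omega), Submodule.mem_bot] at this
      exact this.symm
  right_inv r := by
    refine funext fun l => Subtype.ext ?_
    dsimp only
    rw [dif_pos l.2]

theorem finrank_seqs {J : ℕ → Submodule k V} [∀ l, FiniteDimensional k (J l)] {t : ℕ}
    (h : ∀ l, t < l → J l = ⊥) :
    Module.finrank k (seqs J) = ∑ l ∈ Finset.range (t + 1), Module.finrank k (J l) := by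
  rw [(seqsEquiv h).finrank_eq, Module.finrank_pi_fintype,
    Fin.sum_univ_eq_sum_range (fun l => Module.finrank k (J l))]

theorem finiteDimensional_seqs {J : ℕ → Submodule k V} [∀ l, FiniteDimensional k (J l)] {t : ℕ}
    (h : ∀ l, t < l → J l = ⊥) : FiniteDimensional k (seqs J) :=
  (seqsEquiv h).symm.finiteDimensional

/-- The part of weight `w` of an element of the exterior algebra with coefficients in the
sequences, where the last basis vector and the shift both have weight one. -/
noncomputable def weightPart (k V : Type*) [Field k] [AddCommGroup V] [Module k V] (m w : ℕ) :
    (Finset (Fin (m + 1)) → ℕ → V) →ₗ[k] (Finset (Fin (m + 1)) → V) :=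
  LinearMap.pi fun S => if Fin.last m ∈ S then LinearMap.proj w ∘ₗ shiftOp k V ∘ₗ LinearMap.proj S
    else LinearMap.proj w ∘ₗ LinearMap.proj S

theorem weightPart_of_mem {S : Finset (Fin (m + 1))} (hS : Fin.last m ∈ S) (w : ℕ)
    (φ : Finset (Fin (m + 1)) → ℕ → V) :
    weightPart k V m w φ S = if w = 0 then 0 else φ S (w - 1) := by
  rw [weightPart, LinearMap.pi_apply, if_pos hS]
  rfl

theorem weightPart_of_notMem {S : Finset (Fin (m + 1))} (hS : Fin.last m ∉ S) (w : ℕ)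
    (φ : Finset (Fin (m + 1)) → ℕ → V) :
    weightPart k V m w φ S = φ S w := by
  rw [weightPart, LinearMap.pi_apply, if_neg hS]
  rfl

/-- The Koszul differential preserves the weight. -/
theorem weightPart_kosz (X : Fin m → Module.End k V) (w : ℕ)
    (φ : Finset (Fin (m + 1)) → ℕ → V) :
    weightPart k V m w (kosz (seqOp X) φ) =
      kosz (Fin.lastCases (motive := fun _ => Module.End k V) 1 X) (weightPart k V m w φ) := by
  funext S
  rw [kosz_apply_apply]
  by_cases hS : Fin.last m ∈ S
  · rw [weightPart_of_mem hS, kosz_apply_apply]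
    by_cases hw : w = 0
    · rw [if_pos hw]
      refine (Finset.sum_eq_zero fun v _ => ?_).symm
      rw [weightPart_of_mem (Finset.mem_insert_of_mem hS), if_pos hw, map_zero, smul_zero]
    · rw [if_neg hw, Finset.sum_apply]
      refine Finset.sum_congr rfl fun v hv => ?_
      rw [weightPart_of_mem (Finset.mem_insert_of_mem hS), if_neg hw]
      cases v using Fin.lastCases with
      | last => exact absurd hS (Finset.mem_compl.1 hv)
      | cast v =>
        rw [Fin.lastCases_castSucc, Units.smul_def, Units.smul_def, Pi.smul_apply, seqOp_castSucc]
  · rw [weightPart_of_notMem hS, kosz_apply_apply, Finset.sum_apply]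
    refine Finset.sum_congr rfl fun v hv => ?_
    rw [Units.smul_def, Units.smul_def, Pi.smul_apply]
    cases v using Fin.lastCases with
    | last =>
      rw [weightPart_of_mem (Finset.mem_insert_self _ _), seqOp_last, Fin.lastCases_last]
      rfl
    | cast v =>
      rw [weightPart_of_notMem, Fin.lastCases_castSucc, seqOp_castSucc]
      rw [Finset.mem_insert, not_or]
      exact ⟨(Fin.castSucc_lt_last v).ne', hS⟩

/-- The sequences of leading coefficients of a space of sequences have at most the same Koszul
ranks: they form an initial degeneration of the given space. -/
theorem kRank_seqs_lead_le (X : Fin m → Module.End k V) (U : Submodule k (ℕ → V))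
    [FiniteDimensional k U] {t : ℕ} (ht : ∀ q ∈ U, ∀ l, t < l → q l = 0) (i : ℕ) :
    kRank (seqOp X) (seqs (lead LinearMap.proj U)) i ≤ kRank (seqOp X) U i := by
  set J : ℕ → Submodule k V := lead LinearMap.proj U with hJ
  have hJt : ∀ l, t < l → J l = ⊥ := by
    intro l hl
    rw [eq_bot_iff]
    intro a ha
    obtain ⟨q, hq, -, rfl⟩ := mem_lead.1 ha
    exact ht q hq l hl
  have : FiniteDimensional k (seqs J) := finiteDimensional_seqs hJt
  have hbound : ∀ M : Submodule k (ℕ → V), (∀ q ∈ M, ∀ l, t < l → q l = 0) →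
      ∀ ψ ∈ (chains (m + 1) M i).map (kosz (seqOp X)), ∀ w ∉ Finset.range (t + 3),
        weightPart k V m w ψ = 0 := by
    rintro M hM _ ⟨φ, hφ, rfl⟩ w hw
    rw [Finset.mem_range, not_lt] at hw
    have h0 : weightPart k V m w φ = 0 := by
      funext S
      by_cases hS : Fin.last m ∈ S
      · rw [weightPart_of_mem hS, if_neg (by omega)]
        exact hM _ ((mem_chains.1 hφ).1 S) _ (by omega)
      · rw [weightPart_of_notMem hS]
        exact hM _ ((mem_chains.1 hφ).1 S) _ (by omega)
    rw [weightPart_kosz, h0, map_zero]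
  have hzero : ∀ ψ : Finset (Fin (m + 1)) → ℕ → V, (∀ w, weightPart k V m w ψ = 0) → ψ = 0 := by
    intro ψ hψ
    funext S l
    by_cases hS : Fin.last m ∈ S
    · have := congrFun (hψ (l + 1)) S
      rwa [weightPart_of_mem hS, if_neg (by omega)] at this
    · have := congrFun (hψ l) S
      rwa [weightPart_of_notMem hS] at this
  -- the boundaries are compared through their leading parts, weight by weight
  rw [kRank, kRank,
    finrank_eq_sum_lead (weightPart k V m) _ (Finset.range (t + 3))
      (hbound (seqs J) fun q hq l hl => by
        have := mem_seqs.1 hq l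
        rwa [hJt l hl, Submodule.mem_bot] at this) fun ψ _ => hzero ψ,
    finrank_eq_sum_lead (weightPart k V m) _ (Finset.range (t + 3)) (hbound U ht)
      fun ψ _ => hzero ψ]
  refine Finset.sum_le_sum fun w _ => Submodule.finrank_mono fun a ha => ?_
  obtain ⟨_, ⟨φ, hφ, rfl⟩, -, rfl⟩ := mem_lead.1 ha
  replace hφ := mem_chains.1 hφ
  have hl : ∀ l S, ∃ q ∈ U, (∀ l' < l, q l' = 0) ∧ q l = φ S l := fun l S =>
    mem_lead.1 (mem_seqs.1 (hφ.1 S) l)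
  choose q hqU hql hq using hl
  -- the chain of weight at least `w` whose part of weight `w` is that of `φ`
  set ψ : Finset (Fin (m + 1)) → ℕ → V := fun S => if S.card = i then
    if Fin.last m ∈ S then if w = 0 then 0 else q (w - 1) S else q w S else 0 with hψ
  have hψU : ψ ∈ chains (m + 1) U i := by
    refine mem_chains.2 ⟨fun S => ?_, fun S hS => if_neg hS⟩
    rw [hψ]
    dsimp only
    split_ifs
    · exact U.zero_mem
    · exact hqU _ _
    · exact hqU _ _
    · exact U.zero_mem
  have hlow : ∀ w' < w, weightPart k V m w' ψ = 0 := by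
    intro w' hw'
    funext S
    by_cases hc : S.card = i
    · by_cases hS : Fin.last m ∈ S
      · rw [weightPart_of_mem hS]
        split_ifs
        · rfl
        · simp only [hψ, if_pos hc, if_pos hS, if_neg (show w ≠ 0 by omega)]
          exact hql _ _ _ (by omega)
      · rw [weightPart_of_notMem hS]
        simp only [hψ, if_pos hc, if_neg hS]
        exact hql _ _ _ hw'
    · by_cases hS : Fin.last m ∈ S
      · rw [weightPart_of_mem hS]
        simp [hψ, if_neg hc]
      · rw [weightPart_of_notMem hS]
        simp [hψ, if_neg hc]
  have heq : weightPart k V m w ψ = weightPart k V m w φ := by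
    funext S
    by_cases hc : S.card = i
    · by_cases hS : Fin.last m ∈ S
      · rw [weightPart_of_mem hS, weightPart_of_mem hS]
        by_cases hw : w = 0
        · rw [if_pos hw, if_pos hw]
        · simp only [hψ, if_pos hc, if_pos hS, if_neg hw, hq]
      · rw [weightPart_of_notMem hS, weightPart_of_notMem hS]
        simp only [hψ, if_pos hc, if_neg hS, hq]
    · by_cases hS : Fin.last m ∈ S
      · rw [weightPart_of_mem hS, weightPart_of_mem hS]
        simp [hψ, if_neg hc, hφ.2 S hc]
      · rw [weightPart_of_notMem hS, weightPart_of_notMem hS]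
        simp [hψ, if_neg hc, hφ.2 S hc]
  refine mem_lead.2 ⟨_, Submodule.mem_map_of_mem hψU, fun w' hw' => ?_, ?_⟩
  · rw [weightPart_kosz, hlow w' hw', map_zero]
  · rw [weightPart_kosz, heq, weightPart_kosz]

end Sequences

/-! ### Koszul ranks and the hyperplane section by the last variable -/

section Hyperplane

variable {k : Type*} [Field k] {V W : Type*} [AddCommGroup V] [Module k V] [AddCommGroup W]
  [Module k W] {n m : ℕ}

variable (k V m) in
/-- The components, of an element of the exterior algebra, without the last basis vector. -/
def withoutLast : (Finset (Fin (m + 1)) → V) →ₗ[k] (Finset (Fin m) → V) :=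
  LinearMap.funLeft k V fun S => S.map Fin.castSuccEmb

variable (k V m) in
/-- The components, of an element of the exterior algebra, with the last basis vector. -/
def withLast : (Finset (Fin (m + 1)) → V) →ₗ[k] (Finset (Fin m) → V) :=
  LinearMap.funLeft k V fun S => insert (Fin.last m) (S.map Fin.castSuccEmb)

theorem withoutLast_apply (φ : Finset (Fin (m + 1)) → V) (S : Finset (Fin m)) :
    withoutLast k V m φ S = φ (S.map Fin.castSuccEmb) := rfl

theorem withLast_apply (φ : Finset (Fin (m + 1)) → V) (S : Finset (Fin m)) :
    withLast k V m φ S = φ (insert (Fin.last m) (S.map Fin.castSuccEmb)) := rfl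

theorem last_notMem_map (S : Finset (Fin m)) : Fin.last m ∉ S.map Fin.castSuccEmb := by
  rw [Finset.mem_map]
  rintro ⟨v, -, hv⟩
  exact (Fin.castSucc_lt_last v).ne hv

/-- The element of the exterior algebra with the given components without and with the last basis
vector. -/
noncomputable def joinLast (φ₀ φ₁ : Finset (Fin m) → V) : Finset (Fin (m + 1)) → V := fun S =>
  if Fin.last m ∈ S then φ₁ (S.preimage Fin.castSucc (Fin.castSucc_injective m).injOn)
    else φ₀ (S.preimage Fin.castSucc (Fin.castSucc_injective m).injOn)

theorem withoutLast_joinLast (φ₀ φ₁ : Finset (Fin m) → V) :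
    withoutLast k V m (joinLast φ₀ φ₁) = φ₀ := by
  funext S
  rw [withoutLast_apply, joinLast, if_neg (last_notMem_map S)]
  congr 1
  ext v
  simp

theorem withLast_joinLast (φ₀ φ₁ : Finset (Fin m) → V) :
    withLast k V m (joinLast φ₀ φ₁) = φ₁ := by
  funext S
  rw [withLast_apply, joinLast, if_pos (Finset.mem_insert_self _ _)]
  congr 1
  ext v
  simp [(Fin.castSucc_lt_last v).ne]

theorem exists_map_castSucc (S : Finset (Fin (m + 1))) :
    ∃ T : Finset (Fin m), S = T.map Fin.castSuccEmb ∨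
      S = insert (Fin.last m) (T.map Fin.castSuccEmb) := by
  refine ⟨S.preimage Fin.castSucc (Fin.castSucc_injective m).injOn, ?_⟩
  by_cases h : Fin.last m ∈ S
  · right
    ext v
    cases v using Fin.lastCases with
    | last => simp [h]
    | cast v => simp [(Fin.castSucc_lt_last v).ne]
  · left
    ext v
    cases v using Fin.lastCases with
    | last => simp [h]
    | cast v => simp

theorem eq_zero_of_withLast {φ : Finset (Fin (m + 1)) → V} (h0 : withoutLast k V m φ = 0)
    (h1 : withLast k V m φ = 0) : φ = 0 := by
  funext S
  obtain ⟨T, rfl | rfl⟩ := exists_map_castSucc S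
  · exact congrFun h0 T
  · exact congrFun h1 T

theorem joinLast_mem_chains {M : Submodule k V} {i : ℕ} {φ₀ φ₁ : Finset (Fin m) → V}
    (h0 : φ₀ ∈ chains m M (i + 1)) (h1 : φ₁ ∈ chains m M i) :
    joinLast φ₀ φ₁ ∈ chains (m + 1) M (i + 1) := by
  rw [mem_chains] at *
  have e0 := congrFun (withoutLast_joinLast (k := k) φ₀ φ₁)
  have e1 := congrFun (withLast_joinLast (k := k) φ₀ φ₁)
  refine ⟨fun S => ?_, fun S hS => ?_⟩ <;> obtain ⟨T, rfl | rfl⟩ := exists_map_castSucc S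
  · exact Set.mem_of_eq_of_mem (e0 T) (h0.1 T)
  · exact Set.mem_of_eq_of_mem (e1 T) (h1.1 T)
  · rw [Finset.card_map] at hS
    exact (e0 T).trans (h0.2 T hS)
  · rw [Finset.card_insert_of_notMem (last_notMem_map T), Finset.card_map] at hS
    exact (e1 T).trans (h1.2 T (by omega))

theorem withoutLast_mem_chains {M : Submodule k V} {i : ℕ} {φ : Finset (Fin (m + 1)) → V}
    (h : φ ∈ chains (m + 1) M i) : withoutLast k V m φ ∈ chains m M i := by
  rw [mem_chains] at *
  refine ⟨fun S => h.1 _, fun S hS => h.2 _ ?_⟩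
  rwa [Finset.card_map]

theorem withLast_mem_chains {M : Submodule k V} {i : ℕ} {φ : Finset (Fin (m + 1)) → V}
    (h : φ ∈ chains (m + 1) M (i + 1)) : withLast k V m φ ∈ chains m M i := by
  rw [mem_chains] at *
  refine ⟨fun S => h.1 _, fun S hS => h.2 _ ?_⟩
  rw [Finset.card_insert_of_notMem (last_notMem_map S), Finset.card_map]
  omega

theorem extSign_map (S : Finset (Fin m)) (v : Fin m) :
    extSign (S.map Fin.castSuccEmb) v.castSucc = extSign S v := by
  rw [extSign, extSign, Finset.filter_map, Finset.card_map]
  rfl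

theorem extSign_map_last (S : Finset (Fin m)) :
    extSign (S.map Fin.castSuccEmb) (Fin.last m) = (-1) ^ S.card := by
  rw [extSign, Finset.filter_true_of_mem, Finset.card_map]
  intro v hv
  obtain ⟨v, -, rfl⟩ := Finset.mem_map.1 hv
  exact Fin.castSucc_lt_last v

theorem withLast_kosz (Y : Fin (m + 1) → Module.End k V) (φ : Finset (Fin (m + 1)) → V) :
    withLast k V m (kosz Y φ) = kosz (fun v => Y v.castSucc) (withLast k V m φ) := by
  funext S
  have hS : (insert (Fin.last m) (S.map Fin.castSuccEmb))ᶜ = Sᶜ.map Fin.castSuccEmb := by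
    ext v
    cases v using Fin.lastCases with
    | last => simp
    | cast v => simp [(Fin.castSucc_lt_last v).ne]
  rw [withLast_apply, kosz_apply_apply, kosz_apply_apply, hS, Finset.sum_map]
  refine Finset.sum_congr rfl fun v _ => ?_
  rw [withLast_apply, Finset.map_insert, Finset.insert_comm, Fin.coe_castSuccEmb,
    extSign_insert_of_gt (Fin.le_last _), extSign_map]

theorem withoutLast_kosz (Y : Fin (m + 1) → Module.End k V) {M : Submodule k V} {i : ℕ}
    {φ : Finset (Fin (m + 1)) → V} (hφ : φ ∈ chains (m + 1) M (i + 1)) :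
    withoutLast k V m (kosz Y φ) = kosz (fun v => Y v.castSucc) (withoutLast k V m φ) +
      (-1 : ℤˣ) ^ i • onCoeff (Y (Fin.last m)) (withLast k V m φ) := by
  funext S
  have hS : (S.map Fin.castSuccEmb)ᶜ = insert (Fin.last m) (Sᶜ.map Fin.castSuccEmb) := by
    ext v
    cases v using Fin.lastCases with
    | last => simp
    | cast v => simp [(Fin.castSucc_lt_last v).ne]
  rw [withoutLast_apply, kosz_apply_apply, hS, Finset.sum_insert (last_notMem_map _), Pi.add_apply,
    kosz_apply_apply, Finset.sum_map, add_comm]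
  congr 1
  · refine Finset.sum_congr rfl fun v _ => ?_
    rw [withoutLast_apply, Finset.map_insert, Fin.coe_castSuccEmb, extSign_map]
  · rw [extSign_map_last, Pi.smul_apply, onCoeff_apply, withLast_apply]
    by_cases hc : S.card = i
    · rw [hc]
    · rw [(mem_chains.1 hφ).2, map_zero, smul_zero, smul_zero]
      rw [Finset.card_insert_of_notMem (last_notMem_map S), Finset.card_map]
      omega

theorem neg_one_pow_smul_mem (U : Submodule k V) (i : ℕ) {x : V} (hx : x ∈ U) :
    (-1 : ℤˣ) ^ i • x ∈ U := by
  rw [Units.smul_def]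
  exact zsmul_mem hx _

theorem neg_one_pow_smul_smul (i : ℕ) (x : V) : (-1 : ℤˣ) ^ i • (-1 : ℤˣ) ^ i • x = x := by
  rw [smul_smul, Int.units_mul_self, one_smul]

variable (k V) in
/-- The zeroth term of a sequence. -/
def headMap : (ℕ → V) →ₗ[k] V := LinearMap.proj (φ := fun _ => V) 0

theorem headMap_apply (q : ℕ → V) : headMap k V q = q 0 := rfl

theorem seqOp_castSucc_proj (X : Fin m → Module.End k V) (φ : Finset (Fin m) → ℕ → V) :
    onCoeff (headMap k V) (kosz (fun v => seqOp X v.castSucc) φ) =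
      kosz X (onCoeff (headMap k V) φ) :=
  (kosz_onCoeff (fun v x => seqOp_castSucc X v x 0) φ).symm

theorem onCoeff_shiftOp_injective :
    Function.Injective (onCoeff (k := k) (n := m) (shiftOp k V)) :=
  fun φ ψ h => by
    funext S
    exact shiftOp_injective (k := k) (congrFun h S)

/-- A lower bound for the Koszul ranks of a space of sequences, by the boundaries of the chains that
involve the last basis vector and by the zeroth terms of the others. -/
theorem kRank_seqOp_ge (X : Fin m → Module.End k V) (M : Submodule k (ℕ → V))
    [FiniteDimensional k M] (i : ℕ) :
    m.choose i * Module.finrank k M + kRank X (M.map (headMap k V)) (i + 1) ≤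
      kRank (seqOp X) M (i + 1) := by
  set P := ((chains (m + 1) M (i + 1)).map (kosz (seqOp X))).map (withoutLast k (ℕ → V) m) with hP
  have h1 : Module.finrank k P ≤ kRank (seqOp X) M (i + 1) := Submodule.finrank_map_le _ _
  refine le_trans ?_ h1
  rw [← finrank_map_add_finrank_inf_ker (onCoeff (headMap k V)) P, add_comm]
  refine add_le_add (Submodule.finrank_mono ?_) ?_
  · rw [← map_onCoeff_chains]
    rintro _ ⟨_, ⟨φ, hφ, rfl⟩, rfl⟩
    have hj := joinLast_mem_chains hφ (chains m M i).zero_mem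
    refine ⟨_, ⟨_, ⟨_, hj, rfl⟩, rfl⟩, ?_⟩
    rw [withoutLast_kosz _ hj, withoutLast_joinLast, withLast_joinLast, map_zero, smul_zero,
      add_zero, seqOp_castSucc_proj]
  · rw [← finrank_chains, (Submodule.equivMapOfInjective _ onCoeff_shiftOp_injective (chains m M i)).finrank_eq]
    have : FiniteDimensional k (P ⊓ LinearMap.ker (onCoeff (headMap k V)) :
      Submodule k _) := Submodule.finiteDimensional_inf_left _ _
    refine Submodule.finrank_mono ?_
    rintro _ ⟨φ, hφ, rfl⟩
    have hj := joinLast_mem_chains (chains m M (i + 1)).zero_mem (neg_one_pow_smul_mem _ i hφ)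
    refine ⟨⟨_, ⟨_, hj, rfl⟩, ?_⟩, ?_⟩
    · rw [withoutLast_kosz _ hj, withoutLast_joinLast, withLast_joinLast, map_zero, zero_add,
        seqOp_last, Units.smul_def, Units.smul_def, map_zsmul, ← Units.smul_def, ← Units.smul_def,
        neg_one_pow_smul_smul]
    · rw [SetLike.mem_coe, LinearMap.mem_ker]
      rfl

/-- If the operators `X`, combined with the backward shift, preserve `M`, then the Koszul rank of
`M` is determined by the dimension of `M` and by the zeroth terms. -/
theorem kRank_seqOp_le {X : Fin m → Module.End k V} (hX : ∀ v w, X v * X w = X w * X v)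
    (M : Submodule k (ℕ → V)) [FiniteDimensional k M]
    (hM : ∀ q ∈ M, ∀ v, (fun l => X v (q (l + 1))) ∈ M) (i : ℕ) :
    kRank (seqOp X) M (i + 1) ≤
      m.choose i * Module.finrank k M + kRank X (M.map (headMap k V)) (i + 1) := by
  set N := (chains (m + 1) M (i + 1)).map (kosz (seqOp X)) with hN
  set P := N.map (withoutLast k (ℕ → V) m) with hP
  -- a boundary is determined by its part without the last basis vector
  have h1 : kRank (seqOp X) M (i + 1) = Module.finrank k P := by
    rw [kRank, ← hN, ← finrank_map_add_finrank_inf_ker (withoutLast k (ℕ → V) m) N]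
    have : N ⊓ LinearMap.ker (withoutLast k (ℕ → V) m) = ⊥ := by
      rw [eq_bot_iff]
      rintro _ ⟨⟨φ, hφ, rfl⟩, h0⟩
      rw [Submodule.mem_bot]
      have h0 : withoutLast k (ℕ → V) m (kosz (seqOp X) φ) = 0 := h0
      refine eq_zero_of_withLast h0 ?_
      rw [withLast_kosz]
      rw [withoutLast_kosz _ hφ] at h0
      have h2 := congrArg (kosz fun v => seqOp X v.castSucc) h0
      rw [map_add, kosz_kosz, zero_add, map_zero, Units.smul_def, map_zsmul, ← Units.smul_def,
        seqOp_last] at h2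
      · have h3 : kosz (fun v => seqOp X v.castSucc)
            (onCoeff (shiftOp k V) (withLast k (ℕ → V) m φ)) = 0 := by
          rw [← neg_one_pow_smul_smul i (kosz _ _), h2, smul_zero]
        rw [kosz_onCoeff (X := fun v => seqOp X v.castSucc)] at h3
        · exact onCoeff_shiftOp_injective (h3.trans (map_zero _).symm)
        · intro v q
          funext l
          rw [seqOp_castSucc, shiftOp_apply, shiftOp_apply]
          split_ifs
          · rw [map_zero]
          · rw [seqOp_castSucc]
      · intro v w
        refine LinearMap.ext fun q => ?_
        funext l
        simp only [Module.End.mul_apply, seqOp_castSucc]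
        exact LinearMap.congr_fun (hX v w) (q l)
    rw [this, finrank_bot, add_zero]
  rw [h1, ← finrank_map_add_finrank_inf_ker (onCoeff (headMap k V)) P,
    add_comm]
  refine add_le_add ?_ (Submodule.finrank_mono ?_)
  · rw [← finrank_chains, (Submodule.equivMapOfInjective _ onCoeff_shiftOp_injective (chains m M i)).finrank_eq]
    refine Submodule.finrank_mono ?_
    rintro _ ⟨⟨_, ⟨φ, hφ, rfl⟩, rfl⟩, h0⟩
    have h0 : onCoeff (headMap k V)
      (withoutLast k (ℕ → V) m (kosz (seqOp X) φ)) = 0 := h0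
    rw [withoutLast_kosz _ hφ, seqOp_last] at h0 ⊢
    -- if the zeroth term of a boundary vanishes, the boundary is a shift of a chain in `M`: the
    -- operators `D` are the quotients of the multiplications by the shift
    set D : Fin m → Module.End k (ℕ → V) := fun v => (X v).compLeft ℕ ∘ₗ
      LinearMap.funLeft k V (· + 1) with hD
    refine ⟨kosz D (withoutLast k (ℕ → V) m φ) + (-1 : ℤˣ) ^ i • withLast k (ℕ → V) m φ,
      Submodule.add_mem _ (kosz_mem_chains (fun v q hq => hM q hq v) (withoutLast_mem_chains hφ))
        (neg_one_pow_smul_mem _ i (withLast_mem_chains hφ)), ?_⟩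
    rw [map_add, Units.smul_def, map_zsmul, Units.smul_def]
    congr 1
    funext S l
    cases l with
    | zero =>
      have := congrFun h0 S
      rw [onCoeff_apply, Pi.add_apply, map_add] at this
      rw [onCoeff_apply, shiftOp_zero]
      refine (Eq.trans ?_ this).symm
      rw [Pi.smul_apply, Units.smul_def, map_zsmul, onCoeff_apply, headMap_apply,
        headMap_apply, shiftOp_zero, smul_zero, add_zero]
    | succ l =>
      rw [onCoeff_apply, shiftOp_succ, kosz_apply_apply, kosz_apply_apply, Finset.sum_apply,
        Finset.sum_apply]
      refine Finset.sum_congr rfl fun v _ => ?_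
      rw [Units.smul_def, Units.smul_def, Pi.smul_apply, Pi.smul_apply, seqOp_castSucc]
      rfl
  · rw [← map_onCoeff_chains]
    rintro _ ⟨_, ⟨_, ⟨φ, hφ, rfl⟩, rfl⟩, rfl⟩
    refine ⟨_, ⟨_, withoutLast_mem_chains hφ, rfl⟩, ?_⟩
    rw [withoutLast_kosz _ hφ, map_add, seqOp_castSucc_proj, seqOp_last]
    refine (add_eq_left.2 ?_).symm
    rw [Units.smul_def, map_zsmul]
    refine smul_eq_zero_of_right _ ?_
    rfl

end Hyperplane

/-! ### Degeneration to stable layers -/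

section Layers

variable {k : Type*} [Field k] {V : Type*} [AddCommGroup V] [Module k V] {m : ℕ}

/-- A family of spaces of coefficients, `J l t` in front of the `l`-th power of the last variable
in degree `t`, that is closed under the multiplication by the variables. The coefficients have
degrees according to the grading `G`. -/
structure IsLayered (X : Fin m → Module.End k V) (G : ℕ → Submodule k V)
    (J : ℕ → ℕ → Submodule k V) : Prop where
  X_mem : ∀ l t v, ∀ x ∈ J l t, X v x ∈ J l (t + 1)
  le_succ : ∀ l t, J l t ≤ J (l + 1) (t + 1)
  eq_bot : ∀ t l, t < l → J l t = ⊥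
  le : ∀ t l, l ≤ t → J l t ≤ G (t - l)
  finite : ∀ l t, FiniteDimensional k (J l t)

/-- The space of sequences, in degree `t`, of a family of spaces of coefficients. -/
abbrev layerSeqs (J : ℕ → ℕ → Submodule k V) (t : ℕ) : Submodule k (ℕ → V) := seqs fun l => J l t

theorem IsLayered.finiteDimensional_layerSeqs {X : Fin m → Module.End k V} {G : ℕ → Submodule k V}
    {J : ℕ → ℕ → Submodule k V} (h : IsLayered X G J) (t : ℕ) :
    FiniteDimensional k (layerSeqs J t) := by
  have := fun l => h.finite l t
  exact finiteDimensional_seqs (h.eq_bot t)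

theorem IsLayered.finrank_layerSeqs {X : Fin m → Module.End k V} {G : ℕ → Submodule k V}
    {J : ℕ → ℕ → Submodule k V} (h : IsLayered X G J) (t : ℕ) :
    Module.finrank k (layerSeqs J t) =
      ∑ l ∈ Finset.range (t + 1), Module.finrank k (J l t) := by
  have := fun l => h.finite l t
  exact finrank_seqs (h.eq_bot t)

theorem IsLayered.apply_eq_zero {X : Fin m → Module.End k V} {G : ℕ → Submodule k V}
    {J : ℕ → ℕ → Submodule k V} (h : IsLayered X G J) {t l : ℕ} (hl : t < l) {q : ℕ → V}
    (hq : q ∈ layerSeqs J t) : q l = 0 := by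
  have := mem_seqs.1 hq l
  rwa [h.eq_bot t l hl, Submodule.mem_bot] at this

theorem IsLayered.seqOp_mem {X : Fin m → Module.End k V} {G : ℕ → Submodule k V}
    {J : ℕ → ℕ → Submodule k V}
    (h : IsLayered X G J) {t : ℕ} {q : ℕ → V} (hq : q ∈ layerSeqs J t) (v : Fin (m + 1)) :
    seqOp X v q ∈ layerSeqs J (t + 1) := by
  refine mem_seqs.2 fun l => ?_
  cases v using Fin.lastCases with
  | last =>
    rw [seqOp_last]
    cases l with
    | zero => exact Submodule.zero_mem _
    | succ l => exact h.le_succ l t (mem_seqs.1 hq l)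
  | cast v =>
    rw [seqOp_castSucc]
    exact h.X_mem l t v _ (mem_seqs.1 hq l)

/-- The leading coefficients of spaces of sequences that are closed under the operators form a family
of layers. -/
theorem isLayered_lead {X : Fin m → Module.End k V} {G : ℕ → Submodule k V}
    {U : ℕ → Submodule k (ℕ → V)}
    (hfin : ∀ t, FiniteDimensional k (U t)) (hU : ∀ t, ∀ q ∈ U t, ∀ l, t < l → q l = 0)
    (hG : ∀ t, ∀ q ∈ U t, ∀ l ≤ t, q l ∈ G (t - l))
    (hX : ∀ t v, ∀ q ∈ U t, seqOp X v q ∈ U (t + 1)) :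
    IsLayered X G fun l t => lead LinearMap.proj (U t) l where
  X_mem := by
    intro l t v x hx
    obtain ⟨q, hq, h0, rfl⟩ := mem_lead.1 hx
    refine mem_lead.2 ⟨_, hX t v.castSucc q hq, fun l' hl' => ?_, seqOp_castSucc X v q l⟩
    have := h0 l' hl'
    rw [LinearMap.proj_apply] at this
    rw [LinearMap.proj_apply, seqOp_castSucc, this, map_zero]
  le_succ := by
    intro l t x hx
    obtain ⟨q, hq, h0, rfl⟩ := mem_lead.1 hx
    refine mem_lead.2 ⟨_, hX t (Fin.last m) q hq, fun l' hl' => ?_, ?_⟩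
    · rw [seqOp_last, LinearMap.proj_apply]
      cases l' with
      | zero => rfl
      | succ l' => exact h0 l' (by omega)
    · rw [seqOp_last]
      rfl
  eq_bot := by
    intro t l hl
    rw [eq_bot_iff]
    intro x hx
    obtain ⟨q, hq, -, rfl⟩ := mem_lead.1 hx
    exact hU t q hq l hl
  le := by
    intro t l hl x hx
    obtain ⟨q, hq, -, rfl⟩ := mem_lead.1 hx
    exact hG t q hq l hl
  finite := fun l t => by
    have := hfin t
    infer_instance

theorem finrank_layerSeqs_lead {U : ℕ → Submodule k (ℕ → V)}
    (hfin : ∀ t, FiniteDimensional k (U t)) (hU : ∀ t, ∀ q ∈ U t, ∀ l, t < l → q l = 0) (t : ℕ) :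
    Module.finrank k (layerSeqs (fun l t => lead LinearMap.proj (U t) l) t) =
      Module.finrank k (U t) := by
  have := hfin t
  rw [finrank_eq_sum_lead LinearMap.proj (U t) (Finset.range (t + 1))
    (fun q hq l hl => hU t q hq l (by simpa using hl)) fun q _ h => funext h]
  refine finrank_seqs fun l hl => ?_
  rw [eq_bot_iff]
  intro x hx
  obtain ⟨q, hq, -, rfl⟩ := mem_lead.1 hx
  exact hU t q hq l hl

/-- The operator on sequences that replaces, in the powers of the last variable `z` with exponent
greater than `a`, one factor `z` by `z - x`. -/
def distract (x : Module.End k V) (a : ℕ) : Module.End k (ℕ → V) where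
  toFun q l := q l - if a ≤ l then x (q (l + 1)) else 0
  map_add' q r := by
    funext l
    simp only [Pi.add_apply]
    split_ifs
    · rw [map_add]
      abel
    · simp
  map_smul' b q := by
    funext l
    simp only [Pi.smul_apply, RingHom.id_apply]
    split_ifs
    · rw [map_smul, smul_sub]
    · simp

variable (k V) in
/-- The projection of sequences to the term of index `a`. -/
def termProj (a : ℕ) : Module.End k (ℕ → V) where
  toFun q l := if l = a then q l else 0
  map_add' q r := by
    funext l
    simp only [Pi.add_apply]
    split_ifs <;> simp
  map_smul' b q := by
    funext l
    simp only [Pi.smul_apply, RingHom.id_apply]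
    split_ifs <;> simp

theorem distract_apply (x : Module.End k V) (a : ℕ) (q : ℕ → V) (l : ℕ) :
    distract x a q l = q l - if a ≤ l then x (q (l + 1)) else 0 := rfl

theorem termProj_apply (a : ℕ) (q : ℕ → V) (l : ℕ) :
    termProj k V a q l = if l = a then q l else 0 := rfl

theorem termProj_mem {J : ℕ → Submodule k V} {a : ℕ} {q : ℕ → V} (hq : q ∈ seqs J) :
    termProj k V a q ∈ seqs J := by
  refine mem_seqs.2 fun l => ?_
  rw [termProj_apply]
  split_ifs
  · exact mem_seqs.1 hq l
  · exact Submodule.zero_mem _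

/-- The distraction intertwines the multiplications by the variables, up to a change of the last
one by a multiple of another one. -/
theorem distract_seqOp {X : Fin m → Module.End k V} (hX : ∀ v w, X v * X w = X w * X v) (v : Fin m)
    (a : ℕ) (w : Fin (m + 1)) (q : ℕ → V) :
    distract (X v) a (Function.update (seqOp X) (Fin.last m)
      (seqOp X (Fin.last m) + seqOp X v.castSucc * termProj k V a) w q) =
        seqOp X w (distract (X v) a q) := by
  funext l
  cases w using Fin.lastCases with
  | last =>
    rw [Function.update_self, seqOp_last, LinearMap.add_apply, Module.End.mul_apply, map_add,
      Pi.add_apply, distract_apply, distract_apply, seqOp_castSucc, seqOp_castSucc, termProj_apply,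
      termProj_apply, shiftOp_succ]
    cases l with
    | zero =>
      rw [shiftOp_zero, shiftOp_zero]
      rcases Nat.eq_zero_or_pos a with rfl | ha
      · simp
      · simp [ha.ne', ha.ne]
    | succ l =>
      rw [shiftOp_succ, shiftOp_succ, distract_apply]
      rcases lt_trichotomy (l + 1) a with h | h | h
      · simp [show ¬ a ≤ l + 1 by omega, show l + 1 ≠ a by omega, show ¬ a ≤ l by omega]
      · subst h
        simp
      · simp [show a ≤ l + 1 by omega, show l + 1 ≠ a by omega, show a ≤ l by omega,
          show l + 1 + 1 ≠ a by omega]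
  | cast w =>
    rw [Function.update_of_ne (Fin.castSucc_lt_last w).ne, distract_apply, seqOp_castSucc,
      seqOp_castSucc, seqOp_castSucc, distract_apply, map_sub]
    congr 1
    split_ifs
    · exact LinearMap.congr_fun (hX v w) (q (l + 1))
    · rw [map_zero]

theorem eq_zero_of_distract_eq_zero {x : Module.End k V} {a N : ℕ} {q : ℕ → V}
    (hq : ∀ l, N < l → q l = 0) (h : distract x a q = 0) : q = 0 := by
  have key : ∀ d l, N < l + d → q l = 0 := by
    intro d
    induction d with
    | zero => exact fun l hl => hq l hl
    | succ d ih =>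
      intro l hl
      have h1 := congrFun h l
      rw [distract_apply, ih (l + 1) (by omega), map_zero, ite_self, sub_zero] at h1
      exact h1
  exact funext fun l => key (N + 1) l (by omega)

/-- The leading coefficients of the distraction of a family of layers. -/
def distractLayers (x : Module.End k V) (a : ℕ) (J : ℕ → ℕ → Submodule k V) (l t : ℕ) :
    Submodule k V :=
  lead LinearMap.proj ((layerSeqs J t).map (distract x a)) l

theorem le_distractLayers (x : Module.End k V) {a l : ℕ} (J : ℕ → ℕ → Submodule k V) (t : ℕ)
    (hl : l ≤ a) : J l t ≤ distractLayers x a J l t := by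
  intro y hy
  refine mem_lead.2 ⟨_, Submodule.mem_map_of_mem (single_mem_seqs hy), fun l' hl' => ?_, ?_⟩
  · rw [LinearMap.proj_apply, distract_apply, if_neg (by omega), sub_zero,
      Pi.single_eq_of_ne hl'.ne]
  · rw [LinearMap.proj_apply, distract_apply, Pi.single_eq_same,
      Pi.single_eq_of_ne (Nat.succ_ne_self l), map_zero, ite_self, sub_zero]

theorem apply_mem_distractLayers (x : Module.End k V) (a : ℕ) (J : ℕ → ℕ → Submodule k V) (t : ℕ)
    {y : V} (hy : y ∈ J (a + 1) t) : x y ∈ distractLayers x a J a t := by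
  rw [← Submodule.neg_mem_iff]
  refine mem_lead.2 ⟨_, Submodule.mem_map_of_mem
    (single_mem_seqs (J := fun l => J l t) hy), fun l' hl' => ?_, ?_⟩
  · rw [LinearMap.proj_apply, distract_apply, if_neg (by omega), sub_zero,
      Pi.single_eq_of_ne (by omega)]
  · rw [LinearMap.proj_apply, distract_apply, Pi.single_eq_same,
      Pi.single_eq_of_ne (by omega), if_pos le_rfl, zero_sub]

section Distraction

variable {X : Fin m → Module.End k V} {G : ℕ → Submodule k V}
  (hX : ∀ v w, X v * X w = X w * X v)
  (hG : ∀ t v, ∀ x ∈ G t, X v x ∈ G (t + 1))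
  {J : ℕ → ℕ → Submodule k V} (hJ : IsLayered X G J)

include hJ in
theorem IsLayered.distract_bounded (x : Module.End k V) (a t : ℕ) :
    ∀ q ∈ (layerSeqs J t).map (distract x a), ∀ l, t < l → q l = 0 := by
  rintro _ ⟨q, hq, rfl⟩ l hl
  rw [distract_apply, hJ.apply_eq_zero hl hq, hJ.apply_eq_zero (by omega) hq, map_zero, ite_self,
    sub_zero]

include hJ in
theorem IsLayered.finiteDimensional_distract (x : Module.End k V) (a t : ℕ) :
    FiniteDimensional k ((layerSeqs J t).map (distract x a)) := by
  have := hJ.finiteDimensional_layerSeqs t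
  infer_instance

include hX hG hJ in
theorem IsLayered.distractLayers (v : Fin m) (a : ℕ) :
    IsLayered X G (distractLayers (X v) a J) := by
  refine isLayered_lead (hJ.finiteDimensional_distract (X v) a) (hJ.distract_bounded (X v) a) ?_ ?_
  · rintro t _ ⟨q, hq, rfl⟩ l hl
    rw [distract_apply]
    refine Submodule.sub_mem _ (hJ.le t l hl (mem_seqs.1 hq l)) ?_
    split_ifs
    · rcases hl.lt_or_eq with hl | rfl
      · have := hG _ v _ (hJ.le t (l + 1) hl (mem_seqs.1 hq (l + 1)))
        rwa [show t - (l + 1) + 1 = t - l by omega] at this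
      · rw [hJ.apply_eq_zero (Nat.lt_succ_self l) hq, map_zero]
        exact Submodule.zero_mem _
    · exact Submodule.zero_mem _
  rintro t w _ ⟨q, hq, rfl⟩
  rw [← distract_seqOp hX]
  refine Submodule.mem_map_of_mem ?_
  cases w using Fin.lastCases with
  | last =>
    rw [Function.update_self]
    exact Submodule.add_mem _ (hJ.seqOp_mem hq _) (hJ.seqOp_mem (termProj_mem hq) _)
  | cast w =>
    rw [Function.update_of_ne (Fin.castSucc_lt_last w).ne]
    exact hJ.seqOp_mem hq _

include hJ in
theorem IsLayered.finrank_distractLayers (x : Module.End k V) (a t : ℕ) :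
    Module.finrank k (layerSeqs (LexPlusPowers.distractLayers x a J) t) =
      Module.finrank k (layerSeqs J t) := by
  have := hJ.finiteDimensional_layerSeqs t
  have h := finrank_layerSeqs_lead (hJ.finiteDimensional_distract x a) (hJ.distract_bounded x a) t
  refine h.trans ?_
  rw [← finrank_map_add_finrank_inf_ker (distract x a) (layerSeqs J t)]
  have : layerSeqs J t ⊓ LinearMap.ker (distract x a) = ⊥ := by
    rw [eq_bot_iff]
    rintro q ⟨hq, h0⟩
    exact eq_zero_of_distract_eq_zero (fun l hl => hJ.apply_eq_zero hl hq) h0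
  rw [this, finrank_bot, add_zero]

include hX hJ in
theorem IsLayered.kRank_distractLayers_le (v : Fin m) (a t i : ℕ) :
    kRank (seqOp X) (layerSeqs (LexPlusPowers.distractLayers (X v) a J) t) i ≤
      kRank (seqOp X) (layerSeqs J t) i := by
  have := hJ.finiteDimensional_layerSeqs t
  refine (kRank_seqs_lead_le X _ (hJ.distract_bounded (X v) a t) i).trans (le_of_eq ?_)
  rw [kRank_map_of_injOn (distract_seqOp hX v a) (N := layerSeqs J (t + 1))
    (fun q hq h0 => eq_zero_of_distract_eq_zero (fun l hl => hJ.apply_eq_zero hl hq) h0)]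
  · refine kRank_shear (Fin.castSucc_lt_last v).ne (fun w hw => ?_)
      (fun q hq => termProj_mem hq) i
    obtain ⟨w, rfl⟩ := Fin.exists_castSucc_eq.2 hw
    refine LinearMap.ext fun q => ?_
    funext l
    rw [Module.End.mul_apply, Module.End.mul_apply, termProj_apply, seqOp_castSucc, seqOp_castSucc,
      termProj_apply]
    split_ifs
    · rfl
    · rw [map_zero]
  · intro w q hq
    cases w using Fin.lastCases with
    | last =>
      rw [Function.update_self]
      exact Submodule.add_mem _ (hJ.seqOp_mem hq _) (hJ.seqOp_mem (termProj_mem hq) _)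
    | cast w =>
      rw [Function.update_of_ne (Fin.castSucc_lt_last w).ne]
      exact hJ.seqOp_mem hq _

end Distraction

/-- Every family of layers degenerates to one that is stable, in degrees at most `N`: the
replacement of a factor equal to the last variable by another variable preserves it. The Koszul
ranks do not increase and the bottom layer does not decrease. -/
theorem IsLayered.exists_stable {X : Fin m → Module.End k V} {G : ℕ → Submodule k V}
    (hX : ∀ v w, X v * X w = X w * X v) (hXG : ∀ t v, ∀ x ∈ G t, X v x ∈ G (t + 1))
    {J : ℕ → ℕ → Submodule k V} (hJ : IsLayered X G J) (N : ℕ) :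
    ∃ J' : ℕ → ℕ → Submodule k V, IsLayered X G J' ∧
      (∀ t, Module.finrank k (layerSeqs J' t) = Module.finrank k (layerSeqs J t)) ∧
      (∀ t i, kRank (seqOp X) (layerSeqs J' t) i ≤ kRank (seqOp X) (layerSeqs J t) i) ∧
      (∀ t, J 0 t ≤ J' 0 t) ∧
      ∀ t ≤ N, ∀ a v, ∀ x ∈ J' (a + 1) t, X v x ∈ J' a t := by
  classical
  set F : Set (ℕ → ℕ → Submodule k V) := {J' | IsLayered X G J' ∧
      (∀ t, Module.finrank k (layerSeqs J' t) = Module.finrank k (layerSeqs J t)) ∧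
      (∀ t i, kRank (seqOp X) (layerSeqs J' t) i ≤ kRank (seqOp X) (layerSeqs J t) i) ∧
      ∀ t, J 0 t ≤ J' 0 t} with hF
  -- the dimensions of the layers are bounded, so that they can be chosen lexicographically maximal
  set T := ∑ t ∈ Finset.range (N + 1), Module.finrank k (layerSeqs J t) with hT
  set d : (ℕ → ℕ → Submodule k V) → ℕ → ℕ := fun J' l =>
    ∑ t ∈ Finset.range (N + 1), Module.finrank k (J' l t) with hd
  have hdT : ∀ J' ∈ F, ∀ l, d J' l < T + 1 := by
    intro J' hJ' l
    refine Nat.lt_succ_of_le (Finset.sum_le_sum fun t _ => ?_)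
    rw [← hJ'.2.1 t, hJ'.1.finrank_layerSeqs t]
    by_cases hl : l ∈ Finset.range (t + 1)
    · exact Finset.single_le_sum (f := fun l => Module.finrank k (J' l t))
        (fun _ _ => Nat.zero_le _) hl
    · rw [hJ'.1.eq_bot t l (by simpa using hl), finrank_bot]
      exact Nat.zero_le _
  set D : F → Lex (Fin (N + 1) → Fin (T + 1)) := fun J' =>
    toLex fun l => ⟨d J'.1 l, hdT J'.1 J'.2 l⟩ with hD
  have : Finite (Lex (Fin (N + 1) → Fin (T + 1))) :=
    inferInstanceAs (Finite (Fin (N + 1) → Fin (T + 1)))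
  obtain ⟨_, ⟨J', rfl⟩, hmax⟩ := (Set.toFinite (Set.range D)).exists_maximal
    ⟨_, ⟨⟨J, hJ, fun _ => rfl, fun _ _ => le_rfl, fun _ => le_rfl⟩, rfl⟩⟩
  obtain ⟨J', hJ'⟩ := J'
  refine ⟨J', hJ'.1, hJ'.2.1, hJ'.2.2.1, hJ'.2.2.2, fun t ht a v x hx => ?_⟩
  -- otherwise the distraction of `z` by `x_v` above the exponent `a` would be larger
  by_contra hxa
  by_cases hat : t < a + 1
  · rw [hJ'.1.eq_bot t _ hat, Submodule.mem_bot] at hx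
    rw [hx, map_zero] at hxa
    exact hxa (Submodule.zero_mem _)
  have hL := hJ'.1.distractLayers hX hXG v a
  have hJ'' : LexPlusPowers.distractLayers (X v) a J' ∈ F := by
    refine ⟨hL, fun t => ?_, fun t i => ?_, fun t => ?_⟩
    · rw [hJ'.1.finrank_distractLayers, hJ'.2.1]
    · exact (hJ'.1.kRank_distractLayers_le hX v a t i).trans (hJ'.2.2.1 t i)
    · exact (hJ'.2.2.2 t).trans (le_distractLayers _ _ _ (Nat.zero_le a))
  have hmono : ∀ l ≤ a, ∀ t, Module.finrank k (J' l t) ≤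
      Module.finrank k (LexPlusPowers.distractLayers (X v) a J' l t) := fun l hl t => by
    have := hL.finite l t
    exact Submodule.finrank_mono (le_distractLayers _ _ _ hl)
  have hlt : d J' a < d (LexPlusPowers.distractLayers (X v) a J') a := by
    refine Finset.sum_lt_sum (fun t _ => hmono a le_rfl t) ⟨t, by simpa using Nat.lt_succ_of_le ht, ?_⟩
    have := hL.finite a t
    refine Submodule.finrank_lt_finrank_of_lt (lt_of_le_of_ne (le_distractLayers _ _ _ le_rfl) ?_)
    intro heq
    exact hxa (heq ▸ apply_mem_distractLayers (X v) a J' t hx)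
  have hDlt : D ⟨J', hJ'⟩ < D ⟨_, hJ''⟩ := by
    by_contra hnot
    rcases (not_lt.1 hnot).lt_or_eq with h | h
    · obtain ⟨i, hi, hlt'⟩ := h
      have hi1 : d (LexPlusPowers.distractLayers (X v) a J') i < d J' i := hlt'
      by_cases hia : (i : ℕ) ≤ a
      · exact absurd (Finset.sum_le_sum fun t _ => hmono i hia t) hi1.not_ge
      · have := congrArg Fin.val (hi ⟨a, by omega⟩ (Fin.lt_def.2 (not_le.1 hia)))
        exact hlt.ne' this
    · have := congrArg Fin.val (congrFun h ⟨a, by omega⟩)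
      exact hlt.ne' this
  exact absurd (hmax ⟨_, rfl⟩ hDlt.le) hDlt.not_ge

end Layers

/-! ### Coefficients with respect to the last variable -/

section Snoc

variable {m : ℕ}

/-- The exponent vector with an additional last exponent. -/
noncomputable def snocExp (w : Fin m →₀ ℕ) (l : ℕ) : Fin (m + 1) →₀ ℕ :=
  w.mapDomain Fin.castSucc + Finsupp.single (Fin.last m) l

/-- The exponent vector without its last exponent. -/
noncomputable def initExp (u : Fin (m + 1) →₀ ℕ) : Fin m →₀ ℕ :=
  u.comapDomain Fin.castSucc (Fin.castSucc_injective m).injOn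

@[simp]
theorem snocExp_last (w : Fin m →₀ ℕ) (l : ℕ) : snocExp w l (Fin.last m) = l := by
  rw [snocExp, Finsupp.add_apply, Finsupp.single_eq_same, Finsupp.mapDomain_of_notMem_range, zero_add]
  rintro ⟨v, hv⟩
  exact (Fin.castSucc_lt_last v).ne hv

@[simp]
theorem snocExp_castSucc (w : Fin m →₀ ℕ) (l : ℕ) (v : Fin m) :
    snocExp w l v.castSucc = w v := by
  rw [snocExp, Finsupp.add_apply, Finsupp.mapDomain_apply (Fin.castSucc_injective m),
    Finsupp.single_eq_of_ne (Fin.castSucc_lt_last v).ne, add_zero]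

@[simp]
theorem initExp_apply (u : Fin (m + 1) →₀ ℕ) (v : Fin m) : initExp u v = u v.castSucc := rfl

theorem ext_last {u w : Fin (m + 1) →₀ ℕ} (h : ∀ v : Fin m, u v.castSucc = w v.castSucc)
    (hl : u (Fin.last m) = w (Fin.last m)) : u = w := by
  ext v
  cases v using Fin.lastCases with
  | last => exact hl
  | cast v => exact h v

theorem initExp_snocExp (w : Fin m →₀ ℕ) (l : ℕ) : initExp (snocExp w l) = w := by
  ext v
  simp

theorem snocExp_initExp (u : Fin (m + 1) →₀ ℕ) : snocExp (initExp u) (u (Fin.last m)) = u :=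
  ext_last (fun v => by simp) (by simp)

theorem snocExp_injective (l : ℕ) : Function.Injective fun w : Fin m →₀ ℕ => snocExp w l :=
  fun w w' h => by rw [← initExp_snocExp w l, ← initExp_snocExp w' l]; exact congrArg initExp h

theorem degree_snocExp (w : Fin m →₀ ℕ) (l : ℕ) : (snocExp w l).degree = w.degree + l := by
  rw [Finsupp.degree_eq_sum, Finsupp.degree_eq_sum, Fin.sum_univ_castSucc]
  simp

theorem snocExp_add_castSucc (w : Fin m →₀ ℕ) (l : ℕ) (v : Fin m) :
    snocExp w l + Finsupp.single v.castSucc 1 = snocExp (w + Finsupp.single v 1) l := by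
  refine ext_last (fun v' => ?_) ?_
  · simp [Finsupp.single_apply]
  · simp [(Fin.castSucc_lt_last v).ne]

theorem snocExp_add_last (w : Fin m →₀ ℕ) (l : ℕ) :
    snocExp w l + Finsupp.single (Fin.last m) 1 = snocExp w (l + 1) := by
  refine ext_last (fun v' => ?_) ?_
  · simp
  · simp

theorem toLex_snocExp_lt_iff {w w' : Fin m →₀ ℕ} (l : ℕ) :
    toLex (snocExp w l) < toLex (snocExp w' l) ↔ toLex w < toLex w' := by
  rw [lex_lt_iff, lex_lt_iff]
  constructor
  · rintro ⟨i, h, hi⟩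
    cases i using Fin.lastCases with
    | last => simp at hi
    | cast i =>
      exact ⟨i, fun j hj => by simpa using h j.castSucc (by simpa using hj), by simpa using hi⟩
  · rintro ⟨i, h, hi⟩
    refine ⟨i.castSucc, fun j hj => ?_, by simpa using hi⟩
    cases j using Fin.lastCases with
    | last => simp
    | cast j => simpa using h j (by simpa using hj)

end Snoc

section LayerCoeff

variable {k : Type*} [Field k] {m : ℕ}

/-- The coefficient of the `l`-th power of the last variable. -/
noncomputable def layerCoeff (k : Type*) [Field k] (m l : ℕ) :
    MvPolynomial (Fin (m + 1)) k →ₗ[k] MvPolynomial (Fin m) k :=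
  (basisMonomials (Fin (m + 1)) k).constr k fun u =>
    if u (Fin.last m) = l then monomial (initExp u) 1 else 0

theorem layerCoeff_monomial (l : ℕ) (u : Fin (m + 1) →₀ ℕ) (a : k) :
    layerCoeff k m l (monomial u a) =
      if u (Fin.last m) = l then monomial (initExp u) a else 0 := by
  have : monomial u a = a • basisMonomials (Fin (m + 1)) k u := by
    rw [coe_basisMonomials, smul_monomial, smul_eq_mul, mul_one]
  rw [this, map_smul, layerCoeff, Module.Basis.constr_basis]
  split_ifs
  · rw [smul_monomial, smul_eq_mul, mul_one]
  · rw [smul_zero]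

theorem coeff_layerCoeff (l : ℕ) (w : Fin m →₀ ℕ) (p : MvPolynomial (Fin (m + 1)) k) :
    coeff w (layerCoeff k m l p) = coeff (snocExp w l) p := by
  induction p using MvPolynomial.induction_on' with
  | monomial u a =>
    rw [layerCoeff_monomial, coeff_monomial]
    by_cases hl : u (Fin.last m) = l
    · subst hl
      rw [if_pos rfl, coeff_monomial]
      by_cases h : initExp u = w
      · subst h
        rw [if_pos rfl, if_pos (snocExp_initExp u).symm]
      · rw [if_neg h, if_neg]
        intro h'
        apply h
        rw [h', initExp_snocExp]
    · rw [if_neg hl, coeff_zero, if_neg]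
      rintro rfl
      exact hl (snocExp_last w l)
  | add p q hp hq => rw [map_add, coeff_add, coeff_add, hp, hq]

variable (k m) in
/-- The sequence of coefficients of a polynomial with respect to the last variable. -/
noncomputable def layers : MvPolynomial (Fin (m + 1)) k →ₗ[k] (ℕ → MvPolynomial (Fin m) k) :=
  LinearMap.pi (layerCoeff k m)

theorem layers_apply (p : MvPolynomial (Fin (m + 1)) k) (l : ℕ) :
    layers k m p l = layerCoeff k m l p := rfl

theorem layers_injective : Function.Injective (layers k m) := by
  intro p q h
  ext u
  rw [← snocExp_initExp u, ← coeff_layerCoeff, ← coeff_layerCoeff, ← layers_apply, h, layers_apply]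

theorem layerCoeff_X_castSucc_mul (l : ℕ) (v : Fin m) (p : MvPolynomial (Fin (m + 1)) k) :
    layerCoeff k m l (X v.castSucc * p) = X v * layerCoeff k m l p := by
  ext w
  rw [coeff_layerCoeff, coeff_X_mul', coeff_X_mul', coeff_layerCoeff]
  simp only [Finsupp.mem_support_iff, snocExp_castSucc]
  split_ifs with h
  · replace h : 1 ≤ w v := Nat.one_le_iff_ne_zero.2 h
    congr 1
    conv_lhs => rw [← tsub_add_cancel_of_le (show Finsupp.single v 1 ≤ w by simpa using h)]
    rw [← snocExp_add_castSucc, add_tsub_cancel_right]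
  · rfl

theorem layerCoeff_zero_X_last_mul (p : MvPolynomial (Fin (m + 1)) k) :
    layerCoeff k m 0 (X (Fin.last m) * p) = 0 := by
  ext w
  rw [coeff_layerCoeff, coeff_X_mul', if_neg (by simp), coeff_zero]

theorem layerCoeff_succ_X_last_mul (l : ℕ) (p : MvPolynomial (Fin (m + 1)) k) :
    layerCoeff k m (l + 1) (X (Fin.last m) * p) = layerCoeff k m l p := by
  ext w
  rw [coeff_layerCoeff, coeff_X_mul', if_pos (by simp), coeff_layerCoeff, ← snocExp_add_last,
    add_tsub_cancel_right]

theorem layers_X_mul (v : Fin (m + 1)) (p : MvPolynomial (Fin (m + 1)) k) :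
    layers k m (mulX k (m + 1) v p) = seqOp (mulX k m) v (layers k m p) := by
  funext l
  rw [layers_apply, mulX_apply]
  cases v using Fin.lastCases with
  | last =>
    rw [seqOp_last]
    cases l with
    | zero => exact layerCoeff_zero_X_last_mul p
    | succ l => exact layerCoeff_succ_X_last_mul l p
  | cast v =>
    rw [seqOp_castSucc, mulX_apply, layerCoeff_X_castSucc_mul, layers_apply]

theorem polyRank_eq_kRank_layers (U : Submodule k (MvPolynomial (Fin (m + 1)) k)) (i : ℕ) :
    polyRank U i = kRank (seqOp (mulX k m)) (U.map (layers k m)) i :=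
  (kRank_map layers_injective layers_X_mul U i).symm

theorem layerCoeff_homogeneous {p : MvPolynomial (Fin (m + 1)) k} {t l : ℕ}
    (hp : p.IsHomogeneous t) (hl : l ≤ t) : (layerCoeff k m l p).IsHomogeneous (t - l) := by
  intro w hw
  rw [coeff_layerCoeff] at hw
  have := hp hw
  rw [Pi.one_def, ← Finsupp.degree_eq_weight_one, degree_snocExp] at this
  rw [Pi.one_def, ← Finsupp.degree_eq_weight_one]
  omega

theorem layerCoeff_eq_zero {p : MvPolynomial (Fin (m + 1)) k} {t l : ℕ}
    (hp : p.IsHomogeneous t) (hl : t < l) : layerCoeff k m l p = 0 := by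
  ext w
  rw [coeff_layerCoeff, coeff_zero]
  by_contra hw
  have := hp hw
  rw [Pi.one_def, ← Finsupp.degree_eq_weight_one, degree_snocExp] at this
  omega

theorem layerCoeff_zero_homogeneousComponent (p : MvPolynomial (Fin (m + 1)) k) (t : ℕ) :
    layerCoeff k m 0 (homogeneousComponent t p) = homogeneousComponent t (layerCoeff k m 0 p) := by
  ext w
  rw [coeff_layerCoeff, coeff_homogeneousComponent, coeff_homogeneousComponent, coeff_layerCoeff,
    degree_snocExp, add_zero]

/-- The reduction modulo the last variable. -/
theorem modLastVars_eq_layerCoeff (p : MvPolynomial (Fin (m + 1)) k) :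
    modLastVars k (m + 1) m p = layerCoeff k m 0 p := by
  induction p using MvPolynomial.induction_on with
  | C a =>
    rw [← algebraMap_eq, AlgHom.commutes, algebraMap_eq, algebraMap_eq]
    refine ((layerCoeff_monomial 0 0 a).trans ?_).symm
    have h0 : initExp (0 : Fin (m + 1) →₀ ℕ) = 0 := by
      ext v
      rfl
    rw [if_pos (by simp), C_apply, h0]
  | add p q hp hq => rw [map_add, map_add, hp, hq]
  | mul_X p v hp =>
    rw [map_mul, hp, mul_comm p, mul_comm, modLastVars, aeval_X]
    cases v using Fin.lastCases with
    | last => rw [layerCoeff_zero_X_last_mul, dif_neg (by simp), zero_mul]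
    | cast v =>
      rw [layerCoeff_X_castSucc_mul, dif_pos (by simp)]
      rfl

theorem modLastVars_surjective : Function.Surjective (modLastVars k (m + 1) m) := by
  intro p
  refine ⟨rename Fin.castSucc p, ?_⟩
  rw [modLastVars, aeval_rename]
  conv_rhs => rw [← aeval_X_left_apply p]
  congr 2
  funext i
  simp

end LayerCoeff

/-! ### Monomials and their layers -/

section Glue

variable {m c : ℕ}

theorem snocExp_mem_capMon (hcm : c ≤ m) {e : Fin c → ℕ} {t l : ℕ} {w : Fin m →₀ ℕ} :
    snocExp w l ∈ capMon e (m + 1) t ↔ l ≤ t ∧ w ∈ capMon e m (t - l) := by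
  rw [mem_capMon, mem_capMon, degree_snocExp]
  constructor
  · rintro ⟨h1, h2⟩
    refine ⟨by omega, by omega, fun i j hij => ?_⟩
    have := h2 i.castSucc j hij
    rwa [snocExp_castSucc] at this
  · rintro ⟨h0, h1, h2⟩
    refine ⟨by omega, fun i j hij => ?_⟩
    cases i using Fin.lastCases with
    | last =>
      have := j.2
      rw [Fin.val_last] at hij
      omega
    | cast i =>
      rw [snocExp_castSucc]
      exact h2 i j hij

theorem initExp_mem_capMon (hcm : c ≤ m) {e : Fin c → ℕ} {t : ℕ} {u : Fin (m + 1) →₀ ℕ} :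
    u ∈ capMon e (m + 1) t ↔
      u (Fin.last m) ≤ t ∧ initExp u ∈ capMon e m (t - u (Fin.last m)) := by
  conv_lhs => rw [← snocExp_initExp u]
  exact snocExp_mem_capMon hcm

open Classical in
/-- The monomials, outside the ideal of powers, with layers in given sets. -/
noncomputable def glue (e : Fin c → ℕ) (t : ℕ) (S : ℕ → Finset (Fin m →₀ ℕ)) :
    Finset (Fin (m + 1) →₀ ℕ) :=
  (capMon e (m + 1) t).filter fun u => initExp u ∈ S (u (Fin.last m))

theorem mem_glue {e : Fin c → ℕ} {t : ℕ} {S : ℕ → Finset (Fin m →₀ ℕ)} {u : Fin (m + 1) →₀ ℕ} :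
    u ∈ glue e t S ↔ u ∈ capMon e (m + 1) t ∧ initExp u ∈ S (u (Fin.last m)) := by
  rw [glue, Finset.mem_filter]

theorem snocExp_mem_glue (hcm : c ≤ m) {e : Fin c → ℕ} {t l : ℕ} {S : ℕ → Finset (Fin m →₀ ℕ)}
    (hS : S l ⊆ capMon e m (t - l)) (hl : l ≤ t) {w : Fin m →₀ ℕ} :
    snocExp w l ∈ glue e t S ↔ w ∈ S l := by
  rw [mem_glue, snocExp_last, initExp_snocExp, snocExp_mem_capMon hcm]
  exact ⟨fun h => h.2, fun h => ⟨⟨hl, hS h⟩, h⟩⟩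

theorem card_glue (hcm : c ≤ m) {e : Fin c → ℕ} {t : ℕ} {S : ℕ → Finset (Fin m →₀ ℕ)}
    (hS : ∀ l ≤ t, S l ⊆ capMon e m (t - l)) :
    (glue e t S).card = ∑ l ∈ Finset.range (t + 1), (S l).card := by
  classical
  rw [Finset.card_eq_sum_card_fiberwise (f := fun u => u (Fin.last m))
    (t := Finset.range (t + 1))]
  · refine Finset.sum_congr rfl fun l hl => ?_
    have hl : l ≤ t := Nat.lt_succ_iff.1 (Finset.mem_range.1 hl)
    rw [← Finset.card_image_of_injective (S l) (snocExp_injective l)]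
    congr 1
    ext u
    rw [Finset.mem_filter, Finset.mem_image]
    constructor
    · rintro ⟨hu, rfl⟩
      exact ⟨_, (mem_glue.1 hu).2, snocExp_initExp u⟩
    · rintro ⟨w, hw, rfl⟩
      exact ⟨(snocExp_mem_glue hcm (hS l hl) hl).2 hw, snocExp_last w l⟩
  · intro u hu
    have := ((initExp_mem_capMon hcm).1 (mem_glue.1 hu).1).1
    rw [Finset.coe_range, Set.mem_Iio]
    exact Nat.lt_succ_of_le this

theorem card_capMon_succ (hcm : c ≤ m) (e : Fin c → ℕ) (t : ℕ) :
    (capMon e (m + 1) t).card = ∑ l ∈ Finset.range (t + 1), (capMon e m (t - l)).card := by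
  rw [← card_glue hcm fun l _ => subset_rfl]
  congr 1
  ext u
  rw [mem_glue, initExp_mem_capMon hcm]
  tauto

theorem hilb_top (k : Type*) [Field k] (n t : ℕ) :
    hilb (⊤ : Ideal (MvPolynomial (Fin n) k)) t =
      (capMon (Fin.elim0 : Fin 0 → ℕ) n t).card := by
  have h : powerIdeal k n (Fin.elim0 : Fin 0 → ℕ) = ⊥ := by
    rw [powerIdeal, Ideal.span_eq_bot]
    rintro _ ⟨_, j, _⟩
    exact j.elim0
  rw [← hilb_powerIdeal_add_card (k := k) (Fin.elim0 : Fin 0 → ℕ), h, add_eq_right, hilb,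
    Module.finrank_eq_zero_iff_of_free]
  refine ⟨fun x y => Subtype.ext ?_⟩
  have hx := x.2.1
  have hy := y.2.1
  exact (Ideal.mem_bot.1 hx).trans (Ideal.mem_bot.1 hy).symm

theorem hilb_powerIdeal_succ (k : Type*) [Field k] (hcm : c ≤ m) (e : Fin c → ℕ) (t : ℕ) :
    hilb (powerIdeal k (m + 1) e) t =
      ∑ l ∈ Finset.range (t + 1), hilb (powerIdeal k m e) (t - l) := by
  have h1 := hilb_powerIdeal_add_card (k := k) (n := m + 1) e t
  rw [hilb_top, card_capMon_succ (Nat.zero_le m), card_capMon_succ hcm] at h1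
  have h2 : ∀ l, (capMon (Fin.elim0 : Fin 0 → ℕ) m (t - l)).card =
      hilb (powerIdeal k m e) (t - l) + (capMon e m (t - l)).card := fun l => by
    rw [hilb_powerIdeal_add_card, hilb_top]
  simp only [h2, Finset.sum_add_distrib] at h1
  omega

end Glue

/-! ### The layers of an ideal -/

section IdealLayers

variable {k : Type*} [Field k] {m c : ℕ}

/-- The leading coefficients, in front of the `l`-th power of the last variable, of the elements
of degree `t` of an ideal. -/
noncomputable def idealLayers (I : Ideal (MvPolynomial (Fin (m + 1)) k)) (l t : ℕ) :
    Submodule k (MvPolynomial (Fin m) k) :=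
  lead LinearMap.proj ((gradedPart I t).map (layers k m)) l

theorem mulX_comm (v w : Fin m) : mulX k m v * mulX k m w = mulX k m w * mulX k m v :=
  LinearMap.ext fun p => mul_left_comm (X v) (X w) p

theorem mulX_mem_homogeneous (t : ℕ) (v : Fin m) :
    ∀ p ∈ homogeneousSubmodule (Fin m) k t, mulX k m v p ∈ homogeneousSubmodule (Fin m) k (t + 1) :=
  fun _ hp => X_mul_mem_homogeneous v hp

theorem map_layers_bounded (I : Ideal (MvPolynomial (Fin (m + 1)) k)) (t : ℕ) :
    ∀ q ∈ (gradedPart I t).map (layers k m), ∀ l, t < l → q l = 0 := by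
  rintro _ ⟨p, hp, rfl⟩ l hl
  exact layerCoeff_eq_zero hp.2 hl

theorem isLayered_idealLayers (I : Ideal (MvPolynomial (Fin (m + 1)) k)) :
    IsLayered (mulX k m) (homogeneousSubmodule (Fin m) k) (idealLayers I) := by
  refine isLayered_lead (fun t => inferInstance) (map_layers_bounded I) ?_ ?_
  · rintro t _ ⟨p, hp, rfl⟩ l hl
    exact layerCoeff_homogeneous hp.2 hl
  · rintro t v _ ⟨p, hp, rfl⟩
    rw [← layers_X_mul]
    exact Submodule.mem_map_of_mem ((isGradedFamily_gradedPart I).X_mul t v p hp)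

theorem finrank_layerSeqs_idealLayers (I : Ideal (MvPolynomial (Fin (m + 1)) k)) (t : ℕ) :
    Module.finrank k (layerSeqs (idealLayers I) t) = hilb I t := by
  have h := finrank_layerSeqs_lead (U := fun t => (gradedPart I t).map (layers k m))
    (fun t => inferInstance) (map_layers_bounded I) t
  refine h.trans ?_
  exact (Submodule.equivMapOfInjective _ layers_injective _).finrank_eq.symm

theorem kRank_idealLayers_le (I : Ideal (MvPolynomial (Fin (m + 1)) k)) (t i : ℕ) :
    kRank (seqOp (mulX k m)) (layerSeqs (idealLayers I) t) i ≤ polyRank (gradedPart I t) i := by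
  rw [polyRank_eq_kRank_layers]
  exact kRank_seqs_lead_le _ _ (map_layers_bounded I t) i

theorem map_modLastVars_le_idealLayers {I a : Ideal (MvPolynomial (Fin (m + 1)) k)}
    (ha : IsHomogeneousIdeal a) (haI : a ≤ I) (t : ℕ) :
    gradedPart (a.map (modLastVars k (m + 1) m)) t ≤ idealLayers I 0 t := by
  intro p hp
  obtain ⟨q, hq, hqp⟩ := (Ideal.mem_map_iff_of_surjective _ modLastVars_surjective).1 hp.1
  rw [modLastVars_eq_layerCoeff] at hqp
  refine mem_lead.2 ⟨_, Submodule.mem_map_of_mem ⟨haI (isHomogeneousIdeal_iff.1 ha q hq t),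
    homogeneousComponent_isHomogeneous t q⟩, fun l hl => absurd hl (Nat.not_lt_zero l), ?_⟩
  rw [LinearMap.proj_apply, layers_apply, layerCoeff_zero_homogeneousComponent, hqp,
    homogeneousComponent_of_mem hp.2, if_pos rfl]

theorem IsLayered.gradedPart_le {J : ℕ → ℕ → Submodule k (MvPolynomial (Fin m) k)}
    (hJ : IsLayered (mulX k m) (homogeneousSubmodule (Fin m) k) J)
    {a : Ideal (MvPolynomial (Fin m) k)} (ha : ∀ t, gradedPart a t ≤ J 0 t) (t : ℕ) :
    ∀ l ≤ t, gradedPart a (t - l) ≤ J l t := by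
  intro l
  induction l generalizing t with
  | zero => exact fun _ => ha t
  | succ l ih =>
    intro hl
    obtain ⟨t, rfl⟩ : ∃ s, t = s + 1 := ⟨t - 1, by omega⟩
    rw [Nat.add_sub_add_right]
    exact (ih t (by omega)).trans (hJ.le_succ l t)

theorem IsLayered.isGradedFamily {J : ℕ → ℕ → Submodule k (MvPolynomial (Fin m) k)}
    (hJ : IsLayered (mulX k m) (homogeneousSubmodule (Fin m) k) J) : IsGradedFamily (J 0) :=
  ⟨fun t => hJ.le t 0 (Nat.zero_le t), fun t v p hp => hJ.X_mem 0 t v p hp⟩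

/-- The initial lex segment whose size is the codimension of the ideal of powers in a space that
is at least as large. -/
structure IsInitOf (e : Fin c → ℕ) (t : ℕ) (U : Submodule k (MvPolynomial (Fin m) k))
    (S : Finset (Fin m →₀ ℕ)) : Prop where
  isInit : IsInit (capMon e m t) S
  card_add : S.card + hilb (powerIdeal k m e) t = Module.finrank k U

theorem exists_isInitOf {e : Fin c → ℕ} {t : ℕ} {U : Submodule k (MvPolynomial (Fin m) k)}
    (h1 : hilb (powerIdeal k m e) t ≤ Module.finrank k U)
    (h2 : U ≤ homogeneousSubmodule (Fin m) k t) : ∃ S, IsInitOf e t U S := by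
  have h3 : Module.finrank k U ≤ hilb (⊤ : Ideal (MvPolynomial (Fin m) k)) t :=
    Submodule.finrank_mono fun p hp => ⟨trivial, h2 hp⟩
  rw [← hilb_powerIdeal_add_card e t] at h3
  obtain ⟨S, hS, hc⟩ := exists_isInit_card (capMon e m t)
    (r := Module.finrank k U - hilb (powerIdeal k m e) t) (by omega)
  exact ⟨S, hS, by omega⟩

theorem IsInitOf.subset {e : Fin c → ℕ} {t : ℕ} {U U' : Submodule k (MvPolynomial (Fin m) k)}
    {S S' : Finset (Fin m →₀ ℕ)} (h : IsInitOf e t U S) (h' : IsInitOf e t U' S')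
    (hle : Module.finrank k U ≤ Module.finrank k U') : S ⊆ S' :=
  h.isInit.subset_of_card_le h'.isInit (by have := h.card_add; have := h'.card_add; omega)

theorem LexGrowth.capShadow_subset {e : Fin c → ℕ} {a : Ideal (MvPolynomial (Fin m) k)}
    (hLG : LexGrowth e a) {t : ℕ} {U U' : Submodule k (MvPolynomial (Fin m) k)}
    {S S' : Finset (Fin m →₀ ℕ)} (h : IsInitOf e t U S) (h' : IsInitOf e (t + 1) U' S')
    (hU : gradedPart a t ≤ U) (hUt : U ≤ homogeneousSubmodule (Fin m) k t)
    (hU' : gradedPart a (t + 1) ≤ U') (hUt' : U' ≤ homogeneousSubmodule (Fin m) k (t + 1))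
    (hX : ∀ p ∈ U, ∀ v, X v * p ∈ U') : capShadow e m t S ⊆ S' := by
  refine (isInit_capShadow h.isInit).subset_of_card_le h'.isInit ?_
  have := hLG t U U' hU hUt hU' hUt' hX S h.isInit h.card_add.le
  rw [← h'.card_add] at this
  omega

end IdealLayers

/-! ### Lifting the conjectures from a hyperplane section -/

section Lift

variable {k : Type u} [Field k] {m c : ℕ}

theorem headMap_layerSeqs (J : ℕ → ℕ → Submodule k (MvPolynomial (Fin m) k)) (t : ℕ) :
    (layerSeqs J t).map (headMap k _) = J 0 t := by
  ext p
  constructor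
  · rintro ⟨q, hq, rfl⟩
    exact mem_seqs.1 hq 0
  · intro hp
    exact ⟨_, single_mem_seqs (J := fun l => J l t) hp, by rw [headMap_apply, Pi.single_eq_same]⟩

/-- The initial lex segments of the layers of a family. -/
theorem LexGrowth.exists_layerInit {e : Fin c → ℕ} {a : Ideal (MvPolynomial (Fin m) k)}
    (hab : ∀ t, hilb a t = hilb (powerIdeal k m e) t)
    {J : ℕ → ℕ → Submodule k (MvPolynomial (Fin m) k)}
    (hJ : IsLayered (mulX k m) (homogeneousSubmodule (Fin m) k) J)
    (haJ : ∀ t, gradedPart a t ≤ J 0 t) :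
    ∃ S : ℕ → ℕ → Finset (Fin m →₀ ℕ), ∀ t, ∀ l ≤ t, IsInitOf e (t - l) (J l t) (S l t) := by
  have h : ∀ l t, ∃ S, l ≤ t → IsInitOf e (t - l) (J l t) S := by
    intro l t
    by_cases hl : l ≤ t
    · have := hJ.finite l t
      obtain ⟨S, hS⟩ := exists_isInitOf (e := e) (t := t - l) (U := J l t)
        (by rw [← hab]; exact Submodule.finrank_mono (hJ.gradedPart_le haJ t l hl)) (hJ.le t l hl)
      exact ⟨S, fun _ => hS⟩
    · exact ⟨∅, fun h => absurd h hl⟩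
  choose S hS using h
  exact ⟨S, fun t l => hS l t⟩

theorem card_glue_add (hcm : c ≤ m) {e : Fin c → ℕ}
    {J : ℕ → ℕ → Submodule k (MvPolynomial (Fin m) k)}
    (hJ : IsLayered (mulX k m) (homogeneousSubmodule (Fin m) k) J)
    {S : ℕ → ℕ → Finset (Fin m →₀ ℕ)} (hS : ∀ t, ∀ l ≤ t, IsInitOf e (t - l) (J l t) (S l t))
    (t : ℕ) : (glue e t fun l => S l t).card + hilb (powerIdeal k (m + 1) e) t =
      Module.finrank k (layerSeqs J t) := by
  rw [card_glue hcm fun l hl => (hS t l hl).isInit.subset, hJ.finrank_layerSeqs,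
    hilb_powerIdeal_succ k hcm, ← Finset.sum_add_distrib]
  refine Finset.sum_congr rfl fun l hl => ?_
  exact (hS t l (Nat.lt_succ_iff.1 (Finset.mem_range.1 hl))).card_add

/-- The Eisenbud–Green–Harris property lifts from a hyperplane section: replace the layers of an
ideal by initial lex segments and apply the theorem of Clements and Lindström. -/
theorem LexGrowth.lift (hcm : c ≤ m) {e : Fin c → ℕ} (he : Monotone e)
    {a : Ideal (MvPolynomial (Fin (m + 1)) k)} (ha : IsHomogeneousIdeal a)
    (hab : ∀ t, hilb a t = hilb (powerIdeal k (m + 1) e) t)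
    (hab' : ∀ t, hilb (a.map (modLastVars k (m + 1) m)) t = hilb (powerIdeal k m e) t)
    (h : LexGrowth e (a.map (modLastVars k (m + 1) m))) : LexGrowth e a := by
  refine lexGrowth_of_hilbertPoset_subset he ha hab ((hilbertPoset_subset_iff hab).2 ?_)
  intro I hI haI
  obtain ⟨L, hL, heq⟩ := exists_lexSegment_hilb_eq (k := k) (n := m + 1) (e := e) (H := hilb I)
    (fun t => hab t ▸ hilb_mono haI t) (fun t => hilb_mono le_top t) (fun t T hT hc => by
      have hJ := isLayered_idealLayers I
      have haJ := map_modLastVars_le_idealLayers ha haI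
      obtain ⟨S, hS⟩ := exists_layerInit hab' hJ haJ
      have hcard := card_glue_add hcm hJ hS
      simp only [finrank_layerSeqs_idealLayers] at hcard
      have hsub : ∀ t, (glue e t fun l => S l t) ⊆ capMon e (m + 1) t := fun t u hu =>
        (mem_glue.1 hu).1
      -- the initial segments of the sizes of the layers glue to a set that is closed under shadows,
      -- to which the Clements–Lindström theorem applies
      have h1 := card_capShadow_le he (hsub t) hT (by have := hcard t; omega)
      have h2 : capShadow e (m + 1) t (glue e t fun l => S l t) ⊆ glue e (t + 1) fun l => S l (t + 1) := by
        intro q hq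
        obtain ⟨hq, u, hu, v, rfl⟩ := mem_capShadow.1 hq
        obtain ⟨hu, huS⟩ := mem_glue.1 hu
        have hl := ((initExp_mem_capMon hcm).1 hu).1
        have hl' := ((initExp_mem_capMon hcm).1 hq).1
        have hq' := ((initExp_mem_capMon hcm).1 hq).2
        refine mem_glue.2 ⟨hq, ?_⟩
        rw [← snocExp_initExp u] at hq' hl' ⊢
        generalize u (Fin.last m) = l at *
        generalize initExp u = w at *
        cases v using Fin.lastCases with
        | last =>
          rw [snocExp_add_last, initExp_snocExp, snocExp_last]
          have hS' := hS (t + 1) (l + 1) (by omega)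
          rw [Nat.add_sub_add_right] at hS'
          have := hJ.finite (l + 1) (t + 1)
          exact (hS t l hl).subset hS' (Submodule.finrank_mono (hJ.le_succ l t)) huS
        | cast v =>
          rw [snocExp_add_castSucc, initExp_snocExp, snocExp_last] at *
          have hS' := hS (t + 1) l (by omega)
          have ht : t + 1 - l = t - l + 1 := by omega
          have h1 := hJ.gradedPart_le haJ (t + 1) l (by omega)
          have h2 := hJ.le (t + 1) l (by omega)
          rw [ht] at hS' h1 h2 hq'
          refine h.capShadow_subset (hS t l hl) hS' (hJ.gradedPart_le haJ t l hl) (hJ.le t l hl)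
            h1 h2 (fun p hp v => hJ.X_mem l t v p hp) (mem_capShadow.2 ⟨hq', w, huS, v, rfl⟩)
      have h3 := Finset.card_le_card h2
      have := hcard (t + 1)
      omega)
  exact ⟨L ⊔ powerIdeal k (m + 1) e, (IsMonomialIdeal.sup hL.1
    (isMonomialIdeal_powerIdeal e)).isHomogeneousIdeal, le_sup_right, fun t => (heq t).symm⟩

/-- The replacement of the last variable by another one preserves the sum of a lex-segment ideal
and of an ideal of powers of the other variables. -/
theorem IsLexSegment.monomial_mem_of_last (hcm : c ≤ m) {e : Fin c → ℕ}
    {L : Ideal (MvPolynomial (Fin (m + 1)) k)} (hL : IsLexSegment L) {r : Fin (m + 1) →₀ ℕ}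
    (v : Fin m)
    (h : monomial (r + Finsupp.single (Fin.last m) 1) (1 : k) ∈ L ⊔ powerIdeal k (m + 1) e) :
    monomial (r + Finsupp.single v.castSucc 1) (1 : k) ∈ L ⊔ powerIdeal k (m + 1) e := by
  have hb := isMonomialIdeal_powerIdeal (k := k) (n := m + 1) e
  rw [IsMonomialIdeal.monomial_mem_sup hL.1 hb] at h ⊢
  rcases h with h | h
  · left
    refine hL.2 _ _ (by rw [degree_add_single, degree_add_single]) ?_ h
    refine lex_lt_iff.2 ⟨v.castSucc, fun j hj => ?_, ?_⟩
    · simp [hj.ne, (hj.trans (Fin.castSucc_lt_last v)).ne]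
    · simp [(Fin.castSucc_lt_last v).ne]
  · right
    rw [monomial_mem_powerIdeal_iff] at h ⊢
    intro h'
    refine h (mem_capMon.2 ⟨rfl, fun i j hij => ?_⟩)
    have h1 := (mem_capMon.1 h').2 i j hij
    have hi : i ≠ Fin.last m := by
      rintro rfl
      have := j.2
      rw [Fin.val_last] at hij
      omega
    rw [Finsupp.add_apply, Finsupp.single_eq_of_ne hi, add_zero]
    rw [Finsupp.add_apply] at h1
    omega

theorem layerCoeff_divMonomial (l : ℕ) (p : MvPolynomial (Fin (m + 1)) k) :
    layerCoeff k m l (p.divMonomial (Finsupp.single (Fin.last m) 1)) =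
      layerCoeff k m (l + 1) p := by
  ext w
  rw [coeff_layerCoeff, coeff_divMonomial, coeff_layerCoeff,
    add_comm (Finsupp.single _ _), snocExp_add_last]

/-- An upper bound for the Koszul ranks of a lex-plus-powers ideal, which is attained because the
ideal is closed under the replacement of the last variable by another one. -/
theorem IsLexSegment.polyRank_le (hcm : c ≤ m) (e : Fin c → ℕ)
    {L : Ideal (MvPolynomial (Fin (m + 1)) k)} (hL : IsLexSegment L) (t i : ℕ) :
    polyRank (gradedPart (L ⊔ powerIdeal k (m + 1) e) t) (i + 1) ≤
      m.choose i * hilb (L ⊔ powerIdeal k (m + 1) e) t +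
        polyRank ((gradedPart (L ⊔ powerIdeal k (m + 1) e) t).map (layerCoeff k m 0)) (i + 1) := by
  have hQ := IsMonomialIdeal.sup hL.1 (isMonomialIdeal_powerIdeal (k := k) (n := m + 1) e)
  rw [polyRank_eq_kRank_layers]
  refine (kRank_seqOp_le mulX_comm _ ?_ i).trans (le_of_eq ?_)
  · rintro _ ⟨p, hp, rfl⟩ v
    refine ⟨X v.castSucc * p.divMonomial (Finsupp.single (Fin.last m) 1), ?_, ?_⟩
    · have key : ∀ u, coeff u (X v.castSucc * p.divMonomial (Finsupp.single (Fin.last m) 1)) ≠ 0 →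
          ∃ r, u = r + Finsupp.single v.castSucc 1 ∧
            coeff (r + Finsupp.single (Fin.last m) 1) p ≠ 0 := by
        intro u hu
        rw [coeff_X_mul', coeff_divMonomial] at hu
        split_ifs at hu with h
        · refine ⟨u - Finsupp.single v.castSucc 1, (tsub_add_cancel_of_le ?_).symm, ?_⟩
          · rw [Finsupp.mem_support_iff] at h
            rw [Finsupp.single_le_iff]
            exact Nat.one_le_iff_ne_zero.2 h
          · rwa [add_comm (Finsupp.single _ _)] at hu
        · exact absurd rfl hu
      refine ⟨hQ.mem_iff.2 fun u hu => ?_, fun u hu => ?_⟩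
      · obtain ⟨r, rfl, hr⟩ := key u hu
        exact hL.monomial_mem_of_last hcm v (hQ.mem_iff.1 hp.1 _ hr)
      · obtain ⟨r, rfl, hr⟩ := key u hu
        have := hp.2 hr
        rw [Pi.one_def, ← Finsupp.degree_eq_weight_one, degree_add_single] at this ⊢
        exact this
    · funext l
      rw [layers_apply, layerCoeff_X_castSucc_mul, layerCoeff_divMonomial]
      rfl
  · rw [← (Submodule.equivMapOfInjective _ layers_injective _).finrank_eq, ← Submodule.map_comp]
    rfl

section Compare

variable (hcm : c ≤ m) {e : Fin c → ℕ} {a : Ideal (MvPolynomial (Fin m) k)}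
  (hab : ∀ t, hilb a t = hilb (powerIdeal k m e) t) (h : LexGrowth e a)
  {J : ℕ → ℕ → Submodule k (MvPolynomial (Fin m) k)}
  (hJ : IsLayered (mulX k m) (homogeneousSubmodule (Fin m) k) J)
  (haJ : ∀ t, gradedPart a t ≤ J 0 t)
  {L : Ideal (MvPolynomial (Fin (m + 1)) k)} (hL : IsLexSegment L)
  {L₀ : Ideal (MvPolynomial (Fin m) k)} (hL₀ : IsLexSegment L₀)

include hcm h hJ haJ in
theorem isStableLex_glue {t : ℕ} (hst : ∀ a v, ∀ x ∈ J (a + 1) t, mulX k m v x ∈ J a t)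
    {S : ℕ → ℕ → Finset (Fin m →₀ ℕ)} (hS : ∀ t, ∀ l ≤ t, IsInitOf e (t - l) (J l t) (S l t)) :
    IsStableLex (capFn e (t + 1)) Finset.univ t (Fin.last m) (glue e t fun l => S l t) := by
  refine ⟨fun u hu => ?_, fun u hu hz v _ hvz hv => ?_, fun u hu q hq huq hlt => ?_⟩
  · rw [← capMon_eq_stdMon e (Nat.lt_succ_self t)]
    exact (mem_glue.1 hu).1
  · obtain ⟨v, rfl⟩ := Fin.exists_castSucc_eq.2 hvz
    obtain ⟨huc, huS⟩ := mem_glue.1 hu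
    obtain ⟨l, hl⟩ : ∃ l, u (Fin.last m) = l + 1 := ⟨u (Fin.last m) - 1, by omega⟩
    have hu' : u = snocExp (initExp u) l + Finsupp.single (Fin.last m) 1 := by
      rw [snocExp_add_last, ← hl, snocExp_initExp]
    have hlt := ((initExp_mem_capMon hcm).1 huc).1
    have huc' := ((initExp_mem_capMon hcm).1 huc).2
    rw [hl] at huS hlt huc'
    have hu'' : u - Finsupp.single (Fin.last m) 1 + Finsupp.single v.castSucc 1 =
        snocExp (initExp u + Finsupp.single v 1) l := by
      rw [← snocExp_add_castSucc]
      congr 1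
      conv_lhs => rw [hu']
      rw [add_tsub_cancel_right]
    rw [hu'', snocExp_mem_glue (S := fun l => S l t) (l := l) (t := t) hcm
      (hS t l (by omega)).isInit.subset (by omega)]
    have hSl := hS t l (by omega)
    have h1 := hJ.gradedPart_le haJ t l (by omega)
    have h2 := hJ.le t l (by omega)
    rw [show t - l = t - (l + 1) + 1 by omega] at hSl h1 h2
    refine h.capShadow_subset (hS t (l + 1) hlt) hSl (hJ.gradedPart_le haJ t (l + 1) hlt)
      (hJ.le t (l + 1) hlt) h1 h2 (fun p hp v => hst l v p hp)
      (mem_capShadow.2 ⟨mem_capMon.2 ⟨?_, fun i j hij => ?_⟩, initExp u, huS, v, rfl⟩)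
    · rw [degree_add_single, (mem_capMon.1 huc').1]
    · rw [Finsupp.add_apply, Finsupp.single_apply]
      split_ifs with hvi
      · subst hvi
        have hvc : (v.castSucc : ℕ) < c := by
          rw [Fin.val_castSucc, hij]
          exact j.2
        rw [capFn, dif_pos hvc] at hv
        have hjv : (⟨(v.castSucc : ℕ), hvc⟩ : Fin c) = j := Fin.ext hij
        rw [hjv] at hv
        exact hv
      · exact (mem_capMon.1 huc').2 i j hij
  · rw [← capMon_eq_stdMon e (Nat.lt_succ_self t)] at hq
    obtain ⟨huc, huS⟩ := mem_glue.1 hu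
    have hqt := (initExp_mem_capMon hcm).1 hq
    refine mem_glue.2 ⟨hq, ?_⟩
    rw [← huq] at hqt ⊢
    refine (hS t _ hqt.1).isInit.up _ huS _ hqt.2 ?_
    rwa [← toLex_snocExp_lt_iff (u (Fin.last m)), snocExp_initExp, huq, snocExp_initExp]

include hcm hab h hJ haJ hL hL₀ in
/-- The bottom layer of a lex-plus-powers ideal is contained in the lex-plus-powers ideal with the
Hilbert function of the bottom layer of a stable family. -/
theorem map_layerCoeff_zero_le {t : ℕ}
    (hst : ∀ a v, ∀ x ∈ J (a + 1) t, mulX k m v x ∈ J a t)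
    (ht : Module.finrank k (layerSeqs J t) = hilb (L ⊔ powerIdeal k (m + 1) e) t)
    (ht₀ : hilb (L₀ ⊔ powerIdeal k m e) t = Module.finrank k (J 0 t)) :
    (gradedPart (L ⊔ powerIdeal k (m + 1) e) t).map (layerCoeff k m 0) ≤
      gradedPart (L₀ ⊔ powerIdeal k m e) t := by
  classical
  have hb := isMonomialIdeal_powerIdeal (k := k) (n := m) e
  have hb' := isMonomialIdeal_powerIdeal (k := k) (n := m + 1) e
  have hQ := IsMonomialIdeal.sup hL.1 hb'
  have hP := IsMonomialIdeal.sup hL₀.1 hb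
  rintro _ ⟨p, hp, rfl⟩
  have hhom := layerCoeff_homogeneous hp.2 (Nat.zero_le t)
  refine ⟨hP.mem_iff.2 fun w hw => ?_, hhom⟩
  have hwt : w.degree = t := by
    have := hhom hw
    rwa [Pi.one_def, ← Finsupp.degree_eq_weight_one] at this
  rw [coeff_layerCoeff] at hw
  have hwQ := hQ.mem_iff.1 hp.1 _ hw
  rw [IsMonomialIdeal.monomial_mem_sup hL₀.1 hb]
  rw [IsMonomialIdeal.monomial_mem_sup hL.1 hb'] at hwQ
  by_cases hwc : w ∈ capMon e m t
  swap
  · right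
    rwa [monomial_mem_powerIdeal_iff, hwt]
  left
  have hwc' : snocExp w 0 ∈ capMon e (m + 1) t :=
    (snocExp_mem_capMon hcm).2 ⟨Nat.zero_le t, hwc⟩
  replace hwQ : monomial (snocExp w 0) (1 : k) ∈ L := by
    refine hwQ.resolve_right fun h => ?_
    rw [monomial_mem_powerIdeal_iff, degree_snocExp, hwt] at h
    exact h hwc'
  obtain ⟨S, hS⟩ := LexGrowth.exists_layerInit hab hJ haJ
  have hcard := card_glue_add hcm hJ hS t
  rw [ht, hilb_sup_powerIdeal hL.1] at hcard
  have hst' := isStableLex_glue hcm h hJ haJ hst hS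
  have hinit := hL.isInit e t
  have hmem := hst'.mem_of_apply_eq_zero (fun i _ => Fin.le_last i)
    (by rwa [capMon_eq_stdMon e (Nat.lt_succ_self t)] at hinit) (by
      rw [← capMon_eq_stdMon e (Nat.lt_succ_self t)]
      omega) (w := snocExp w 0)
    (by
      rw [← capMon_eq_stdMon e (Nat.lt_succ_self t)]
      exact Finset.mem_filter.2 ⟨hwc', hwQ⟩) (snocExp_last w 0)
  have hwS := (snocExp_mem_glue (S := fun l => S l t) (l := 0) (t := t) hcm
    (hS t 0 (Nat.zero_le t)).isInit.subset (Nat.zero_le t)).1 hmem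
  have h0 := (hS t 0 (Nat.zero_le t)).card_add
  rw [Nat.sub_zero, ← ht₀, hilb_sup_powerIdeal hL₀.1] at h0
  have hsub := (hS t 0 (Nat.zero_le t)).isInit.subset_of_card_le (hL₀.isInit e t) (by omega)
  exact (Finset.mem_filter.1 (hsub hwS)).2

end Compare

end Lift

section LiftBetti

variable {k : Type u} [Field k] {n m c : ℕ}

theorem kRank_zero {V : Type*} [AddCommGroup V] [Module k V] (X : Fin n → Module.End k V)
    (M : Submodule k V) : kRank X M 0 = 0 := by
  have : (chains n M 0).map (kosz X) = ⊥ := by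
    rw [eq_bot_iff]
    rintro _ ⟨φ, hφ, rfl⟩
    rw [Submodule.mem_bot]
    funext S
    rw [kosz_apply_apply]
    refine Finset.sum_eq_zero fun w _ => ?_
    rw [(mem_chains.1 hφ).2 _ (Finset.card_ne_zero_of_mem (Finset.mem_insert_self w S)), map_zero,
      smul_zero]
  rw [kRank, this, finrank_bot]

theorem polyRank_zero (U : Submodule k (MvPolynomial (Fin n) k)) : polyRank U 0 = 0 :=
  kRank_zero _ _

theorem gradedBetti_le_of_polyRank_le {I Q : Ideal (MvPolynomial (Fin n) k)}
    (hH : ∀ t, hilb I t = hilb Q t)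
    (h0 : ∀ i, polyRank (gradedPart Q 0) i ≤ polyRank (gradedPart I 0) i)
    (h : ∀ t i, polyRank (gradedPart Q t) (i + 1) + polyRank (gradedPart Q (t + 1)) i ≤
      polyRank (gradedPart I t) (i + 1) + polyRank (gradedPart I (t + 1)) i) (i j : ℕ) :
    gradedBetti I i j ≤ gradedBetti Q i j := by
  rcases lt_trichotomy i j with hij | rfl | hij
  · obtain ⟨t, rfl⟩ : ∃ t, j = t + 1 + i := ⟨j - i - 1, by omega⟩
    have h1 := gradedBetti_add I i t
    have h2 := gradedBetti_add Q i t
    rw [hH] at h1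
    have := h t i
    omega
  · have h1 := gradedBetti_zero_add I i
    have h2 := gradedBetti_zero_add Q i
    rw [hH] at h1
    have := h0 i
    omega
  · rw [gradedBetti_eq_zero I hij]
    exact Nat.zero_le _

theorem polyRank_le_of_gradedBetti_le {I Q : Ideal (MvPolynomial (Fin n) k)}
    (hH : ∀ t, hilb I t = hilb Q t) (h : ∀ i j, gradedBetti I i j ≤ gradedBetti Q i j) :
    (∀ i, polyRank (gradedPart Q 0) i ≤ polyRank (gradedPart I 0) i) ∧
    ∀ t i, polyRank (gradedPart Q t) (i + 1) + polyRank (gradedPart Q (t + 1)) i ≤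
      polyRank (gradedPart I t) (i + 1) + polyRank (gradedPart I (t + 1)) i := by
  refine ⟨fun i => ?_, fun t i => ?_⟩
  · have h1 := gradedBetti_zero_add I i
    have h2 := gradedBetti_zero_add Q i
    rw [hH] at h1
    have := h i i
    omega
  · have h1 := gradedBetti_add I i t
    have h2 := gradedBetti_add Q i t
    rw [hH] at h1
    have := h i (t + 1 + i)
    omega

/-- The lex-plus-powers property lifts from a hyperplane section: after a degeneration to stable
layers, the Koszul ranks of an ideal are bounded below in terms of its Hilbert function and of its
bottom layer, with equality for lex-plus-powers ideals. -/
theorem LexBetti.lift (hcm : c ≤ m) {e : Fin c → ℕ}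
    {a : Ideal (MvPolynomial (Fin (m + 1)) k)} (ha : IsHomogeneousIdeal a)
    (hab' : ∀ t, hilb (a.map (modLastVars k (m + 1) m)) t = hilb (powerIdeal k m e) t)
    (h : LexGrowth e (a.map (modLastVars k (m + 1) m)))
    (hB : LexBetti e (a.map (modLastVars k (m + 1) m))) : LexBetti e a := by
  intro I L hI haI hL hH
  set b := a.map (modLastVars k (m + 1) m) with hb
  have hbh : ∀ p ∈ b, ∀ t, homogeneousComponent t p ∈ b := by
    intro p hp t
    obtain ⟨q, hq, rfl⟩ := (Ideal.mem_map_iff_of_surjective _ modLastVars_surjective).1 hp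
    rw [modLastVars_eq_layerCoeff, ← layerCoeff_zero_homogeneousComponent,
      ← modLastVars_eq_layerCoeff]
    exact Ideal.mem_map_of_mem _ (isHomogeneousIdeal_iff.1 ha q hq t)
  set Q := L ⊔ powerIdeal k (m + 1) e with hQ
  -- `I₀` is the bottom layer of a degeneration of `I` that is stable up to degree `N`, and `P` is the
  -- lex-plus-powers ideal with the Hilbert function of `I₀`
  have key : ∀ N, ∃ I₀ P : Ideal (MvPolynomial (Fin m) k),
      (∀ t ≤ N, ∀ i, m.choose i * hilb I t + polyRank (gradedPart I₀ t) (i + 1) ≤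
        polyRank (gradedPart I t) (i + 1)) ∧
      (∀ t ≤ N, ∀ i, polyRank (gradedPart Q t) (i + 1) ≤
        m.choose i * hilb I t + polyRank (gradedPart P t) (i + 1)) ∧
      (∀ i, polyRank (gradedPart P 0) i ≤ polyRank (gradedPart I₀ 0) i) ∧
      ∀ t i, polyRank (gradedPart P t) (i + 1) + polyRank (gradedPart P (t + 1)) i ≤
        polyRank (gradedPart I₀ t) (i + 1) + polyRank (gradedPart I₀ (t + 1)) i := by
    intro N
    obtain ⟨J, hJ, hJd, hJr, hJ0, hJs⟩ := (isLayered_idealLayers I).exists_stable mulX_comm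
      mulX_mem_homogeneous N
    have haJ : ∀ t, gradedPart b t ≤ J 0 t := fun t =>
      (map_modLastVars_le_idealLayers ha haI t).trans (hJ0 t)
    have hfam := hJ.isGradedFamily
    have hbI₀ : b ≤ familyIdeal (J 0) hfam := by
      refine le_of_gradedPart_le (isHomogeneousIdeal_iff.2 hbh) fun t => ?_
      rw [gradedPart_familyIdeal]
      exact haJ t
    obtain ⟨L₀, hL₀, hL₀h⟩ := h.exists_lexSegment hab' hbI₀
    refine ⟨familyIdeal (J 0) hfam, L₀ ⊔ powerIdeal k m e, fun t ht i => ?_, fun t ht i => ?_,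
      polyRank_le_of_gradedBetti_le (fun t => (hL₀h t).symm)
        (hB _ L₀ (isHomogeneousIdeal_familyIdeal hfam) hbI₀ hL₀ fun t => (hL₀h t).symm)⟩
    · have := hJ.finiteDimensional_layerSeqs t
      have h1 := kRank_seqOp_ge (mulX k m) (layerSeqs J t) i
      rw [headMap_layerSeqs, hJd, finrank_layerSeqs_idealLayers] at h1
      rw [gradedPart_familyIdeal]
      exact h1.trans ((hJr t (i + 1)).trans (kRank_idealLayers_le I t (i + 1)))
    · refine (hL.polyRank_le hcm e t i).trans ?_
      rw [hH]
      refine Nat.add_le_add_left (kRank_mono _ (map_layerCoeff_zero_le hcm hab' h hJ haJ hL hL₀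
        (fun a v => hJs t ht a v) ?_ ?_) _) _
      · rw [hJd, finrank_layerSeqs_idealLayers, hH]
      · rw [hL₀h, hilb_familyIdeal]
  refine gradedBetti_le_of_polyRank_le hH (fun i => ?_) fun t i => ?_
  · obtain ⟨I₀, P, h1, h2, h3, -⟩ := key 0
    cases i with
    | zero => rw [polyRank_zero]; exact Nat.zero_le _
    | succ i =>
      have := h1 0 le_rfl i
      have := h2 0 le_rfl i
      have := h3 (i + 1)
      omega
  · obtain ⟨I₀, P, h1, h2, -, h4⟩ := key (t + 1)
    have e1 := h1 t (by omega) i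
    have e2 := h2 t (by omega) i
    have e3 := h4 t i
    cases i with
    | zero =>
      rw [polyRank_zero, polyRank_zero] at e3 ⊢
      omega
    | succ i =>
      have := h1 (t + 1) le_rfl i
      have := h2 (t + 1) le_rfl i
      omega

end LiftBetti

/-! ### Extension of the base field -/

section BaseChange

variable {k : Type u} [Field k] {K : Type v} [Field K] [Algebra k K] {n : ℕ}

section General

variable {V V' : Type*} [AddCommGroup V] [Module k V] [AddCommGroup V'] [Module K V']
  (ι : V →ₛₗ[algebraMap k K] V')

/-- A semilinear map that preserves linear independence, as the map from a vector space to its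
base change does. -/
def PreservesIndep : Prop :=
  ∀ (s : ℕ) (b : Fin s → V), LinearIndependent k b → LinearIndependent K (ι ∘ b)

/-- The span, over the larger field, of the image of a subspace. -/
def extSpan (U : Submodule k V) : Submodule K V' := Submodule.span K (ι '' U)

theorem preservesIndep_of_coord {S : Type*} {c : V →ₗ[k] (S → k)} (hc : Function.Injective c)
    {c' : V' →ₗ[K] (S → K)} (h : ∀ x s, c' (ι x) s = algebraMap k K (c x s)) :
    PreservesIndep ι := by
  intro r b hb
  rw [Fintype.linearIndependent_iff] at hb ⊢
  intro g hg
  let B := Module.Basis.ofVectorSpace k K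
  have key : ∀ β i, B.repr (g i) β = 0 := by
    intro β
    refine hb _ (hc ?_)
    funext s
    have h1 := congrFun (congrArg c' hg) s
    rw [map_sum, Finset.sum_apply, map_zero, Pi.zero_apply] at h1
    have h2 := congrArg (fun x => B.repr x β) h1
    simp only [map_smul, Pi.smul_apply, Function.comp_apply, h, smul_eq_mul, map_sum,
      map_zero] at h2
    rw [map_sum, map_zero, Finset.sum_apply, Pi.zero_apply]
    rw [Finsupp.finsetSum_apply] at h2
    refine Eq.trans (Finset.sum_congr rfl fun i _ => ?_) h2
    rw [map_smul, Pi.smul_apply, smul_eq_mul, mul_comm (g i), ← Algebra.smul_def, map_smul,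
      Finsupp.smul_apply, smul_eq_mul, mul_comm]
  intro i
  rw [← B.repr.map_eq_zero_iff]
  ext β
  exact key β i

variable {ι}

theorem finrank_extSpan (hι : PreservesIndep ι) (U : Submodule k V) [FiniteDimensional k U] :
    Module.finrank K (extSpan ι U) = Module.finrank k U := by
  let b := Module.finBasis k U
  have hb : LinearIndependent k (fun i => (b i : V)) :=
    b.linearIndependent.map' U.subtype (Submodule.ker_subtype U)
  have hspan : extSpan ι U = Submodule.span K (Set.range (ι ∘ fun i => (b i : V))) := by
    refine le_antisymm (Submodule.span_le.2 ?_) (Submodule.span_mono ?_)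
    · rintro _ ⟨x, hx, rfl⟩
      have hx' : x = ∑ i, b.repr ⟨x, hx⟩ i • (b i : V) := by
        have := congrArg U.subtype (b.sum_repr ⟨x, hx⟩)
        rw [map_sum] at this
        exact this.symm
      rw [hx', map_sum]
      refine Submodule.sum_mem _ fun i _ => ?_
      rw [map_smulₛₗ]
      exact Submodule.smul_mem _ _ (Submodule.subset_span ⟨i, rfl⟩)
    · rintro _ ⟨i, rfl⟩
      exact ⟨_, (b i).2, rfl⟩
  rw [hspan, finrank_span_eq_card (hι _ _ hb), Fintype.card_fin]

variable (ι n) in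
/-- The base change on the exterior algebra. -/
def extOnCoeff : (Finset (Fin n) → V) →ₛₗ[algebraMap k K] (Finset (Fin n) → V') where
  toFun φ S := ι (φ S)
  map_add' φ ψ := by
    funext S
    exact map_add ι _ _
  map_smul' a φ := by
    funext S
    exact map_smulₛₗ ι _ _

theorem extOnCoeff_apply (φ : Finset (Fin n) → V) (S : Finset (Fin n)) :
    extOnCoeff n ι φ S = ι (φ S) := rfl

theorem chains_extSpan (U : Submodule k V) (i : ℕ) :
    chains n (extSpan ι U) i = extSpan (extOnCoeff n ι) (chains n U i) := by
  classical
  refine le_antisymm (fun φ hφ => ?_) (Submodule.span_le.2 ?_)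
  · rw [mem_chains] at hφ
    rw [← Finset.univ_sum_single φ]
    refine Submodule.sum_mem _ fun S _ => ?_
    by_cases hS : S.card = i
    · have key : ∀ x ∈ extSpan ι U, (Pi.single S x : Finset (Fin n) → V') ∈
          extSpan (extOnCoeff n ι) (chains n U i) := by
        intro x hx
        induction hx using Submodule.span_induction with
        | mem x hx =>
          obtain ⟨y, hy, rfl⟩ := hx
          refine Submodule.subset_span ⟨Pi.single S y, mem_chains.2 ⟨fun T => ?_, fun T hT => ?_⟩, ?_⟩
          · by_cases hT : T = S
            · subst hT
              rwa [Pi.single_eq_same]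
            · rw [Pi.single_eq_of_ne hT]
              exact U.zero_mem
          · exact Pi.single_eq_of_ne (by rintro rfl; exact hT hS) _
          · funext T
            rw [extOnCoeff_apply]
            by_cases hT : T = S
            · subst hT
              rw [Pi.single_eq_same, Pi.single_eq_same]
            · rw [Pi.single_eq_of_ne hT, Pi.single_eq_of_ne hT, map_zero]
        | zero => rw [Pi.single_zero]; exact Submodule.zero_mem _
        | add x y _ _ hx hy => rw [Pi.single_add]; exact Submodule.add_mem _ hx hy
        | smul a x _ hx => rw [Pi.single_smul]; exact Submodule.smul_mem _ _ hx
      exact key _ (hφ.1 S)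
    · rw [hφ.2 S hS, Pi.single_zero]
      exact Submodule.zero_mem _
  · rintro _ ⟨φ, hφ, rfl⟩
    have hφ := mem_chains.1 hφ
    refine mem_chains.2 ⟨fun S => Submodule.subset_span ⟨_, hφ.1 S, rfl⟩, fun S hS => ?_⟩
    rw [extOnCoeff_apply, hφ.2 S hS, map_zero]

theorem kRank_extSpan (hι : PreservesIndep (extOnCoeff n ι)) {X : Fin n → Module.End k V}
    {Y : Fin n → Module.End K V'} (hXY : ∀ w x, ι (X w x) = Y w (ι x)) (U : Submodule k V)
    [FiniteDimensional k U] (i : ℕ) : kRank Y (extSpan ι U) i = kRank X U i := by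
  have hk : ∀ φ, kosz Y (extOnCoeff n ι φ) = extOnCoeff n ι (kosz X φ) := by
    intro φ
    funext S
    rw [kosz_apply_apply, extOnCoeff_apply, kosz_apply_apply, map_sum]
    refine Finset.sum_congr rfl fun w _ => ?_
    rw [extOnCoeff_apply, ← hXY, Units.smul_def, Units.smul_def, map_zsmul]
  have : (chains n (extSpan ι U) i).map (kosz Y) =
      extSpan (extOnCoeff n ι) ((chains n U i).map (kosz X)) := by
    rw [chains_extSpan, extSpan, Submodule.map_span, extSpan]
    congr 1
    ext ψ
    constructor
    · rintro ⟨_, ⟨φ, hφ, rfl⟩, rfl⟩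
      exact ⟨_, ⟨φ, hφ, rfl⟩, (hk φ).symm⟩
    · rintro ⟨_, ⟨φ, hφ, rfl⟩, rfl⟩
      exact ⟨_, ⟨φ, hφ, rfl⟩, hk φ⟩
  rw [kRank, this, finrank_extSpan hι, kRank]

end General

variable (k K n) in
/-- The base change of polynomials, as a semilinear map. -/
noncomputable def extPoly :
    MvPolynomial (Fin n) k →ₛₗ[algebraMap k K] MvPolynomial (Fin n) K where
  toFun := map (algebraMap k K)
  map_add' := map_add _
  map_smul' a p := by rw [smul_eq_C_mul, map_mul, map_C, smul_eq_C_mul]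

theorem extPoly_apply (p : MvPolynomial (Fin n) k) :
    extPoly k K n p = map (algebraMap k K) p := rfl

theorem preservesIndep_extPoly : PreservesIndep (extPoly k K n) := by
  refine preservesIndep_of_coord (S := Fin n →₀ ℕ) (c := LinearMap.pi fun u => lcoeff k u)
    (c' := LinearMap.pi fun u => lcoeff K u) _ (fun p q h => ?_) fun p u => ?_
  · ext u
    exact congrFun h u
  · exact coeff_map _ _ _

theorem preservesIndep_extOnCoeff_extPoly {m : ℕ} :
    PreservesIndep (extOnCoeff m (extPoly k K n)) := by
  refine preservesIndep_of_coord (S := Finset (Fin m) × (Fin n →₀ ℕ))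
    (c := LinearMap.pi fun s => lcoeff k s.2 ∘ₗ LinearMap.proj s.1)
    (c' := LinearMap.pi fun s => lcoeff K s.2 ∘ₗ LinearMap.proj s.1) _ (fun φ ψ h => ?_)
    fun φ s => ?_
  · funext S
    ext u
    exact congrFun h (S, u)
  · exact coeff_map _ _ _

theorem polyRank_extSpan (U : Submodule k (MvPolynomial (Fin n) k)) [FiniteDimensional k U]
    (i : ℕ) : polyRank (extSpan (extPoly k K n) U) i = polyRank U i := by
  refine kRank_extSpan preservesIndep_extOnCoeff_extPoly (fun w p => ?_) U i
  rw [mulX_apply, mulX_apply, extPoly_apply, extPoly_apply, map_mul, map_X]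

theorem extSpan_restrictSupport (T : Set (Fin n →₀ ℕ)) :
    extSpan (extPoly k K n) (restrictSupport k T) = restrictSupport K T := by
  refine le_antisymm (Submodule.span_le.2 ?_) ?_
  · rintro _ ⟨p, hp, rfl⟩
    rw [SetLike.mem_coe, mem_restrictSupport_iff] at hp ⊢
    exact (Finset.coe_subset.2 (support_map_subset _ p)).trans hp
  · rw [restrictSupport_eq_span]
    refine Submodule.span_mono ?_
    rintro _ ⟨u, hu, rfl⟩
    exact ⟨monomial u 1, (monomial_mem_restrictSupport _).2 (Or.inl hu), by
      rw [extPoly_apply, map_monomial, map_one]⟩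

end BaseChange

/-! ### Linear changes of coordinates -/

section Coordinates

variable {k : Type u} [Field k] {n : ℕ}

/-- The linear combinations of operators with coefficients in the columns of a matrix. -/
def linOp {V : Type*} [AddCommGroup V] [Module k V] (h : Matrix (Fin n) (Fin n) k)
    (X : Fin n → Module.End k V) (w : Fin n) : Module.End k V := ∑ i, h i w • X i

/-- The Koszul ranks are invariant under invertible linear substitutions of the operators. -/
theorem kRank_linOp {V : Type*} [AddCommGroup V] [Module k V] (h : Matrix (Fin n) (Fin n) k)
    (hh : h.det ≠ 0) (X : Fin n → Module.End k V) (M : Submodule k V) (i : ℕ) :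
    kRank (linOp h X) M i = kRank X M i := by
  revert X
  refine Matrix.diagonal_transvection_induction_of_det_ne_zero
    (fun h => ∀ X : Fin n → Module.End k V, kRank (linOp h X) M i = kRank X M i) h hh ?_ ?_ ?_
  · intro D hD X
    rw [Matrix.det_diagonal, Finset.prod_ne_zero_iff] at hD
    rw [← kRank_smul X (fun i => hD i (Finset.mem_univ i)) M i]
    congr 1
    funext w
    rw [linOp, Finset.sum_eq_single w]
    · rw [Matrix.diagonal_apply_eq]
    · intro j _ hj
      rw [Matrix.diagonal_apply_ne _ hj, zero_smul]
    · simp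
  · rintro ⟨v, j, hvj, a⟩ X
    refine Eq.trans ?_ (kRank_shear (X := X) (M := M) hvj (π := a • 1) (fun i _ => by simp)
      (fun x hx => M.smul_mem a hx) i)
    congr 1
    funext w
    have : linOp (Matrix.TransvectionStruct.toMatrix ⟨v, j, hvj, a⟩) X w =
        X w + if w = j then a • X v else 0 := by
      rw [linOp, Matrix.TransvectionStruct.toMatrix_mk, Matrix.transvection]
      simp only [Matrix.add_apply, add_smul, Finset.sum_add_distrib, Matrix.one_apply, ite_smul,
        one_smul, zero_smul, Finset.sum_ite_eq', Finset.mem_univ, if_true, Matrix.single_apply]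
      congr 1
      by_cases hw : w = j
      · subst hw
        simp
      · simp [hw, Ne.symm hw]
    rw [this]
    by_cases hw : w = j
    · subst hw
      rw [if_pos rfl, Function.update_self, mul_smul_comm, mul_one]
    · rw [if_neg hw, Function.update_of_ne hw, add_zero]
  · intro A B _ _ hA hB X
    rw [← hA X, ← hB (linOp A X)]
    congr 1
    funext w
    simp only [linOp, Matrix.mul_apply, Finset.smul_sum, Finset.sum_smul, smul_smul]
    rw [Finset.sum_comm]
    exact Finset.sum_congr rfl fun _ _ => Finset.sum_congr rfl fun _ _ => by rw [mul_comm]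

theorem changeCoords_X (g : GL (Fin n) k) (j : Fin n) :
    changeCoords g (X j) = ∑ i, C ((g : Matrix (Fin n) (Fin n) k) i j) * X i := by
  rw [changeCoords, aeval_X]

theorem changeCoords_mul (g h : GL (Fin n) k) (p : MvPolynomial (Fin n) k) :
    changeCoords g (changeCoords h p) = changeCoords (g * h) p := by
  have : (changeCoords g).comp (changeCoords h) = changeCoords (g * h) := by
    refine MvPolynomial.algHom_ext fun j => ?_
    rw [AlgHom.comp_apply, changeCoords_X, changeCoords_X, map_sum]
    simp only [map_mul, changeCoords_X, Units.val_mul, Matrix.mul_apply, map_sum, Finset.sum_mul,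
      Finset.mul_sum]
    rw [Finset.sum_comm]
    refine Finset.sum_congr rfl fun i _ => Finset.sum_congr rfl fun l _ => ?_
    rw [← algebraMap_eq, AlgHom.commutes]
    ring
  exact DFunLike.congr_fun this p

theorem changeCoords_one (p : MvPolynomial (Fin n) k) : changeCoords 1 p = p := by
  have : changeCoords (1 : GL (Fin n) k) = AlgHom.id k _ := by
    refine MvPolynomial.algHom_ext fun j => ?_
    rw [changeCoords_X, AlgHom.id_apply, Finset.sum_eq_single j]
    · simp
    · intro i _ hi
      simp [Matrix.one_apply_ne hi]
    · simp
  rw [this, AlgHom.id_apply]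

theorem changeCoords_inv (g : GL (Fin n) k) (p : MvPolynomial (Fin n) k) :
    changeCoords g (changeCoords g⁻¹ p) = p := by
  rw [changeCoords_mul, mul_inv_cancel, changeCoords_one]

theorem changeCoords_injective (g : GL (Fin n) k) : Function.Injective (changeCoords g) := by
  refine Function.LeftInverse.injective (g := changeCoords g⁻¹) fun p => ?_
  rw [changeCoords_mul, inv_mul_cancel, changeCoords_one]

theorem isHomogeneous_changeCoords (g : GL (Fin n) k) {p : MvPolynomial (Fin n) k} {t : ℕ}
    (hp : p.IsHomogeneous t) : (changeCoords g p).IsHomogeneous t := by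
  have := hp.aeval (fun j => ∑ i, C ((g : Matrix (Fin n) (Fin n) k) i j) * X i) (n := 1)
    fun j => IsHomogeneous.sum _ _ _ fun i _ => isHomogeneous_C_mul_X _ _
  rwa [one_mul] at this

theorem polyRank_map_changeCoords (g : GL (Fin n) k) (U : Submodule k (MvPolynomial (Fin n) k))
    (i : ℕ) : polyRank (U.map (changeCoords g).toLinearMap) i = polyRank U i := by
  rw [polyRank, polyRank, ← kRank_linOp (g⁻¹ : GL (Fin n) k).1
    (Matrix.isUnit_iff_isUnit_det _ |>.1 (g⁻¹ : GL (Fin n) k).isUnit).ne_zero (mulX k n) U i]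
  refine kRank_map (changeCoords_injective g) (fun w p => ?_) U i
  have : linOp (g⁻¹ : GL (Fin n) k).1 (mulX k n) w p = changeCoords g⁻¹ (X w) * p := by
    rw [linOp, LinearMap.sum_apply, changeCoords_X, Finset.sum_mul]
    refine Finset.sum_congr rfl fun i _ => ?_
    rw [LinearMap.smul_apply, mulX_apply, smul_eq_C_mul, mul_assoc]
  rw [this, AlgHom.toLinearMap_apply, map_mul, changeCoords_inv, mulX_apply,
    AlgHom.toLinearMap_apply]

end Coordinates

section Transfer

variable {k : Type u} [Field k] (K : Type v) [Field K] {n c : ℕ}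

theorem hilb_powerIdeal_eq (k : Type u) [Field k] (K : Type v) [Field K] (e : Fin c → ℕ) (t : ℕ) :
    hilb (powerIdeal K n e) t = hilb (powerIdeal k n e) t := by
  have h1 := hilb_powerIdeal_add_card (k := k) (n := n) e t
  have h2 := hilb_powerIdeal_add_card (k := K) (n := n) e t
  rw [hilb_top] at h1 h2
  omega

/-- The lex-segment ideal with the same monomials over a larger field. -/
theorem IsLexSegment.exists_extension {L : Ideal (MvPolynomial (Fin n) k)} (hL : IsLexSegment L) :
    ∃ L' : Ideal (MvPolynomial (Fin n) K), IsLexSegment L' ∧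
      ∀ u, monomial u (1 : K) ∈ L' ↔ monomial u (1 : k) ∈ L := by
  obtain ⟨T, hT⟩ : ∃ T : Set (Fin n →₀ ℕ), ∀ u, u ∈ T ↔ monomial u (1 : k) ∈ L :=
    ⟨{u | monomial u (1 : k) ∈ L}, fun _ => Iff.rfl⟩
  have hTadd : ∀ u ∈ T, ∀ v, u + Finsupp.single v 1 ∈ T := fun u hu v =>
    (hT _).2 (monomial_add_single_mem ((hT u).1 hu) v)
  have hmon : ∀ u, monomial u (1 : K) ∈ Ideal.span ((fun u => monomial u (1 : K)) '' T) ↔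
      monomial u (1 : k) ∈ L := fun u => (monomial_mem_span_iff hTadd).trans (hT u)
  refine ⟨_, ⟨⟨_, rfl⟩, fun u v huv hlt hu => ?_⟩, hmon⟩
  rw [hmon] at hu ⊢
  exact hL.2 u v huv hlt hu

variable [Algebra k K]

/-- The image of a homogeneous ideal, after an extension of the base field and a linear change of
coordinates, has the same Hilbert function and the same graded Betti numbers. -/
theorem exists_ideal_extension (g : GL (Fin n) K) {I : Ideal (MvPolynomial (Fin n) k)} :
    ∃ I' : Ideal (MvPolynomial (Fin n) K), IsHomogeneousIdeal I' ∧
      (∀ t, hilb I' t = hilb I t) ∧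
      (∀ t i, polyRank (gradedPart I' t) i = polyRank (gradedPart I t) i) ∧
      ∀ t, ∀ p ∈ gradedPart I t, changeCoords g (map (algebraMap k K) p) ∈ I' := by
  set U : ℕ → Submodule K (MvPolynomial (Fin n) K) := fun t =>
    (extSpan (extPoly k K n) (gradedPart I t)).map (changeCoords g).toLinearMap with hU
  have hspan : ∀ t, extSpan (extPoly k K n) (gradedPart I t) ≤ homogeneousSubmodule (Fin n) K t := by
    refine fun t => Submodule.span_le.2 ?_
    rintro _ ⟨p, hp, rfl⟩
    exact hp.2.map _
  have hX : ∀ t v, ∀ p ∈ extSpan (extPoly k K n) (gradedPart I t),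
      X v * p ∈ extSpan (extPoly k K n) (gradedPart I (t + 1)) := by
    intro t v p hp
    have : extSpan (extPoly k K n) (gradedPart I t) ≤
        (extSpan (extPoly k K n) (gradedPart I (t + 1))).comap (mulX K n v) := by
      refine Submodule.span_le.2 ?_
      rintro _ ⟨p, hp, rfl⟩
      refine Submodule.subset_span ⟨X v * p, (isGradedFamily_gradedPart I).X_mul t v p hp, ?_⟩
      rw [extPoly_apply, map_mul, map_X]
      rfl
    exact this hp
  have hfam : IsGradedFamily U := by
    refine ⟨fun t => ?_, fun t v => ?_⟩
    · rintro _ ⟨p, hp, rfl⟩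
      exact isHomogeneous_changeCoords g (hspan t hp)
    · rintro _ ⟨p, hp, rfl⟩
      refine ⟨changeCoords g⁻¹ (X v) * p, ?_, ?_⟩
      · rw [changeCoords_X, Finset.sum_mul]
        refine Submodule.sum_mem _ fun i _ => ?_
        rw [mul_assoc, ← smul_eq_C_mul]
        exact Submodule.smul_mem _ _ (hX t i p hp)
      · rw [AlgHom.toLinearMap_apply, map_mul, changeCoords_inv]
        rfl
  refine ⟨familyIdeal U hfam, isHomogeneousIdeal_familyIdeal hfam, fun t => ?_, fun t i => ?_,
    fun t p hp => ?_⟩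
  · rw [hilb_familyIdeal, hilb, ← finrank_extSpan (preservesIndep_extPoly (K := K)) (gradedPart I t)]
    have hinj : Function.Injective (changeCoords g).toLinearMap := changeCoords_injective g
    exact (Submodule.equivMapOfInjective _ hinj (extSpan (extPoly k K n) (gradedPart I t))).finrank_eq.symm
  · rw [gradedPart_familyIdeal, polyRank_map_changeCoords, polyRank_extSpan]
  · have : changeCoords g (map (algebraMap k K) p) ∈ gradedPart (familyIdeal U hfam) t := by
      rw [gradedPart_familyIdeal]
      exact ⟨_, Submodule.subset_span ⟨p, hp, rfl⟩, rfl⟩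
    exact this.1

theorem gradedPart_sup_extension {L : Ideal (MvPolynomial (Fin n) k)} (hL : IsMonomialIdeal L)
    {L' : Ideal (MvPolynomial (Fin n) K)} (hL' : IsMonomialIdeal L')
    (h : ∀ u, monomial u (1 : K) ∈ L' ↔ monomial u (1 : k) ∈ L) (e : Fin c → ℕ) (t : ℕ) :
    gradedPart (L' ⊔ powerIdeal K n e) t =
      extSpan (extPoly k K n) (gradedPart (L ⊔ powerIdeal k n e) t) := by
  have hb := isMonomialIdeal_powerIdeal (k := k) (n := n) e
  have hb' := isMonomialIdeal_powerIdeal (k := K) (n := n) e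
  rw [(hL.sup hb).gradedPart_eq, (hL'.sup hb').gradedPart_eq, extSpan_restrictSupport]
  congr 2
  ext u
  rw [mem_monFinset, mem_monFinset, IsMonomialIdeal.monomial_mem_sup hL hb,
    IsMonomialIdeal.monomial_mem_sup hL' hb', h, monomial_mem_powerIdeal_iff,
    monomial_mem_powerIdeal_iff]

/-- Both conjectures descend from a sequence that is obtained by an extension of the base field and
a linear change of coordinates. -/
theorem satisfies_of_extension (g : GL (Fin n) K) {e : Fin c → ℕ} (he : Monotone e)
    {f : Fin c → MvPolynomial (Fin n) k} (hf : ∀ i, (f i).IsHomogeneous (e i))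
    (hab : ∀ t, hilb (Ideal.span (Set.range f)) t = hilb (powerIdeal k n e) t)
    {f' : Fin c → MvPolynomial (Fin n) K}
    (hf' : ∀ i, f' i = changeCoords g (map (algebraMap k K) (f i)))
    (h : LexGrowth e (Ideal.span (Set.range f')) ∧ LexBetti e (Ideal.span (Set.range f'))) :
    SatisfiesEGH f e ∧ SatisfiesLPP f e := by
  rw [satisfies_iff he hf hab]
  have ha : IsHomogeneousIdeal (Ideal.span (Set.range f)) := by
    refine isHomogeneousIdeal_span ?_
    rintro _ ⟨i, rfl⟩
    exact ⟨e i, hf i⟩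
  have key : ∀ I : Ideal (MvPolynomial (Fin n) k), Ideal.span (Set.range f) ≤ I →
      ∃ I' : Ideal (MvPolynomial (Fin n) K), IsHomogeneousIdeal I' ∧
      Ideal.span (Set.range f') ≤ I' ∧ (∀ t, hilb I' t = hilb I t) ∧
      ∀ t i, polyRank (gradedPart I' t) i = polyRank (gradedPart I t) i := by
    intro I hI
    obtain ⟨I', h1, h2, h3, h4⟩ := exists_ideal_extension K g (I := I)
    refine ⟨I', h1, Ideal.span_le.2 ?_, h2, h3⟩
    rintro _ ⟨i, rfl⟩
    rw [hf']
    exact h4 (e i) _ ⟨hI (Ideal.subset_span ⟨i, rfl⟩), hf i⟩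
  refine ⟨lexGrowth_of_hilbertPoset_subset he ha hab ((hilbertPoset_subset_iff hab).2 ?_), ?_⟩
  · intro I hI haI
    obtain ⟨I', hI', haI', hh, -⟩ := key I haI
    obtain ⟨L, hL, heq⟩ := exists_lexSegment_hilb_eq (k := k) (n := n) (e := e) (H := hilb I)
      (fun t => hab t ▸ hilb_mono haI t) (fun t => hilb_mono le_top t) (fun t S hS hc => by
        have := h.1.of_ideal haI' t S hS (by rwa [hh, hilb_powerIdeal_eq k K])
        rwa [hh, hilb_powerIdeal_eq k K] at this)
    exact ⟨L ⊔ powerIdeal k n e, (IsMonomialIdeal.sup hL.1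
      (isMonomialIdeal_powerIdeal e)).isHomogeneousIdeal, le_sup_right, fun t => (heq t).symm⟩
  · intro I L hI haI hL hH
    obtain ⟨I', hI', haI', hh, hr⟩ := key I haI
    obtain ⟨L', hL', hLL'⟩ := hL.exists_extension K
    have hg := gradedPart_sup_extension K hL.1 hL'.1 hLL' e
    have hH' : ∀ t, hilb I' t = hilb (L' ⊔ powerIdeal K n e) t := by
      intro t
      rw [hh, hH, hilb, hilb, hg, finrank_extSpan preservesIndep_extPoly]
    obtain ⟨h1, h2⟩ := polyRank_le_of_gradedBetti_le hH' (h.2 I' L' hI' haI' hL' hH')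
    simp only [hr, hg, polyRank_extSpan] at h1 h2
    exact gradedBetti_le_of_polyRank_le hH h1 h2

end Transfer

/-! ### Regular sequences and Hilbert functions -/

section RegularOn

variable {R : Type*} [CommRing R]

/-- The elements of the list form a weakly regular sequence on `R ⧸ I`. -/
def RegularOn (I : Ideal R) : List R → Prop
  | [] => True
  | p :: ps => (∀ x, p * x ∈ I → x ∈ I) ∧ RegularOn (I ⊔ Ideal.span {p}) ps

theorem regularOn_append (I : Ideal R) (ps qs : List R) :
    RegularOn I (ps ++ qs) ↔ RegularOn I ps ∧ RegularOn (I ⊔ Ideal.ofList ps) qs := by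
  induction ps generalizing I with
  | nil => simp [RegularOn]
  | cons p ps ih =>
    rw [List.cons_append, RegularOn, RegularOn, ih, Ideal.ofList_cons, sup_assoc, and_assoc]

theorem regularOn_iff_getElem (I : Ideal R) (ps : List R) :
    RegularOn I ps ↔ ∀ (i : ℕ) (h : i < ps.length), ∀ x,
      ps[i] * x ∈ I ⊔ Ideal.ofList (ps.take i) → x ∈ I ⊔ Ideal.ofList (ps.take i) := by
  induction ps generalizing I with
  | nil => simp [RegularOn]
  | cons p ps ih =>
    rw [RegularOn, ih]
    constructor
    · rintro ⟨h0, h1⟩ i hi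
      cases i with
      | zero => simpa using h0
      | succ i =>
        have := h1 i (by simpa using hi)
        rw [sup_assoc, ← Ideal.ofList_cons] at this
        simpa using this
    · intro h
      have h0 := h 0 (by simp)
      rw [List.take_zero, Ideal.ofList_nil, sup_bot_eq] at h0
      refine ⟨h0, fun i hi => ?_⟩
      have := h (i + 1) (by simpa using hi)
      rw [sup_assoc, ← Ideal.ofList_cons]
      simpa using this

theorem isWeaklyRegular_iff_regularOn (ps : List R) :
    RingTheory.Sequence.IsWeaklyRegular R ps ↔ RegularOn ⊥ ps := by
  rw [regularOn_iff_getElem, RingTheory.Sequence.isWeaklyRegular_iff]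
  refine forall₂_congr fun i hi => ?_
  rw [isSMulRegular_quotient_iff_mem_of_smul_mem]
  simp [smul_eq_mul, Ideal.mul_top]

theorem RegularOn.map {S : Type*} [CommRing S] (φ : R ≃+* S) {I : Ideal R} {ps : List R}
    (h : RegularOn I ps) : RegularOn (I.map (φ : R →+* S)) (ps.map φ) := by
  induction ps generalizing I with
  | nil => trivial
  | cons p ps ih =>
    refine ⟨fun x hx => ?_, ?_⟩
    · obtain ⟨y, rfl⟩ := φ.surjective x
      rw [← map_mul] at hx
      have hmem : ∀ z, φ z ∈ I.map (φ : R →+* S) ↔ z ∈ I := by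
        intro z
        rw [Ideal.map_comap_of_equiv, Ideal.mem_comap]
        simp
      rw [hmem] at hx ⊢
      exact h.1 y hx
    · have := ih h.2
      rwa [Ideal.map_sup, Ideal.map_span, Set.image_singleton] at this

end RegularOn

section Step

variable {k : Type u} [Field k] {n c : ℕ}

theorem homogeneousComponent_mul_left {p : MvPolynomial (Fin n) k} {d : ℕ}
    (hp : p.IsHomogeneous d) (q : MvPolynomial (Fin n) k) (t : ℕ) :
    homogeneousComponent t (p * q) = if d ≤ t then p * homogeneousComponent (t - d) q else 0 := by
  rw [← decomposition.decompose'_apply, ← decomposition.decompose'_apply]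
  exact DirectSum.coe_decompose_mul_of_left_mem (homogeneousSubmodule (Fin n) k) t hp

/-- The colon ideal `I : p`. -/
noncomputable def colonIdeal (I : Ideal (MvPolynomial (Fin n) k)) (p : MvPolynomial (Fin n) k) :
    Ideal (MvPolynomial (Fin n) k) :=
  Submodule.comap (LinearMap.mulLeft (MvPolynomial (Fin n) k) p) I

theorem mem_colonIdeal {I : Ideal (MvPolynomial (Fin n) k)} {p x : MvPolynomial (Fin n) k} :
    x ∈ colonIdeal I p ↔ p * x ∈ I := Iff.rfl

theorem le_colonIdeal (I : Ideal (MvPolynomial (Fin n) k)) (p : MvPolynomial (Fin n) k) :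
    I ≤ colonIdeal I p := fun _ hx => I.mul_mem_left p hx

theorem isHomogeneousIdeal_colonIdeal {I : Ideal (MvPolynomial (Fin n) k)}
    (hI : IsHomogeneousIdeal I) {p : MvPolynomial (Fin n) k} {d : ℕ} (hp : p.IsHomogeneous d) :
    IsHomogeneousIdeal (colonIdeal I p) := by
  rw [isHomogeneousIdeal_iff] at hI ⊢
  intro x hx t
  have := hI _ hx (t + d)
  rw [LinearMap.mulLeft_apply, homogeneousComponent_mul_left hp, if_pos (Nat.le_add_left _ _),
    Nat.add_sub_cancel] at this
  exact this

theorem isHomogeneousIdeal_span_singleton {p : MvPolynomial (Fin n) k} {d : ℕ}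
    (hp : p.IsHomogeneous d) : IsHomogeneousIdeal (Ideal.span {p}) :=
  isHomogeneousIdeal_span fun q hq => ⟨d, by rwa [Set.mem_singleton_iff.1 hq]⟩

theorem gradedPart_sup_span_singleton {I : Ideal (MvPolynomial (Fin n) k)}
    (hI : IsHomogeneousIdeal I) {p : MvPolynomial (Fin n) k} {d : ℕ} (hp : p.IsHomogeneous d)
    {t : ℕ} {x : MvPolynomial (Fin n) k} (hx : x ∈ gradedPart (I ⊔ Ideal.span {p}) t) :
    ∃ y ∈ gradedPart I t, ∃ z, x = y + (if d ≤ t then p * homogeneousComponent (t - d) z else 0) := by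
  obtain ⟨y, hy, w, hw, hyw⟩ := Submodule.mem_sup.1 hx.1
  obtain ⟨z, rfl⟩ := Ideal.mem_span_singleton'.1 hw
  refine ⟨homogeneousComponent t y, ⟨isHomogeneousIdeal_iff.1 hI y hy t,
    homogeneousComponent_isHomogeneous t y⟩, z, ?_⟩
  rw [← homogeneousComponent_mul_left hp, ← map_add, mul_comm p z, hyw,
    homogeneousComponent_of_isHomogeneous hx.2, if_pos rfl]

theorem hilb_sup_span_singleton_of_lt {I : Ideal (MvPolynomial (Fin n) k)}
    (hI : IsHomogeneousIdeal I) {p : MvPolynomial (Fin n) k} {d : ℕ} (hp : p.IsHomogeneous d)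
    {t : ℕ} (ht : t < d) : hilb (I ⊔ Ideal.span {p}) t = hilb I t := by
  have : gradedPart (I ⊔ Ideal.span {p}) t = gradedPart I t := by
    refine le_antisymm (fun x hx => ?_) (gradedPart_mono le_sup_left t)
    obtain ⟨y, hy, z, rfl⟩ := gradedPart_sup_span_singleton hI hp hx
    rw [if_neg (not_le.2 ht), add_zero]
    exact hy
  rw [hilb, this, hilb]

/-- The Hilbert function of `I + (p)`: the exact sequence
`0 → (I : p) → A → (I + (p)) / I → 0`, degree by degree. -/
theorem hilb_sup_span_singleton {I : Ideal (MvPolynomial (Fin n) k)}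
    (hI : IsHomogeneousIdeal I) {p : MvPolynomial (Fin n) k} {d : ℕ} (hp : p.IsHomogeneous d)
    (s : ℕ) : hilb (I ⊔ Ideal.span {p}) (s + d) + hilb (colonIdeal I p) s =
      hilb I (s + d) + hilb (⊤ : Ideal (MvPolynomial (Fin n) k)) s := by
  -- everything is computed in the quotient by `I`, so that `p` may be zero
  set q := (gradedPart I (s + d)).mkQ with hq
  have h1 := finrank_map_add_finrank_inf_ker q (gradedPart (I ⊔ Ideal.span {p}) (s + d))
  have h2 := finrank_map_add_finrank_inf_ker (q ∘ₗ LinearMap.mulLeft k p)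
    (gradedPart (⊤ : Ideal (MvPolynomial (Fin n) k)) s)
  rw [hq, Submodule.ker_mkQ, inf_eq_right.2 (gradedPart_mono le_sup_left _), ← hq] at h1
  have h3 : gradedPart (⊤ : Ideal (MvPolynomial (Fin n) k)) s ⊓
      LinearMap.ker (q ∘ₗ LinearMap.mulLeft k p) = gradedPart (colonIdeal I p) s := by
    ext x
    simp only [Submodule.mem_inf, LinearMap.mem_ker, LinearMap.comp_apply, hq,
      Submodule.mkQ_apply, Submodule.Quotient.mk_eq_zero, mem_gradedPart, mem_colonIdeal,
      LinearMap.mulLeft_apply, Submodule.mem_top, true_and]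
    constructor
    · rintro ⟨h, h', -⟩
      exact ⟨h', h⟩
    · rintro ⟨h, h'⟩
      exact ⟨h', h, by rw [add_comm]; exact hp.mul h'⟩
  have h4 : (gradedPart (I ⊔ Ideal.span {p}) (s + d)).map q =
      (gradedPart (⊤ : Ideal (MvPolynomial (Fin n) k)) s).map (q ∘ₗ LinearMap.mulLeft k p) := by
    refine le_antisymm ?_ ?_
    · rintro _ ⟨x, hx, rfl⟩
      obtain ⟨y, hy, z, rfl⟩ := gradedPart_sup_span_singleton hI hp hx
      rw [if_pos (Nat.le_add_left _ _), Nat.add_sub_cancel, map_add,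
        show q y = 0 from (Submodule.Quotient.mk_eq_zero _).2 hy, zero_add]
      exact ⟨_, ⟨Submodule.mem_top, homogeneousComponent_isHomogeneous s z⟩, rfl⟩
    · rintro _ ⟨x, hx, rfl⟩
      refine ⟨p * x, ⟨Ideal.mem_sup_right (Ideal.mul_mem_right _ _
        (Ideal.mem_span_singleton_self p)), ?_⟩, rfl⟩
      rw [add_comm]
      exact hp.mul hx.2
  rw [h3] at h2
  rw [h4] at h1
  simp only [hilb]
  omega

/-- The Hilbert function of `A ⧸ I`, with integer values. -/
noncomputable def quotHilb (I : Ideal (MvPolynomial (Fin n) k)) (t : ℕ) : ℤ :=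
  (hilb (⊤ : Ideal (MvPolynomial (Fin n) k)) t : ℤ) - hilb I t

theorem quotHilb_anti {I J : Ideal (MvPolynomial (Fin n) k)} (h : I ≤ J) (t : ℕ) :
    quotHilb J t ≤ quotHilb I t := by
  have := hilb_mono h t
  rw [quotHilb, quotHilb]
  omega

theorem eq_of_quotHilb_le {I J : Ideal (MvPolynomial (Fin n) k)} (hJ : IsHomogeneousIdeal J)
    (hIJ : I ≤ J) (h : ∀ t, quotHilb I t ≤ quotHilb J t) : I = J := by
  refine le_antisymm hIJ (le_of_gradedPart_le hJ fun t => ?_)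
  refine (Submodule.eq_of_le_of_finrank_le (gradedPart_mono hIJ t) ?_).ge
  have := h t
  rw [quotHilb, quotHilb] at this
  change hilb J t ≤ hilb I t
  omega

/-- The effect on the Hilbert function of dividing by a nonzerodivisor of degree `d`. -/
def shiftSub (d : ℕ) (y : ℕ → ℤ) (t : ℕ) : ℤ := y t - if d ≤ t then y (t - d) else 0

theorem quotHilb_sup_span_singleton {I : Ideal (MvPolynomial (Fin n) k)}
    (hI : IsHomogeneousIdeal I) {p : MvPolynomial (Fin n) k} {d : ℕ} (hp : p.IsHomogeneous d)
    (t : ℕ) : quotHilb (I ⊔ Ideal.span {p}) t = shiftSub d (quotHilb I) t +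
      if d ≤ t then quotHilb I (t - d) - quotHilb (colonIdeal I p) (t - d) else 0 := by
  rw [shiftSub]
  split_ifs with h
  · obtain ⟨s, rfl⟩ := Nat.exists_eq_add_of_le' h
    have := hilb_sup_span_singleton hI hp s
    simp only [quotHilb, Nat.add_sub_cancel]
    omega
  · simp only [quotHilb, hilb_sup_span_singleton_of_lt hI hp (not_le.1 h)]
    omega

theorem shiftSub_le_quotHilb {I : Ideal (MvPolynomial (Fin n) k)}
    (hI : IsHomogeneousIdeal I) {p : MvPolynomial (Fin n) k} {d : ℕ} (hp : p.IsHomogeneous d)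
    (t : ℕ) : shiftSub d (quotHilb I) t ≤ quotHilb (I ⊔ Ideal.span {p}) t := by
  rw [quotHilb_sup_span_singleton hI hp]
  have := quotHilb_anti (le_colonIdeal I p) (t - d)
  split_ifs <;> omega

theorem quotHilb_sup_of_regular {I : Ideal (MvPolynomial (Fin n) k)}
    (hI : IsHomogeneousIdeal I) {p : MvPolynomial (Fin n) k} {d : ℕ} (hp : p.IsHomogeneous d)
    (h : ∀ x, p * x ∈ I → x ∈ I) :
    quotHilb (I ⊔ Ideal.span {p}) = shiftSub d (quotHilb I) := by
  have hc : colonIdeal I p = I := le_antisymm h (le_colonIdeal I p)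
  funext t
  rw [quotHilb_sup_span_singleton hI hp, hc]
  simp

theorem regular_of_quotHilb_sup_le {I : Ideal (MvPolynomial (Fin n) k)}
    (hI : IsHomogeneousIdeal I) {p : MvPolynomial (Fin n) k} {d : ℕ} (hp : p.IsHomogeneous d)
    (h : ∀ t, quotHilb (I ⊔ Ideal.span {p}) t ≤ shiftSub d (quotHilb I) t) (x) (hx : p * x ∈ I) :
    x ∈ I := by
  have hc := eq_of_quotHilb_le (isHomogeneousIdeal_colonIdeal hI hp) (le_colonIdeal I p)
    fun t => by
      have := h (t + d)
      rw [quotHilb_sup_span_singleton hI hp, if_pos (Nat.le_add_left _ _), Nat.add_sub_cancel] at this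
      omega
  rw [hc]
  exact hx

theorem le_of_shiftSub_le {d : ℕ} (hd : 1 ≤ d) {y z : ℕ → ℤ}
    (h : ∀ t, shiftSub d y t ≤ shiftSub d z t) (t : ℕ) : y t ≤ z t := by
  induction t using Nat.strong_induction_on with
  | _ t ih =>
    have := h t
    rw [shiftSub, shiftSub] at this
    split_ifs at this with hdt
    · have := ih (t - d) (by omega)
      omega
    · omega


/-- The effect on the Hilbert function of dividing by a regular sequence with these degrees. -/
def shiftSubs (ds : List ℕ) (y : ℕ → ℤ) : ℕ → ℤ := ds.foldl (fun y d => shiftSub d y) y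

theorem quotHilb_sup_ofList_of_regularOn {ps : List (MvPolynomial (Fin n) k)} {ds : List ℕ}
    (hps : List.Forall₂ (fun p d => p.IsHomogeneous d) ps ds)
    {I : Ideal (MvPolynomial (Fin n) k)} (hI : IsHomogeneousIdeal I) (h : RegularOn I ps) :
    quotHilb (I ⊔ Ideal.ofList ps) = shiftSubs ds (quotHilb I) := by
  induction hps generalizing I with
  | nil => simp [shiftSubs]
  | @cons p d ps ds hp _ ih =>
    have := ih (hI.sup (isHomogeneousIdeal_span_singleton hp)) h.2
    rw [Ideal.ofList_cons, ← sup_assoc, this, quotHilb_sup_of_regular hI hp h.1]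
    rfl

/-- An upper bound for the Hilbert function of the quotient by a sequence of forms, of the kind that
holds for regular sequences, is inherited by the Hilbert function before the division. -/
theorem quotHilb_le_of_sup_ofList_le {ps : List (MvPolynomial (Fin n) k)} {ds : List ℕ}
    (hps : List.Forall₂ (fun p d => p.IsHomogeneous d) ps ds) (hds : ∀ d ∈ ds, 1 ≤ d)
    {I : Ideal (MvPolynomial (Fin n) k)} (hI : IsHomogeneousIdeal I) {y : ℕ → ℤ}
    (h : ∀ t, quotHilb (I ⊔ Ideal.ofList ps) t ≤ shiftSubs ds y t) (t : ℕ) :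
    quotHilb I t ≤ y t := by
  induction hps generalizing I y t with
  | nil => simpa [shiftSubs] using h t
  | @cons p d ps ds hp _ ih =>
    have h1 := fun t => ih (fun d hd => hds d (List.mem_cons_of_mem _ hd))
      (hI.sup (isHomogeneousIdeal_span_singleton hp)) (y := shiftSub d y)
      (fun t => by rw [sup_assoc, ← Ideal.ofList_cons]; exact h t) t
    exact le_of_shiftSub_le (hds d List.mem_cons_self)
      (fun t => (shiftSub_le_quotHilb hI hp t).trans (h1 t)) t

/-- A sequence of forms of positive degrees is regular if the Hilbert function of the quotient is
as small as for a regular sequence. -/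
theorem regularOn_of_quotHilb_le {ps : List (MvPolynomial (Fin n) k)} {ds : List ℕ}
    (hps : List.Forall₂ (fun p d => p.IsHomogeneous d) ps ds) (hds : ∀ d ∈ ds, 1 ≤ d)
    {I : Ideal (MvPolynomial (Fin n) k)} (hI : IsHomogeneousIdeal I)
    (h : ∀ t, quotHilb (I ⊔ Ideal.ofList ps) t ≤ shiftSubs ds (quotHilb I) t) :
    RegularOn I ps := by
  induction hps generalizing I with
  | nil => trivial
  | @cons p d ps ds hp hps ih =>
    have hds' : ∀ d ∈ ds, 1 ≤ d := fun d hd => hds d (List.mem_cons_of_mem _ hd)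
    have hI' := hI.sup (isHomogeneousIdeal_span_singleton hp)
    have h' : ∀ t, quotHilb (I ⊔ Ideal.span {p} ⊔ Ideal.ofList ps) t ≤
        shiftSubs ds (shiftSub d (quotHilb I)) t := fun t => by
      rw [sup_assoc, ← Ideal.ofList_cons]
      exact h t
    have hreg := regular_of_quotHilb_sup_le hI hp (quotHilb_le_of_sup_ofList_le hps hds' hI' h')
    refine ⟨hreg, ih hds' hI' ?_⟩
    rwa [quotHilb_sup_of_regular hI hp hreg]

end Step

section CompleteIntersection

variable {k : Type u} [Field k] {n c : ℕ}

theorem quotHilb_powerIdeal (k : Type u) [Field k] (n : ℕ) (e : Fin c → ℕ) (t : ℕ) :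
    quotHilb (powerIdeal k n e) t = (capMon e n t).card := by
  have := hilb_powerIdeal_add_card (k := k) (n := n) e t
  rw [quotHilb]
  omega

theorem ofList_ofFn {R : Type*} [CommRing R] (f : Fin c → R) :
    Ideal.ofList (List.ofFn f) = Ideal.span (Set.range f) := by
  rw [Ideal.ofList]
  congr 1
  ext x
  simp [List.mem_ofFn]

theorem forall₂_ofFn {α β : Type*} {r : α → β → Prop} {f : Fin c → α} {g : Fin c → β}
    (h : ∀ i, r (f i) (g i)) : List.Forall₂ r (List.ofFn f) (List.ofFn g) := by
  rw [List.forall₂_iff_get]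
  refine ⟨by simp, fun i h1 h2 => ?_⟩
  simpa using h _

theorem span_powers_eq_powerIdeal (hcn : c ≤ n) (e : Fin c → ℕ) :
    Ideal.span (Set.range fun j : Fin c => (X (Fin.castLE hcn j) : MvPolynomial (Fin n) k) ^ e j) =
      powerIdeal k n e := by
  rw [powerIdeal]
  congr 1
  ext p
  constructor
  · rintro ⟨j, rfl⟩
    exact ⟨_, j, rfl, rfl⟩
  · rintro ⟨i, j, h, rfl⟩
    obtain rfl : Fin.castLE hcn j = i := Fin.ext h.symm
    exact ⟨j, rfl⟩

/-- A variable beyond the `c`-th is a nonzerodivisor modulo the powers of the first `c`. -/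
theorem powers_regular {e : Fin c → ℕ} {i : Fin n} (hi : c ≤ i) (d : ℕ)
    (x : MvPolynomial (Fin n) k) (hx : X i ^ d * x ∈ powerIdeal k n e) : x ∈ powerIdeal k n e := by
  rw [(isMonomialIdeal_powerIdeal e).mem_iff] at hx ⊢
  intro u hu
  have h := hx (Finsupp.single i d + u) (by
    rwa [X_pow_eq_monomial, coeff_monomial_mul, one_mul])
  rw [monomial_mem_powerIdeal_iff] at h ⊢
  refine fun h' => h (mem_capMon.2 ⟨rfl, fun i' j hij => ?_⟩)
  have hne : i ≠ i' := by
    rintro rfl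
    have := j.2
    omega
  rw [Finsupp.add_apply, Finsupp.single_eq_of_ne' hne, zero_add]
  exact (mem_capMon.1 h').2 i' j hij

theorem regularOn_powers (hcn : c ≤ n) (e : Fin c → ℕ) :
    RegularOn ⊥ (List.ofFn fun j : Fin c => (X (Fin.castLE hcn j) : MvPolynomial (Fin n) k) ^ e j) := by
  induction c with
  | zero => simp [RegularOn]
  | succ c ih =>
    rw [List.ofFn_succ', List.concat_eq_append, regularOn_append]
    refine ⟨ih (by omega) fun j => e j.castSucc, fun x hx => ?_, trivial⟩
    have := span_powers_eq_powerIdeal (k := k) (show c ≤ n by omega) fun j => e j.castSucc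
    rw [bot_sup_eq, ofList_ofFn] at hx ⊢
    erw [this] at hx ⊢
    exact powers_regular (i := Fin.castLE hcn (Fin.last c)) (by simp) _ x hx

theorem isHomogeneousIdeal_bot : IsHomogeneousIdeal (⊥ : Ideal (MvPolynomial (Fin n) k)) :=
  Ideal.IsHomogeneous.bot _

theorem quotHilb_span_of_regularOn {f : Fin c → MvPolynomial (Fin n) k} {e : Fin c → ℕ}
    (hf : ∀ i, (f i).IsHomogeneous (e i)) (h : RegularOn ⊥ (List.ofFn f)) :
    quotHilb (Ideal.span (Set.range f)) =
      shiftSubs (List.ofFn e) (quotHilb (⊥ : Ideal (MvPolynomial (Fin n) k))) := by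
  rw [← ofList_ofFn, ← quotHilb_sup_ofList_of_regularOn (forall₂_ofFn hf) isHomogeneousIdeal_bot h,
    bot_sup_eq]

/-- The Hilbert function of a complete intersection counts the monomials outside the ideal of powers,
because the powers of the variables are such a complete intersection. -/
theorem shiftSubs_ofFn (k : Type u) [Field k] (hcn : c ≤ n) (e : Fin c → ℕ) :
    shiftSubs (List.ofFn e) (quotHilb (⊥ : Ideal (MvPolynomial (Fin n) k))) =
      fun t => ((capMon e n t).card : ℤ) := by
  rw [← quotHilb_span_of_regularOn (fun j => isHomogeneous_X_pow (Fin.castLE hcn j) (e j))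
    (regularOn_powers hcn e), span_powers_eq_powerIdeal]
  exact funext (quotHilb_powerIdeal k n e)

theorem mem_of_quotHilb_eq_zero {I : Ideal (MvPolynomial (Fin n) k)} {t : ℕ}
    (h : quotHilb I t = 0) {p : MvPolynomial (Fin n) k} (hp : p.IsHomogeneous t) : p ∈ I := by
  have : gradedPart I t = gradedPart ⊤ t := by
    refine Submodule.eq_of_le_of_finrank_le (gradedPart_mono le_top t) ?_
    rw [quotHilb] at h
    change hilb ⊤ t ≤ hilb I t
    omega
  have hp' : p ∈ gradedPart (⊤ : Ideal (MvPolynomial (Fin n) k)) t := ⟨Submodule.mem_top, hp⟩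
  rw [← this] at hp'
  exact hp'.1

/-- The forms in a regular sequence have positive degrees: zero is not regular, and the other
constants are units. -/
theorem one_le_degree_of_regularOn {ps : List (MvPolynomial (Fin n) k)} {ds : List ℕ}
    (hps : List.Forall₂ (fun p d => p.IsHomogeneous d) ps ds)
    {I : Ideal (MvPolynomial (Fin n) k)} (h : RegularOn I ps) (htop : I ⊔ Ideal.ofList ps ≠ ⊤) :
    ∀ d ∈ ds, 1 ≤ d := by
  induction hps generalizing I with
  | nil => simp
  | @cons p d ps ds hp _ ih =>
    rw [Ideal.ofList_cons, ← sup_assoc] at htop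
    intro d' hd'
    rcases List.mem_cons.1 hd' with rfl | hd'
    · by_contra hlt
      obtain rfl : d' = 0 := by omega
      obtain ⟨a, rfl⟩ : ∃ a, p = C a :=
        ⟨_, totalDegree_eq_zero_iff_eq_C.1 (Nat.le_zero.1 hp.totalDegree_le)⟩
      rcases eq_or_ne a 0 with rfl | ha
      · have h1 := h.1 1 (by simp)
        exact htop ((Ideal.eq_top_iff_one _).2 (Ideal.mem_sup_left (Ideal.mem_sup_left h1)))
      · have h1 : (1 : MvPolynomial (Fin n) k) ∈ Ideal.span {(C a : MvPolynomial (Fin n) k)} :=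
          Ideal.mem_span_singleton.2 ⟨C a⁻¹, by rw [← C_mul, mul_inv_cancel₀ ha, C_1]⟩
        exact htop ((Ideal.eq_top_iff_one _).2 (Ideal.mem_sup_left (Ideal.mem_sup_right h1)))
    · exact ih h.2 htop d' hd'

theorem card_capMon_eq_zero (e : Fin n → ℕ) {t : ℕ} (ht : ∑ i, e i < t) : (capMon e n t).card = 0 := by
  rw [Finset.card_eq_zero, Finset.eq_empty_iff_forall_notMem]
  intro u hu
  rw [mem_capMon] at hu
  have : u.degree ≤ ∑ i, e i := by
    rw [Finsupp.degree_eq_sum]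
    exact Finset.sum_le_sum fun i _ => (hu.2 i i rfl).le
  omega

/-- A regular sequence of forms of `k[x₁, …, xₙ]` has at most `n` terms: modulo `n` of them,
everything of large degree vanishes. -/
theorem length_le_of_regularOn {ps : List (MvPolynomial (Fin n) k)} {ds : List ℕ}
    (hps : List.Forall₂ (fun p d => p.IsHomogeneous d) ps ds)
    (h : RegularOn ⊥ ps) (htop : Ideal.ofList ps ≠ ⊤) : ps.length ≤ n := by
  by_contra! hlt
  have hds := one_le_degree_of_regularOn hps h (by rwa [bot_sup_eq])
  have hlen := hps.length_eq
  have hsplit : ps = ps.take n ++ ps[n] :: ps.drop (n + 1) := by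
    rw [← List.drop_eq_getElem_cons, List.take_append_drop]
  have hreg := h
  rw [hsplit, regularOn_append, bot_sup_eq] at hreg
  obtain ⟨h1, h2, -⟩ := hreg
  have hq := quotHilb_sup_ofList_of_regularOn (List.forall₂_take n hps) isHomogeneousIdeal_bot h1
  set e : Fin n → ℕ := fun i => ds[i.1]'(by omega) with he
  have htake : ds.take n = List.ofFn e := by
    refine List.ext_getElem (by simp; omega) fun i h1 h2 => ?_
    simp [he]
  rw [htake, shiftSubs_ofFn k le_rfl, bot_sup_eq] at hq
  have hp : (ps[n]).IsHomogeneous (ds[n]'(by omega)) := by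
    simpa using (List.forall₂_iff_get.1 hps).2 n hlt (by omega)
  have hd : 1 ≤ ds[n]'(by omega) := hds _ (List.getElem_mem _)
  have hpow : ∀ N : ℕ, ps[n] ^ N ∈ Ideal.ofList (ps.take n) → 1 ∈ Ideal.ofList (ps.take n) := by
    intro N
    induction N with
    | zero => simp
    | succ N ih =>
      intro hN
      rw [pow_succ'] at hN
      exact ih (h2 _ hN)
  have hmem : ps[n] ^ (∑ i, e i + 1) ∈ Ideal.ofList (ps.take n) := by
    refine mem_of_quotHilb_eq_zero (t := ds[n]'(by omega) * (∑ i, e i + 1)) ?_ (hp.pow _)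
    rw [hq]
    have := card_capMon_eq_zero e (t := ds[n]'(by omega) * (∑ i, e i + 1)) 
      (lt_of_lt_of_le (Nat.lt_succ_self _) (Nat.le_mul_of_pos_left _ hd))
    simp [this]
  refine htop ((Ideal.eq_top_iff_one _).2 ?_)
  rw [hsplit, Ideal.ofList_append]
  exact Ideal.mem_sup_left (hpow _ hmem)

theorem hilb_eq_iff_quotHilb_eq {m : ℕ} {I J : Ideal (MvPolynomial (Fin m) k)} (t : ℕ) :
    hilb I t = hilb J t ↔ quotHilb I t = quotHilb J t := by
  rw [quotHilb, quotHilb]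
  omega

end CompleteIntersection

/-! ### Reduction modulo the last variables -/

section ModLastVars

variable {k : Type u} [Field k] {n m c : ℕ}

theorem modLastVars_rename (hmn : m ≤ n) (p : MvPolynomial (Fin m) k) :
    modLastVars k n m (rename (Fin.castLE hmn) p) = p := by
  rw [modLastVars, aeval_rename]
  conv_rhs => rw [← aeval_X_left_apply p]
  congr 2
  funext i
  simp

theorem modLastVars_surjective_of_le (hmn : m ≤ n) : Function.Surjective (modLastVars k n m) :=
  fun p => ⟨_, modLastVars_rename hmn p⟩

theorem isHomogeneous_modLastVars {p : MvPolynomial (Fin n) k} {t : ℕ} (hp : p.IsHomogeneous t) :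
    (modLastVars k n m p).IsHomogeneous t := by
  have := hp.aeval (fun i : Fin n => if h : (i : ℕ) < m then (X ⟨i, h⟩ : MvPolynomial (Fin m) k) else 0)
    (n := 1) fun i => by
      split_ifs
      · exact isHomogeneous_X _ _
      · exact isHomogeneous_zero _ _ _
  rwa [one_mul] at this

theorem mem_lastVars {p : MvPolynomial (Fin n) k} :
    p ∈ lastVars k n m ↔ ∃ i : Fin n, m ≤ i ∧ p = X i := by
  simp [lastVars, eq_comm]

theorem ker_modLastVars (hmn : m ≤ n) :
    RingHom.ker (modLastVars k n m) = Ideal.ofList (lastVars k n m) := by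
  refine le_antisymm (fun p hp => ?_) (Ideal.span_le.2 fun p hp => ?_)
  · have h : ((Ideal.Quotient.mkₐ k (Ideal.ofList (lastVars k n m))).comp
        ((rename (Fin.castLE hmn)).comp (modLastVars k n m))) =
        Ideal.Quotient.mkₐ k (Ideal.ofList (lastVars k n m)) := by
      refine MvPolynomial.algHom_ext fun i => ?_
      rw [AlgHom.comp_apply, AlgHom.comp_apply, modLastVars, aeval_X]
      split_ifs with hi
      · rw [rename_X]
        rfl
      · rw [map_zero, map_zero]
        exact ((Ideal.Quotient.eq_zero_iff_mem (I := Ideal.ofList (lastVars k n m))).2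
          (Ideal.subset_span (mem_lastVars.2 ⟨i, not_lt.1 hi, rfl⟩))).symm
    have := DFunLike.congr_fun h p
    rw [AlgHom.comp_apply, AlgHom.comp_apply, show modLastVars k n m p = 0 from hp, map_zero,
      map_zero] at this
    exact Ideal.Quotient.eq_zero_iff_mem.1 this.symm
  · obtain ⟨i, hi, rfl⟩ := mem_lastVars.1 hp
    rw [SetLike.mem_coe, RingHom.mem_ker, modLastVars, aeval_X, dif_neg (not_lt.2 hi)]

theorem isHomogeneousIdeal_ofList_lastVars :
    IsHomogeneousIdeal (Ideal.ofList (lastVars k n m)) :=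
  isHomogeneousIdeal_span fun p hp => by
    obtain ⟨i, -, rfl⟩ := mem_lastVars.1 hp
    exact ⟨1, isHomogeneous_X k i⟩

theorem lastVars_self : lastVars k n n = [] := by
  simp [lastVars]

theorem ofList_lastVars_eq_sup (hmn : m < n) :
    Ideal.ofList (lastVars k n m) =
      Ideal.ofList (lastVars k n (m + 1)) ⊔ Ideal.span {X ⟨m, hmn⟩} := by
  rw [Ideal.ofList, Ideal.ofList, ← Ideal.span_union]
  congr 1
  ext p
  simp only [Set.mem_ofPred_eq, Set.mem_union, Set.mem_singleton_iff, mem_lastVars]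
  constructor
  · rintro ⟨i, hi, rfl⟩
    rcases hi.eq_or_lt with h | h
    · exact Or.inr (by rw [show i = ⟨m, hmn⟩ from Fin.ext h.symm])
    · exact Or.inl ⟨i, h, rfl⟩
  · rintro (⟨i, hi, rfl⟩ | rfl)
    · exact ⟨i, by omega, rfl⟩
    · exact ⟨_, le_rfl, rfl⟩

theorem length_lastVars : (lastVars k n m).length = n - m := by
  rw [lastVars, List.length_map, ← List.toFinset_card_of_nodup ((List.nodup_finRange n).filter _),
    List.toFinset_filter, List.toFinset_finRange]
  rw [← Finset.card_map Fin.valEmbedding, ← Nat.card_Ico m n]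
  congr 1
  ext x
  simp only [Finset.mem_map, Finset.mem_filter, Finset.mem_univ, true_and, decide_eq_true_eq,
    Fin.valEmbedding_apply, Finset.mem_Ico]
  constructor
  · rintro ⟨i, hi, rfl⟩
    exact ⟨hi, i.2⟩
  · rintro ⟨h1, h2⟩
    exact ⟨⟨x, h2⟩, h1, rfl⟩

/-- The Hilbert function of the reduction modulo the last variables. -/
theorem quotHilb_map_modLastVars (hmn : m ≤ n) (a : Ideal (MvPolynomial (Fin n) k)) (t : ℕ) :
    quotHilb (a.map (modLastVars k n m)) t = quotHilb (a ⊔ Ideal.ofList (lastVars k n m)) t := by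
  set b := a ⊔ Ideal.ofList (lastVars k n m) with hb
  have hker := ker_modLastVars (k := k) hmn
  have hmem : ∀ x, modLastVars k n m x ∈ a.map (modLastVars k n m) ↔ x ∈ b := by
    intro x
    rw [← Ideal.mem_comap, Ideal.comap_map_of_surjective _ (modLastVars_surjective_of_le hmn),
      hb, ← hker]
    rfl
  have hmap : ∀ (I : Ideal (MvPolynomial (Fin n) k)) (J : Ideal (MvPolynomial (Fin m) k)),
      (∀ x, modLastVars k n m x ∈ J ↔ x ∈ I) →
      (gradedPart I t).map (modLastVars k n m).toLinearMap = gradedPart J t := by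
    intro I J hIJ
    ext y
    constructor
    · rintro ⟨x, hx, rfl⟩
      exact ⟨(hIJ x).2 hx.1, isHomogeneous_modLastVars hx.2⟩
    · intro hy
      have hr := modLastVars_rename (k := k) hmn y
      exact ⟨rename (Fin.castLE hmn) y, ⟨(hIJ _).1 (by rw [hr]; exact hy.1),
        hy.2.rename_isHomogeneous⟩, hr⟩
  have hker' : gradedPart b t ⊓ LinearMap.ker (modLastVars k n m).toLinearMap =
      gradedPart ⊤ t ⊓ LinearMap.ker (modLastVars k n m).toLinearMap := by
    refine le_antisymm (inf_le_inf_right _ (gradedPart_mono le_top t)) ?_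
    rintro x ⟨hx, hx'⟩
    have hx'' : x ∈ RingHom.ker (modLastVars k n m) := hx'
    rw [hker] at hx''
    exact ⟨⟨Ideal.mem_sup_right hx'', hx.2⟩, hx'⟩
  have h1 := finrank_map_add_finrank_inf_ker (modLastVars k n m).toLinearMap (gradedPart b t)
  have h2 := finrank_map_add_finrank_inf_ker (modLastVars k n m).toLinearMap
    (gradedPart (⊤ : Ideal (MvPolynomial (Fin n) k)) t)
  rw [hmap b _ hmem, hker'] at h1
  rw [hmap ⊤ ⊤ (by simp)] at h2
  rw [quotHilb, quotHilb]
  simp only [hilb]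
  omega

theorem modLastVars_modLastVars (p : MvPolynomial (Fin n) k) :
    modLastVars k (m + 1) m (modLastVars k n (m + 1) p) = modLastVars k n m p := by
  rw [← AlgHom.comp_apply]
  congr 1
  refine MvPolynomial.algHom_ext fun i => ?_
  rw [AlgHom.comp_apply, modLastVars, modLastVars, modLastVars, aeval_X, aeval_X]
  by_cases h1 : (i : ℕ) < m
  · rw [dif_pos h1, dif_pos (by omega), aeval_X, dif_pos h1]
  · rw [dif_neg h1]
    by_cases h2 : (i : ℕ) < m + 1
    · rw [dif_pos h2, aeval_X, dif_neg h1]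
    · rw [dif_neg h2, map_zero]

theorem modLastVars_self (p : MvPolynomial (Fin n) k) : modLastVars k n n p = p := by
  have := modLastVars_rename (k := k) le_rfl p
  simpa using this

theorem map_modLastVars_succ (a : Ideal (MvPolynomial (Fin n) k)) :
    (a.map (modLastVars k n (m + 1))).map (modLastVars k (m + 1) m) = a.map (modLastVars k n m) := by
  rw [Ideal.map_mapₐ]
  congr 1
  exact AlgHom.ext fun p => modLastVars_modLastVars p

theorem map_modLastVars_self (a : Ideal (MvPolynomial (Fin n) k)) :
    a.map (modLastVars k n n) = a := by
  rw [show modLastVars k n n = AlgHom.id k _ from AlgHom.ext modLastVars_self]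
  exact Ideal.map_id a

theorem map_modLastVars_span (f : Fin c → MvPolynomial (Fin n) k) :
    (Ideal.span (Set.range f)).map (modLastVars k n m) =
      Ideal.span (Set.range fun i => modLastVars k n m (f i)) := by
  rw [Ideal.map_span, ← Set.range_comp]
  rfl

theorem shiftSub_one_card_capMon (hcm : c ≤ m) (e : Fin c → ℕ) :
    shiftSub 1 (fun t => ((capMon e (m + 1) t).card : ℤ)) = fun t => ((capMon e m t).card : ℤ) := by
  funext t
  rw [shiftSub, card_capMon_succ hcm]
  cases t with
  | zero => simp
  | succ t =>
    rw [if_pos (by omega), Nat.add_sub_cancel, card_capMon_succ hcm, Finset.sum_range_succ']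
    simp

theorem shiftSubs_replicate_one (hcm : c ≤ m) (e : Fin c → ℕ) (j : ℕ) :
    shiftSubs (List.replicate j 1) (fun t => ((capMon e (m + j) t).card : ℤ)) =
      fun t => ((capMon e m t).card : ℤ) := by
  induction j with
  | zero => rfl
  | succ j ih =>
    rw [List.replicate_succ, shiftSubs, List.foldl_cons, ← add_assoc,
      shiftSub_one_card_capMon (by omega)]
    exact ih

theorem forall₂_append_lastVars {f : Fin c → MvPolynomial (Fin n) k} {e : Fin c → ℕ}
    (hf : ∀ i, (f i).IsHomogeneous (e i)) :
    List.Forall₂ (fun p d => p.IsHomogeneous d) (List.ofFn f ++ lastVars k n m)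
      (List.ofFn e ++ List.replicate (n - m) 1) := by
  refine List.rel_append (forall₂_ofFn hf) ?_
  rw [List.forall₂_iff_get]
  refine ⟨by rw [length_lastVars, List.length_replicate], fun i h1 h2 => ?_⟩
  obtain ⟨v, -, hv⟩ := mem_lastVars.1 ((lastVars k n m).get_mem ⟨i, h1⟩)
  simp only [List.get_eq_getElem] at hv ⊢
  rw [hv, List.getElem_replicate]
  exact isHomogeneous_X k v

theorem quotHilb_append_lastVars (hcn : c ≤ n) {f : Fin c → MvPolynomial (Fin n) k} {e : Fin c → ℕ}
    (hf : ∀ i, (f i).IsHomogeneous (e i))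
    (hreg : RegularOn ⊥ (List.ofFn f ++ lastVars k n c)) (t : ℕ) :
    quotHilb (Ideal.span (Set.range f) ⊔ Ideal.ofList (lastVars k n c)) t =
      (capMon e c t).card := by
  have h := quotHilb_sup_ofList_of_regularOn (forall₂_append_lastVars hf) isHomogeneousIdeal_bot hreg
  rw [bot_sup_eq, Ideal.ofList_append, ofList_ofFn] at h
  rw [h, shiftSubs, List.foldl_append]
  obtain ⟨j, rfl⟩ := Nat.exists_eq_add_of_le hcn
  have h1 := shiftSubs_ofFn k hcn e
  have h2 := shiftSubs_replicate_one le_rfl e j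
  rw [Nat.add_sub_cancel_left]
  rw [shiftSubs] at h1 h2
  rw [h1, h2]

theorem isHomogeneousIdeal_span_range {f : Fin c → MvPolynomial (Fin n) k} {e : Fin c → ℕ}
    (hf : ∀ i, (f i).IsHomogeneous (e i)) : IsHomogeneousIdeal (Ideal.span (Set.range f)) := by
  refine isHomogeneousIdeal_span ?_
  rintro _ ⟨i, rfl⟩
  exact ⟨e i, hf i⟩

/-- If `f` followed by the last variables is a regular sequence, then the reduction of `f` modulo
any number of them has the Hilbert function of a complete intersection. -/
theorem quotHilb_map_modLastVars_of_regularOn (hcn : c ≤ n) {f : Fin c → MvPolynomial (Fin n) k}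
    {e : Fin c → ℕ} (hf : ∀ i, (f i).IsHomogeneous (e i))
    (hreg : RegularOn ⊥ (List.ofFn f ++ lastVars k n c)) (hcm : c ≤ m) (hmn : m ≤ n) (t : ℕ) :
    quotHilb ((Ideal.span (Set.range f)).map (modLastVars k n m)) t = (capMon e m t).card := by
  rw [quotHilb_map_modLastVars hmn]
  set I : ℕ → Ideal (MvPolynomial (Fin n) k) :=
    fun m => Ideal.span (Set.range f) ⊔ Ideal.ofList (lastVars k n m) with hI
  have hIh : ∀ m, IsHomogeneousIdeal (I m) := fun m =>
    (isHomogeneousIdeal_span_range hf).sup isHomogeneousIdeal_ofList_lastVars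
  have hstep : ∀ m, m < n → ∀ t, shiftSub 1 (quotHilb (I (m + 1))) t ≤ quotHilb (I m) t := by
    intro m hm t
    rw [show I m = I (m + 1) ⊔ Ideal.span {X ⟨m, hm⟩} by
      rw [hI, sup_assoc, ← ofList_lastVars_eq_sup hm]]
    exact shiftSub_le_quotHilb (hIh _) (isHomogeneous_X _ _) t
  -- the bound from above starts from the whole sequence, and the bound from below from `f` alone
  have hupper : ∀ m, c ≤ m → m ≤ n → ∀ t, quotHilb (I m) t ≤ (capMon e m t).card := by
    intro m hcm
    induction m, hcm using Nat.le_induction with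
    | base => exact fun _ t => (quotHilb_append_lastVars hcn hf hreg t).le
    | succ m hm ih =>
      intro hmn
      refine le_of_shiftSub_le le_rfl (z := fun t => ((capMon e (m + 1) t).card : ℤ)) fun t => ?_
      rw [shiftSub_one_card_capMon hm]
      exact (hstep m (by omega) t).trans (ih (by omega) t)
  have hlower : ∀ j m, m + j = n → c ≤ m → ∀ t, ((capMon e m t).card : ℤ) ≤ quotHilb (I m) t := by
    intro j
    induction j with
    | zero =>
      intro m hmn hcm t
      obtain rfl : m = n := hmn
      simp only [hI]
      rw [lastVars_self, Ideal.ofList_nil, sup_bot_eq,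
        quotHilb_span_of_regularOn hf ((regularOn_append _ _ _).1 hreg).1, shiftSubs_ofFn k hcm]
    | succ j ih =>
      intro m hmn hcm t
      have heq : quotHilb (I (m + 1)) = fun t => ((capMon e (m + 1) t).card : ℤ) :=
        funext fun t => le_antisymm (hupper _ (by omega) (by omega) t)
          (ih _ (by omega) (by omega) t)
      have := hstep m (by omega) t
      rwa [heq, shiftSub_one_card_capMon hcm] at this
  exact le_antisymm (hupper m hcm hmn t) (hlower (n - m) m (by omega) hcm t)

end ModLastVars

section Reduction

variable {k : Type u} [Field k] {n c : ℕ}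

theorem hilb_eq_of_quotHilb_eq {I : Ideal (MvPolynomial (Fin n) k)} {e : Fin c → ℕ} {t : ℕ}
    (h : quotHilb I t = (capMon e n t).card) : hilb I t = hilb (powerIdeal k n e) t :=
  (hilb_eq_iff_quotHilb_eq t).2 (h.trans (quotHilb_powerIdeal k n e t).symm)

theorem hilb_span_of_regularOn (hcn : c ≤ n) {f : Fin c → MvPolynomial (Fin n) k} {e : Fin c → ℕ}
    (hf : ∀ i, (f i).IsHomogeneous (e i)) (h : RegularOn ⊥ (List.ofFn f)) (t : ℕ) :
    hilb (Ideal.span (Set.range f)) t = hilb (powerIdeal k n e) t :=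
  hilb_eq_of_quotHilb_eq (by rw [quotHilb_span_of_regularOn hf h, shiftSubs_ofFn k hcn])

/-- Both conjectures for the reduction modulo the last variables imply both for the sequence
itself: the variables are put back one at a time. -/
theorem lexGrowth_and_lexBetti_of_reduction (hcn : c ≤ n) {e : Fin c → ℕ} (he : Monotone e)
    {f : Fin c → MvPolynomial (Fin n) k} (hf : ∀ i, (f i).IsHomogeneous (e i))
    (hreg : RegularOn ⊥ (List.ofFn f ++ lastVars k n c))
    (h1 : SatisfiesEGH (fun i => modLastVars k n c (f i)) e)
    (h2 : SatisfiesLPP (fun i => modLastVars k n c (f i)) e) :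
    LexGrowth e (Ideal.span (Set.range f)) ∧ LexBetti e (Ideal.span (Set.range f)) := by
  have hab : ∀ m, c ≤ m → m ≤ n → ∀ t,
      hilb ((Ideal.span (Set.range f)).map (modLastVars k n m)) t = hilb (powerIdeal k m e) t :=
    fun m hcm hmn t =>
      hilb_eq_of_quotHilb_eq (quotHilb_map_modLastVars_of_regularOn hcn hf hreg hcm hmn t)
  have key : ∀ m, c ≤ m → m ≤ n →
      LexGrowth e ((Ideal.span (Set.range f)).map (modLastVars k n m)) ∧
      LexBetti e ((Ideal.span (Set.range f)).map (modLastVars k n m)) := by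
    intro m hcm
    induction m, hcm using Nat.le_induction with
    | base =>
      intro _
      have := hab c le_rfl hcn
      rw [map_modLastVars_span] at this ⊢
      exact (satisfies_iff he (fun i => isHomogeneous_modLastVars (hf i)) this).1 ⟨h1, h2⟩
    | succ m hcm ih =>
      intro hmn
      obtain ⟨ih1, ih2⟩ := ih (by omega)
      have hh : IsHomogeneousIdeal
          ((Ideal.span (Set.range f)).map (modLastVars k n (m + 1))) := by
        rw [map_modLastVars_span]
        exact isHomogeneousIdeal_span_range fun i => isHomogeneous_modLastVars (hf i)
      have hab' := hab m hcm (by omega)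
      rw [← map_modLastVars_succ] at ih1 ih2 hab'
      exact ⟨ih1.lift hcm he hh (hab _ (by omega) hmn) hab', LexBetti.lift hcm hh hab' ih1 ih2⟩
  have := key n hcn le_rfl
  rwa [map_modLastVars_self] at this

theorem isRegular_iff {R : Type*} [CommRing R] {ps : List R} :
    RingTheory.Sequence.IsRegular R ps ↔ RegularOn ⊥ ps ∧ Ideal.ofList ps ≠ ⊤ := by
  constructor
  · intro h
    refine ⟨(isWeaklyRegular_iff_regularOn ps).1 h.toIsWeaklyRegular, fun htop => ?_⟩
    have := h.top_ne_smul
    rw [smul_eq_mul, Ideal.mul_top, htop] at this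
    exact this rfl
  · rintro ⟨h1, h2⟩
    refine ⟨(isWeaklyRegular_iff_regularOn ps).2 h1, fun h => ?_⟩
    rw [smul_eq_mul, Ideal.mul_top] at h
    exact h2 h.symm

theorem le_of_isRegular {f : Fin c → MvPolynomial (Fin n) k} {e : Fin c → ℕ}
    (hf : ∀ i, (f i).IsHomogeneous (e i))
    (hreg : RingTheory.Sequence.IsRegular (MvPolynomial (Fin n) k) (List.ofFn f)) : c ≤ n := by
  obtain ⟨h1, h2⟩ := isRegular_iff.1 hreg
  simpa using length_le_of_regularOn (forall₂_ofFn hf) h1 h2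

end Reduction

section Transfer

variable {k : Type u} [Field k] {K : Type v} [Field K] [Algebra k K] {n c : ℕ}

/-- Both conjectures descend to a sequence from its reduction, after an extension of the base field
and a linear change of coordinates. -/
theorem satisfies_of_reduction {e : Fin c → ℕ} (he : Monotone e)
    {f : Fin c → MvPolynomial (Fin n) k} (hf : ∀ i, (f i).IsHomogeneous (e i))
    (hreg : RingTheory.Sequence.IsRegular (MvPolynomial (Fin n) k) (List.ofFn f))
    (g : GL (Fin n) K) {f' : Fin c → MvPolynomial (Fin n) K}
    (hf' : ∀ i, f' i = changeCoords g (MvPolynomial.map (algebraMap k K) (f i)))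
    (hreg' : RegularOn ⊥ (List.ofFn f' ++ lastVars K n c))
    (h1 : SatisfiesEGH (fun i => modLastVars K n c (f' i)) e)
    (h2 : SatisfiesLPP (fun i => modLastVars K n c (f' i)) e) :
    SatisfiesEGH f e ∧ SatisfiesLPP f e := by
  have hcn := le_of_isRegular hf hreg
  refine satisfies_of_extension K g he hf (hilb_span_of_regularOn hcn hf (isRegular_iff.1 hreg).1)
    hf' (lexGrowth_and_lexBetti_of_reduction hcn he (fun i => ?_) hreg' h1 h2)
  rw [hf']
  exact isHomogeneous_changeCoords g ((hf i).map _)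

end Transfer

/-! ### Depth and the Koszul complex -/

section KoszulHomotopy

variable {k : Type*} [Field k] {V : Type*} [AddCommGroup V] [Module k V] {n : ℕ}

/-- The exterior multiplication by a basis vector is a homotopy between zero and the
multiplication by the corresponding variable. -/
theorem kosz_wedge (X : Fin n → Module.End k V) (v : Fin n) (φ : Finset (Fin n) → V) :
    kosz X (wedge k V v φ) = onCoeff (X v) φ - wedge k V v (kosz X φ) := by
  have h : ∀ w, contr k V w (wedge k V v φ) =
      (if w = v then φ else 0) - wedge k V v (contr k V w φ) := by
    intro w
    rw [← Module.End.mul_apply, contr_mul_wedge, LinearMap.sub_apply, Module.End.mul_apply]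
    split_ifs <;> rfl
  rw [kosz_apply, kosz_apply, map_sum]
  simp only [h, map_sub, Finset.sum_sub_distrib, onCoeff_wedge]
  congr 1
  rw [Finset.sum_eq_single v]
  · rw [if_pos rfl]
  · intro w _ hw
    rw [if_neg hw, map_zero]
  · simp

end KoszulHomotopy

section Depth

variable {k : Type u} [Field k] {n : ℕ}

/-- The quotient of the division by the variable `x_v`. -/
noncomputable def divX (v : Fin n) : Module.End k (MvPolynomial (Fin n) k) where
  toFun p := p.divMonomial (Finsupp.single v 1)
  map_add' p q := add_divMonomial p q _
  map_smul' a p := by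
    ext u
    simp

theorem divX_apply (v : Fin n) (p : MvPolynomial (Fin n) k) :
    divX v p = p.divMonomial (Finsupp.single v 1) := rfl

theorem divX_X_mul (v : Fin n) (p : MvPolynomial (Fin n) k) : divX v (X v * p) = p :=
  X_mul_divMonomial v p

theorem divX_X_mul_of_ne {v w : Fin n} (h : w ≠ v) (p : MvPolynomial (Fin n) k) :
    divX v (X w * p) = X w * divX v p := by
  ext u
  rw [divX_apply, divX_apply, coeff_divMonomial, coeff_X_mul', coeff_X_mul', coeff_divMonomial]
  have h1 : (Finsupp.single v 1 + u : Fin n →₀ ℕ) w = u w := by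
    rw [Finsupp.add_apply, Finsupp.single_eq_of_ne h, zero_add]
  simp only [Finsupp.mem_support_iff, h1]
  split_ifs with h2
  · rw [add_tsub_assoc_of_le]
    exact Finsupp.single_le_iff.2 (Nat.one_le_iff_ne_zero.2 h2)
  · rfl

theorem koszulD_apply (φ : Finset (Fin n) → MvPolynomial (Fin n) k) (T : Finset (Fin n)) :
    koszulD k n φ T =
      ∑ v ∈ Tᶜ, (-1) ^ (T.filter (· < v)).card * X v * φ (insert v T) := by
  simp [koszulD, LinearMap.sum_apply, mul_assoc]

/-- On cycles, `φ ↦ e_v ∧ (φ / x_v)` is a homotopy between the identity and the projection that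
kills `e_v` and sets `x_v` to zero. -/
theorem sub_koszulD_wedge_divX (v : Fin n) {φ : Finset (Fin n) → MvPolynomial (Fin n) k}
    (hφ : koszulD k n φ = 0) (S : Finset (Fin n)) :
    φ S - koszulD k n (wedge k _ v (onCoeff (divX v) φ)) S =
      if v ∈ S then 0 else φ S - X v * divX v (φ S) := by
  set η : Finset (Fin n) → MvPolynomial (Fin n) k := fun S => φ S - X v * divX v (φ S) with hη
  have h1 : koszulD k n (onCoeff (divX v) φ) = -contr k _ v η := by
    have h2 : koszulD k n (onCoeff (divX v) φ) + contr k _ v η = onCoeff (divX v) (koszulD k n φ) := by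
      rw [← kosz_mulX, kosz_apply, kosz_apply, map_sum, ← Finset.add_sum_erase Finset.univ _ (Finset.mem_univ v),
        ← Finset.add_sum_erase Finset.univ (fun w => onCoeff (divX v)
          (onCoeff (mulX k n w) (contr k _ w φ))) (Finset.mem_univ v), add_right_comm]
      congr 1
      · rw [← onCoeff_contr]
        funext T
        simp only [Pi.add_apply, onCoeff_apply, contr_apply, mulX_apply]
        split_ifs
        · simp
        · rw [hη]
          simp only [Units.smul_def, mul_smul_comm, map_zsmul, smul_sub, divX_X_mul]
          abel
      · refine Finset.sum_congr rfl fun w hw => ?_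
        rw [← onCoeff_contr]
        funext T
        simp only [onCoeff_apply, mulX_apply]
        rw [divX_X_mul_of_ne (Finset.ne_of_mem_erase hw)]
    rw [hφ, map_zero] at h2
    exact eq_neg_of_add_eq_zero_left h2
  rw [← kosz_mulX, kosz_wedge, kosz_mulX, h1, map_neg, sub_neg_eq_add]
  simp only [Pi.add_apply, onCoeff_apply, mulX_apply, wedge_apply, contr_apply, divX_apply]
  by_cases hv : v ∈ S
  · rw [if_pos hv, if_pos hv, if_neg (Finset.notMem_erase v S), smul_smul, extSign_mul_self,
      one_smul, Finset.insert_erase hv, hη]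
    simp only [divX_apply]
    ring
  · rw [if_neg hv, if_neg hv]
    ring

theorem koszulD_eq_zero_of_card {i : ℕ} {φ : Finset (Fin n) → MvPolynomial (Fin n) k}
    (hφ : ∀ S, S.card ≠ i + 1 → φ S = 0) (S : Finset (Fin n)) (hS : S.card ≠ i) :
    koszulD k n φ S = 0 := by
  rw [koszulD_apply]
  refine Finset.sum_eq_zero fun v hv => ?_
  rw [hφ _ (by rw [Finset.card_insert_of_notMem (Finset.mem_compl.1 hv)]; omega), mul_zero]

theorem koszulD_mem {I : Ideal (MvPolynomial (Fin n) k)}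
    {φ : Finset (Fin n) → MvPolynomial (Fin n) k} (hφ : ∀ S, φ S ∈ I) (S : Finset (Fin n)) :
    koszulD k n φ S ∈ I := by
  rw [koszulD_apply]
  exact I.sum_mem fun v _ => I.mul_mem_left _ (hφ _)

/-- The Koszul complex of the variables is exact in positive degrees. -/
theorem exists_koszulD_eq {i : ℕ} (hi : 0 < i) {φ : Finset (Fin n) → MvPolynomial (Fin n) k}
    (hφ : ∀ S, S.card ≠ i → φ S = 0) (hd : koszulD k n φ = 0) :
    ∃ χ, (∀ S, S.card ≠ i + 1 → χ S = 0) ∧ koszulD k n χ = φ := by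
  have key : ∀ s : Finset (Fin n), ∃ χ : Finset (Fin n) → MvPolynomial (Fin n) k,
      (∀ S, S.card ≠ i + 1 → χ S = 0) ∧
      ∀ S v, v ∈ S → v ∈ s → φ S - koszulD k n χ S = 0 := by
    intro s
    induction s using Finset.induction_on with
    | empty => exact ⟨0, by simp, by simp⟩
    | insert v s _ ih =>
      obtain ⟨χ, hχ, hχ'⟩ := ih
      have hcyc : koszulD k n (φ - koszulD k n χ) = 0 := by
        rw [map_sub, hd, koszulD_koszulD, sub_zero]
      set ψ := wedge k _ v (onCoeff (divX v) (φ - koszulD k n χ)) with hψ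
      refine ⟨χ + ψ, fun S hS => ?_, fun S w hwS hw => ?_⟩
      · rw [Pi.add_apply, hχ S hS, zero_add, hψ, wedge_apply]
        split_ifs with hv
        · have hS' : (S.erase v).card ≠ i := by
            rw [Finset.card_erase_of_mem hv]
            have := Finset.card_pos.2 ⟨v, hv⟩
            omega
          rw [onCoeff_apply, Pi.sub_apply, hφ _ hS', koszulD_eq_zero_of_card hχ _ hS', sub_zero,
            map_zero, smul_zero]
        · rfl
      · have h := sub_koszulD_wedge_divX v hcyc S
        rw [← hψ, Pi.sub_apply] at h
        rw [map_add, Pi.add_apply, ← sub_sub, h]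
        split_ifs with hv
        · rfl
        · rcases Finset.mem_insert.1 hw with rfl | hw
          · exact absurd hwS hv
          · rw [hχ' S w hwS hw, map_zero, mul_zero, sub_zero]
  obtain ⟨χ, hχ, hχ'⟩ := key Finset.univ
  refine ⟨χ, hχ, funext fun S => ?_⟩
  rcases S.eq_empty_or_nonempty with rfl | ⟨v, hv⟩
  · have h0 : (∅ : Finset (Fin n)).card ≠ i := by simp; omega
    rw [hφ _ h0, koszulD_eq_zero_of_card hχ _ h0]
  · exact (sub_eq_zero.1 (hχ' S v hv (Finset.mem_univ v))).symm

/-- The Koszul homology of `A ⧸ I` vanishes in the degrees above `r`. -/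
def KoszulVanishes (I : Ideal (MvPolynomial (Fin n) k)) (r : ℕ) : Prop :=
  ∀ i, r < i → ∀ φ : Finset (Fin n) → MvPolynomial (Fin n) k, (∀ S, S.card ≠ i → φ S = 0) →
    (∀ S, koszulD k n φ S ∈ I) →
    ∃ χ, (∀ S, S.card ≠ i + 1 → χ S = 0) ∧ ∀ S, φ S - koszulD k n χ S ∈ I

theorem koszulVanishes_bot : KoszulVanishes (⊥ : Ideal (MvPolynomial (Fin n) k)) 0 := by
  intro i hi φ hφ hd
  obtain ⟨χ, hχ, h⟩ := exists_koszulD_eq hi hφ (funext fun S => hd S)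
  exact ⟨χ, hχ, fun S => by rw [h, sub_self]; exact Ideal.zero_mem _⟩

/-- Division by a nonzerodivisor raises the degrees of the nonzero Koszul homology by at most one. -/
theorem KoszulVanishes.sup {I : Ideal (MvPolynomial (Fin n) k)} {r : ℕ} (h : KoszulVanishes I r)
    {p : MvPolynomial (Fin n) k} (hp : ∀ x, p * x ∈ I → x ∈ I) :
    KoszulVanishes (I ⊔ Ideal.span {p}) (r + 1) := by
  intro i hi φ hφ hd
  obtain ⟨j, rfl⟩ : ∃ j, i = j + 1 := ⟨i - 1, by omega⟩
  have hdec : ∀ S, ∃ y, koszulD k n φ S - p * y ∈ I ∧ (S.card ≠ j → y = 0) := by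
    intro S
    by_cases hS : S.card = j
    · obtain ⟨a, ha, w, hw, haw⟩ := Submodule.mem_sup.1 (hd S)
      obtain ⟨y, rfl⟩ := Ideal.mem_span_singleton'.1 hw
      refine ⟨y, ?_, fun h => absurd hS h⟩
      rw [← haw, mul_comm y p, add_sub_cancel_right]
      exact ha
    · refine ⟨0, ?_, fun _ => rfl⟩
      rw [koszulD_eq_zero_of_card hφ S hS, mul_zero, sub_zero]
      exact I.zero_mem
  choose ψ hψ hψ0 using hdec
  have hmul : ∀ χ : Finset (Fin n) → MvPolynomial (Fin n) k, ∀ S,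
      koszulD k n (fun S => p * χ S) S = p * koszulD k n χ S := by
    intro χ S
    rw [koszulD_apply, koszulD_apply, Finset.mul_sum]
    exact Finset.sum_congr rfl fun v _ => by ring
  -- as `φ` has the boundary `p ψ` modulo `I`, the chain `ψ` is a cycle modulo `I`
  have hψd : ∀ S, koszulD k n ψ S ∈ I := by
    intro S
    refine hp _ ?_
    have h1 := koszulD_mem (I := I) (φ := koszulD k n φ - fun S => p * ψ S) (fun S => hψ S) S
    rw [map_sub, koszulD_koszulD, zero_sub, Pi.neg_apply, hmul] at h1
    exact I.neg_mem_iff.1 h1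
  obtain ⟨χ, hχ, hχ'⟩ := h j (by omega) ψ hψ0 hψd
  -- as `ψ` is the boundary of `χ` modulo `I`, the chain `φ - p χ` is a cycle modulo `I`
  obtain ⟨ξ, hξ, hξ'⟩ := h (j + 1) (by omega) (φ - fun S => p * χ S)
    (fun S hS => by rw [Pi.sub_apply, hφ S hS, hχ S hS, mul_zero, sub_zero]) (fun S => by
      rw [map_sub, Pi.sub_apply, hmul]
      have := I.add_mem (hψ S) (I.mul_mem_left p (hχ' S))
      rwa [mul_sub, sub_add_sub_cancel] at this)
  refine ⟨ξ, hξ, fun S => ?_⟩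
  have h1 : φ S - koszulD k n ξ S = (φ S - p * χ S - koszulD k n ξ S) + p * χ S := by ring
  rw [h1]
  exact Ideal.add_mem _ (Ideal.mem_sup_left (hξ' S))
    (Ideal.mem_sup_right (Ideal.mul_mem_right _ _ (Ideal.mem_span_singleton_self p)))

theorem KoszulVanishes.sup_ofList {I : Ideal (MvPolynomial (Fin n) k)} {r : ℕ}
    (h : KoszulVanishes I r) {ps : List (MvPolynomial (Fin n) k)} (hps : RegularOn I ps) :
    KoszulVanishes (I ⊔ Ideal.ofList ps) (r + ps.length) := by
  induction ps generalizing I r with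
  | nil => simpa using h
  | cons p ps ih =>
    have := ih (h.sup hps.1) hps.2
    rwa [sup_assoc, ← Ideal.ofList_cons, add_assoc, add_comm 1, ← List.length_cons] at this

/-- A quotient of `k[x₁, …, xₙ]` by a regular sequence of fewer than `n` elements has no socle. -/
theorem mem_of_forall_X_mul_mem {ps : List (MvPolynomial (Fin n) k)} (hps : RegularOn ⊥ ps)
    (hlen : ps.length < n) {x : MvPolynomial (Fin n) k}
    (hx : ∀ v, X v * x ∈ Ideal.ofList ps) : x ∈ Ideal.ofList ps := by
  have h := koszulVanishes_bot.sup_ofList hps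
  rw [bot_sup_eq, zero_add] at h
  obtain ⟨χ, hχ, hχ'⟩ := h n hlen (fun S => if S = Finset.univ then x else 0)
    (fun S hS => if_neg (by rintro rfl; simp at hS)) (fun S => by
      rw [koszulD_apply]
      refine Ideal.sum_mem _ fun v _ => ?_
      split_ifs
      · rw [mul_assoc]
        exact Ideal.mul_mem_left _ _ (hx v)
      · rw [mul_zero]
        exact Ideal.zero_mem _)
  have h0 : χ = 0 := funext fun S => hχ S (by
    have := Finset.card_le_univ S
    rw [Fintype.card_fin] at this
    omega)
  have := hχ' Finset.univ
  rwa [h0, map_zero, Pi.zero_apply, sub_zero, if_pos rfl] at this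

end Depth

/-! ### Generic linear forms -/

section LinearForms

variable {k : Type u} [Field k] {n c : ℕ}

/-- The linear form with given coefficients. -/
noncomputable def linForm : (Fin n → k) →ₗ[k] MvPolynomial (Fin n) k :=
  Fintype.linearCombination k X

theorem linForm_apply (b : Fin n → k) : linForm b = ∑ j, C (b j) * X j := by
  rw [linForm, Fintype.linearCombination_apply]
  exact Finset.sum_congr rfl fun j _ => smul_eq_C_mul _ _

theorem linForm_single (v : Fin n) : linForm (Pi.single v (1 : k)) = X v := by
  rw [linForm, Fintype.linearCombination_apply_single, one_smul]

theorem changeCoords_linForm (g : GL (Fin n) k) (b : Fin n → k) :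
    changeCoords g (linForm b) = linForm ((g : Matrix (Fin n) (Fin n) k).mulVec b) := by
  rw [linForm_apply, linForm_apply, map_sum]
  simp only [map_mul, changeCoords_X, Matrix.mulVec, dotProduct, map_sum, Finset.sum_mul,
    Finset.mul_sum]
  rw [Finset.sum_comm]
  refine Finset.sum_congr rfl fun i _ => Finset.sum_congr rfl fun j _ => ?_
  rw [← algebraMap_eq, AlgHom.commutes]
  ring

/-- Modulo a regular sequence of fewer than `n` elements, a linear form that avoids the associated
primes is a nonzerodivisor; over an infinite field it can also be taken outside a given proper
subspace. -/
theorem exists_linForm_regular [Infinite k] {ps : List (MvPolynomial (Fin n) k)}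
    (hps : RegularOn ⊥ ps) (hlen : ps.length < n) {U : Submodule k (Fin n → k)} (hU : U ≠ ⊤) :
    ∃ b, b ∉ U ∧ ∀ x, linForm b * x ∈ Ideal.ofList ps → x ∈ Ideal.ofList ps := by
  classical
  set I := Ideal.ofList ps with hI
  have hfin := associatedPrimes.finite (MvPolynomial (Fin n) k) (MvPolynomial (Fin n) k ⧸ I)
  set s : Finset (Submodule k (Fin n → k)) :=
    insert U (hfin.toFinset.image fun P => (P.restrictScalars k).comap linForm) with hs
  have htop : ⊤ ∉ s := by
    rw [hs, Finset.mem_insert, Finset.mem_image]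
    rintro (h | ⟨P, hP, h⟩)
    · exact hU h.symm
    · rw [Set.Finite.mem_toFinset, AssociatedPrimes.mem_iff, isAssociatedPrime_iff] at hP
      obtain ⟨hprime, x, hx⟩ := hP
      obtain ⟨x, rfl⟩ := Ideal.Quotient.mk_surjective x
      have hcolon : ∀ y, y ∈ P ↔ y * x ∈ I := by
        intro y
        rw [hx, Submodule.mem_colon_singleton, Submodule.mem_bot, ← Ideal.Quotient.eq_zero_iff_mem,
          map_mul]
        rfl
      -- an associated prime that contains all variables would come from a socle element
      have hxI : x ∈ I := mem_of_forall_X_mul_mem hps hlen fun v => by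
        rw [← hcolon, ← linForm_single]
        have : Pi.single v (1 : k) ∈ (P.restrictScalars k).comap linForm := h ▸ Submodule.mem_top
        exact this
      exact hprime.ne_top ((Ideal.eq_top_iff_one _).2 ((hcolon 1).2 (by rwa [one_mul])))
  obtain ⟨b, hb⟩ := (Set.ne_univ_iff_exists_notMem _).1
    (Subspace.biUnion_ne_univ_of_top_notMem htop)
  simp only [Set.mem_iUnion, not_exists] at hb
  refine ⟨b, hb U (Finset.mem_insert_self _ _), fun x hx => ?_⟩
  by_contra hxI
  have hmem : linForm b ∈ {r : MvPolynomial (Fin n) k |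
      ∃ x : MvPolynomial (Fin n) k ⧸ I, x ≠ 0 ∧ r • x = 0} :=
    ⟨Ideal.Quotient.mk I x, fun h => hxI (Ideal.Quotient.eq_zero_iff_mem.1 h),
      Ideal.Quotient.eq_zero_iff_mem.2 hx⟩
  rw [← biUnion_associatedPrimes_eq_zero_divisors] at hmem
  obtain ⟨P, hP, hbP⟩ := Set.mem_iUnion₂.1 hmem
  exact hb _ (Finset.mem_insert_of_mem (Finset.mem_image_of_mem _ (hfin.mem_toFinset.2 hP))) hbP

/-- Over an infinite field, a regular sequence extends by independent linear forms up to length `n`. -/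
theorem exists_linForms_regular [Infinite k] {f : Fin c → MvPolynomial (Fin n) k}
    (hreg : RegularOn ⊥ (List.ofFn f)) (j : ℕ) (hj : c + j ≤ n) :
    ∃ a : Fin j → Fin n → k, LinearIndependent k a ∧
      RegularOn ⊥ (List.ofFn f ++ List.ofFn fun i => linForm (a i)) := by
  induction j with
  | zero => exact ⟨Fin.elim0, linearIndependent_empty_type, by simpa using hreg⟩
  | succ j ih =>
    obtain ⟨a, ha, har⟩ := ih (by omega)
    have hU : Submodule.span k (Set.range a) ≠ ⊤ := by
      intro h
      have h1 := finrank_range_le_card (R := k) a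
      rw [Set.finrank, h, finrank_top, Module.finrank_fin_fun, Fintype.card_fin] at h1
      omega
    obtain ⟨b, hb, hbr⟩ := exists_linForm_regular har (by simp; omega) hU
    refine ⟨Fin.snoc a b, linearIndependent_finSnoc.2 ⟨ha, hb⟩, ?_⟩
    rw [List.ofFn_succ', List.concat_eq_append, ← List.append_assoc, regularOn_append]
    simp only [Fin.snoc_castSucc, Fin.snoc_last]
    exact ⟨har, by rwa [bot_sup_eq], trivial⟩

/-- Independent vectors can be moved to the last standard basis vectors. -/
theorem exists_GL_mulVec_eq {j : ℕ} {a : Fin j → Fin (c + j) → k} (ha : LinearIndependent k a) :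
    ∃ g : GL (Fin (c + j)) k, ∀ i,
      (g : Matrix (Fin (c + j)) (Fin (c + j)) k).mulVec (a i) = Pi.single (Fin.natAdd c i) 1 := by
  set b := Module.Basis.sumExtend ha with hb
  have hbi : ∀ i, b (Sum.inl i) = a i := by
    intro i
    rw [hb]
    simp only [Module.Basis.sumExtend, Module.Basis.coe_reindex, Module.Basis.coe_extend, Function.comp_apply]
    rfl
  have : Finite (Fin j ⊕ Module.Basis.sumExtendIndex ha) := Module.Finite.finite_basis b
  have hfin : Finite (Module.Basis.sumExtendIndex ha) := 
    Finite.of_injective (Sum.inr (α := Fin j)) Sum.inr_injective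
  have hcard : Nat.card (Module.Basis.sumExtendIndex ha) = c := by
    have h := Module.finrank_eq_nat_card_basis b
    rw [Module.finrank_fin_fun, Nat.card_sum, Nat.card_fin] at h
    omega
  obtain ⟨ε⟩ : Nonempty (Module.Basis.sumExtendIndex ha ≃ Fin c) := ⟨Finite.equivFinOfCardEq hcard⟩
  set b' := b.reindex ((Equiv.sumComm _ _).trans ((Equiv.sumCongr ε (Equiv.refl _)).trans
    finSumFinEquiv)) with hb'
  have hbi' : ∀ i, b' (Fin.natAdd c i) = a i := by
    intro i
    rw [hb', Module.Basis.reindex_apply, ← hbi]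
    congr 1
    simp
  refine ⟨⟨LinearMap.toMatrix' b'.equivFun.toLinearMap, LinearMap.toMatrix' b'.equivFun.symm.toLinearMap,
    ?_, ?_⟩, fun i => ?_⟩
  · rw [← LinearMap.toMatrix'_comp]
    simp
  · rw [← LinearMap.toMatrix'_comp]
    simp
  · show (LinearMap.toMatrix' b'.equivFun.toLinearMap).mulVec (a i) = _
    rw [LinearMap.toMatrix'_mulVec, ← hbi']
    simp [Finsupp.single_eq_pi_single]

theorem lastVars_eq_ofFn (c j : ℕ) :
    lastVars k (c + j) c = List.ofFn fun i : Fin j => X (Fin.natAdd c i) := by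
  rw [lastVars, ← List.ofFn_id, List.ofFn_add, List.filter_append, List.filter_eq_nil_iff.2,
    List.filter_eq_self.2, List.nil_append, List.map_ofFn]
  · rfl
  · simp [List.mem_ofFn]
  · simp [List.mem_ofFn]

end LinearForms

/-! ### Reduction to the Artinian case -/

section Artinian

variable {k : Type u} [Field k] {n c : ℕ}

theorem span_range_ne_top {f : Fin c → MvPolynomial (Fin n) k} {e : Fin c → ℕ}
    (hf : ∀ i, (f i).IsHomogeneous (e i)) (he : ∀ i, 1 ≤ e i) :
    Ideal.span (Set.range f) ≠ ⊤ := by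
  intro h
  have hle : Ideal.span (Set.range f) ≤ RingHom.ker (constantCoeff (R := k) (σ := Fin n)) := by
    rw [Ideal.span_le]
    rintro _ ⟨i, rfl⟩
    refine (hf i).coeff_eq_zero ?_
    have := he i
    rw [map_zero]
    omega
  have h1 := hle (h ▸ Submodule.mem_top : (1 : MvPolynomial (Fin n) k) ∈ _)
  rw [RingHom.mem_ker, map_one] at h1
  exact one_ne_zero h1

theorem one_le_degree {f : Fin c → MvPolynomial (Fin n) k} {e : Fin c → ℕ}
    (hf : ∀ i, (f i).IsHomogeneous (e i))
    (hreg : RingTheory.Sequence.IsRegular (MvPolynomial (Fin n) k) (List.ofFn f)) (i : Fin c) :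
    1 ≤ e i := by
  obtain ⟨h1, h2⟩ := isRegular_iff.1 hreg
  exact one_le_degree_of_regularOn (forall₂_ofFn hf) h1 (by rwa [bot_sup_eq]) _
    (List.mem_ofFn.2 ⟨i, rfl⟩)

/-- Regular sequences of forms are recognized by their Hilbert functions. -/
theorem regularOn_of_hilb_le (hcn : c ≤ n) {f : Fin c → MvPolynomial (Fin n) k} {e : Fin c → ℕ}
    (hf : ∀ i, (f i).IsHomogeneous (e i)) (he : ∀ i, 1 ≤ e i)
    (h : ∀ t, quotHilb (Ideal.span (Set.range f)) t ≤ (capMon e n t).card) :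
    RegularOn ⊥ (List.ofFn f) := by
  refine regularOn_of_quotHilb_le (forall₂_ofFn hf) (fun d hd => ?_) isHomogeneousIdeal_bot ?_
  · obtain ⟨i, rfl⟩ := List.mem_ofFn.1 hd
    exact he i
  · rw [bot_sup_eq, ofList_ofFn, shiftSubs_ofFn k hcn]
    exact h

variable {K : Type v} [Field K] [Algebra k K]

theorem hilb_le_hilb_map (I : Ideal (MvPolynomial (Fin n) k)) (t : ℕ) :
    hilb I t ≤ hilb (I.map (map (σ := Fin n) (algebraMap k K))) t := by
  rw [hilb, ← finrank_extSpan (K := K) preservesIndep_extPoly (gradedPart I t), hilb]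
  refine Submodule.finrank_mono (Submodule.span_le.2 ?_)
  rintro _ ⟨p, hp, rfl⟩
  exact ⟨Ideal.mem_map_of_mem _ hp.1, hp.2.map _⟩

/-- Regular sequences of forms remain regular over an extension field. -/
theorem regularOn_map (hcn : c ≤ n) {f : Fin c → MvPolynomial (Fin n) k} {e : Fin c → ℕ}
    (hf : ∀ i, (f i).IsHomogeneous (e i)) (he : ∀ i, 1 ≤ e i) (hreg : RegularOn ⊥ (List.ofFn f)) :
    RegularOn ⊥ (List.ofFn fun i => map (algebraMap k K) (f i)) := by
  refine regularOn_of_hilb_le hcn (fun i => (hf i).map _) he fun t => ?_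
  have h1 := hilb_le_hilb_map (K := K) (Ideal.span (Set.range f)) t
  rw [Ideal.map_span, ← Set.range_comp] at h1
  have h2 := hilb_span_of_regularOn hcn hf hreg t
  have h3 := hilb_powerIdeal_eq (n := n) k K e t
  have h4 := quotHilb_powerIdeal K n e t
  rw [quotHilb] at h4 ⊢
  change hilb _ t ≤ hilb (Ideal.span (Set.range fun i => map (algebraMap k K) (f i))) t at h1
  omega

theorem RegularOn.map_changeCoords (g : GL (Fin n) k) {ps : List (MvPolynomial (Fin n) k)}
    (h : RegularOn ⊥ ps) : RegularOn ⊥ (ps.map (changeCoords g)) := by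
  have := h.map (AlgEquiv.ofAlgHom (changeCoords g) (changeCoords g⁻¹)
    (AlgHom.ext fun p => changeCoords_inv g p)
    (AlgHom.ext fun p => by
      have := changeCoords_inv g⁻¹ p
      rwa [inv_inv] at this)).toRingEquiv
  rwa [Ideal.map_bot] at this

/-- Over an infinite field, a regular sequence can be continued by the last variables after a linear
change of coordinates. -/
theorem exists_changeCoords_regularOn [Infinite K] (hcn : c ≤ n)
    {f : Fin c → MvPolynomial (Fin n) K} (hreg : RegularOn ⊥ (List.ofFn f)) :
    ∃ g : GL (Fin n) K,
      RegularOn ⊥ ((List.ofFn fun i => changeCoords g (f i)) ++ lastVars K n c) := by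
  obtain ⟨j, rfl⟩ := Nat.exists_eq_add_of_le hcn
  obtain ⟨a, ha, har⟩ := exists_linForms_regular hreg j le_rfl
  obtain ⟨g, hg⟩ := exists_GL_mulVec_eq ha
  refine ⟨g, ?_⟩
  have := har.map_changeCoords g
  rw [List.map_append, List.map_ofFn, List.map_ofFn] at this
  rw [lastVars_eq_ofFn]
  have hX : (changeCoords g ∘ fun i => linForm (a i)) = fun i : Fin j => X (Fin.natAdd c i) :=
    funext fun i => by rw [Function.comp_apply, changeCoords_linForm, hg, linForm_single]
  rw [hX] at this
  exact this

/-- If `f` followed by the last variables is a regular sequence, then so is the reduction of `f`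
modulo the last variables. -/
theorem isRegular_modLastVars (hcn : c ≤ n) {f : Fin c → MvPolynomial (Fin n) k} {e : Fin c → ℕ}
    (hf : ∀ i, (f i).IsHomogeneous (e i)) (he : ∀ i, 1 ≤ e i)
    (hreg : RegularOn ⊥ (List.ofFn f ++ lastVars k n c)) :
    RingTheory.Sequence.IsRegular (MvPolynomial (Fin c) k)
      (List.ofFn fun i => modLastVars k n c (f i)) := by
  have hf' := fun i => isHomogeneous_modLastVars (m := c) (hf i)
  rw [isRegular_iff, ofList_ofFn]
  refine ⟨regularOn_of_hilb_le le_rfl hf' he fun t => ?_, span_range_ne_top hf' he⟩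
  rw [← map_modLastVars_span, quotHilb_map_modLastVars_of_regularOn hcn hf hreg le_rfl hcn]

end Artinian

end LexPlusPowers

theorem theorem4p1 {k : Type u} [Field k] (K : Type v) [Field K] [Algebra k K]
    (n c : ℕ) (e : Fin c → ℕ) (he : Monotone e)
    (f : Fin c → MvPolynomial (Fin n) k) (hf : ∀ i, (f i).IsHomogeneous (e i))
    (hreg : RingTheory.Sequence.IsRegular (MvPolynomial (Fin n) k) (List.ofFn f)) :
    -- the transfer from the reduction to `f`
    (∀ (g : GL (Fin n) K) (f' : Fin c → MvPolynomial (Fin n) K)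
      (fbar : Fin c → MvPolynomial (Fin c) K),
      (∀ i, f' i = LexPlusPowers.changeCoords g (MvPolynomial.map (algebraMap k K) (f i))) →
      RingTheory.Sequence.IsRegular (MvPolynomial (Fin n) K)
        (List.ofFn f' ++ LexPlusPowers.lastVars K n c) →
      (∀ i, fbar i = LexPlusPowers.modLastVars K n c (f' i)) →
      LexPlusPowers.SatisfiesEGH fbar e → LexPlusPowers.SatisfiesLPP fbar e →
      LexPlusPowers.SatisfiesEGH f e ∧ LexPlusPowers.SatisfiesLPP f e) ∧
    -- the reduction to the Artinian case
    (Infinite K →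
      (∀ h : Fin c → MvPolynomial (Fin c) K, (∀ i, (h i).IsHomogeneous (e i)) →
        RingTheory.Sequence.IsRegular (MvPolynomial (Fin c) K) (List.ofFn h) →
        LexPlusPowers.SatisfiesEGH h e ∧ LexPlusPowers.SatisfiesLPP h e) →
      LexPlusPowers.SatisfiesEGH f e ∧ LexPlusPowers.SatisfiesLPP f e) := by
  constructor
  · intro g f' fbar hf' hreg' hfbar h1 h2
    obtain rfl : fbar = fun i => LexPlusPowers.modLastVars K n c (f' i) := funext hfbar
    exact LexPlusPowers.satisfies_of_reduction he hf hreg g hf'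
      (LexPlusPowers.isRegular_iff.1 hreg').1 h1 h2
  · intro hK hart
    have hcn := LexPlusPowers.le_of_isRegular hf hreg
    have he1 := LexPlusPowers.one_le_degree hf hreg
    obtain ⟨g, hg⟩ := LexPlusPowers.exists_changeCoords_regularOn hcn
      (LexPlusPowers.regularOn_map (K := K) hcn hf he1 (LexPlusPowers.isRegular_iff.1 hreg).1)
    have hf' := fun i => LexPlusPowers.isHomogeneous_changeCoords g ((hf i).map (algebraMap k K))
    obtain ⟨h1, h2⟩ := hart _ (fun i => LexPlusPowers.isHomogeneous_modLastVars (hf' i))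
      (LexPlusPowers.isRegular_modLastVars hcn hf' he1 hg)
    exact LexPlusPowers.satisfies_of_reduction he hf hreg g (fun _ => rfl) hg h1 h2
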